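/- Multigraphs are finite, undirected and vertex-labelled, and may have loops and multiple edges. The weight $w(H)$ of a multigraph $H$ is the product of a factor $1/2$ for each loop, a factor $1/i!$ for each pair of distinct vertices joined by exactly $i$ edges, and a factor $1/i!$ for each vertex carrying exactly $i$ loops. For a finite set $\mathcal A$ of multigraphs let $|\mathcal A|=\sum_{H\in\mathcal A}w(H)$; a uniform random member of $\mathcal A$ equals $H\in\mathcal A$ with probability $w(H)/|\mathcal A|$. Let $H_1,H_2,H_3$ be connected multigraphs. $H_3$ is obtained from $H_1,H_2$ by a bridge insertion if $H_1,H_2$ are vertex-disjoint and there are distinct vertices $w,x$ outside $V(H_1)\cup V(H_2)$ and edges $y_1z_1$ of $H_1$ and $y_2z_2$ of $H_2$ (loops allowed) such that $V(H_3)=V(H_1)\cup V(H_2)\cup\{w,x\}$ and $E(H_3)$ is the multiset $E(H_1)+E(H_2)-y_1z_1-y_2z_2+wy_1+wz_1+wx+xy_2+xz_2$. Let $\mathcal B$ be a class of connected multigraphs, closed under relabelling of vertices, and let $\mathcal B(2n,3n)$ be the set of its members with vertex set $\{1,\dots,2n\}$ and exactly $3n$ edges. Call $\mathcal B$ bridge-stable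 with critical exponent $\alpha\in\mathbb R$ if (B1) whenever $H_3$ is obtained from $H_1,H_2$ by a bridge insertion, $H_1,H_2\in\mathcal B$ if and only if $H_3\in\mathcal B$; (B2) there are constants $\gamma,c>0$ with $|\mathcal B(2n,3n)|=(1+o(1))\,c\,n^{-\alpha}\gamma^n(2n)!$ as $n\to\infty$. A block of a multigraph is a maximal 2-connected subgraph (two vertices joined by at least two parallel edges count as 2-connected, a bridge does not), or a single vertex with a loop. Let $b_i(H)$ be the number of vertices of the $i$-th largest block of $H$, and $b_i(H)=0$ if $H$ has fewer than $i$ blocks. For random variables $X_n$ and $f\ge 0$, write $X_n=\Theta_p(f)$ if for every $\delta>0$ there are $c>0$ and $N$ with $\mathbb P(|X_n|\le c f(n))\ge 1-\delta$ for all $n\ge N$, and for every $\delta>0$ there are $c>0$ and $N$ with $\mathbb P(|X_n|\ge c f(n))\ge 1-\delta$ for all $n\ge N$. **Lemma.** Let $\mathcal B$ be a bridge-stable class of connected multigraphs with critical exponent $\alpha>3$, all of whose members in $\mathcal B(2n,3n)$, $n\ge1$, are cubic (3-regular), and let $G_n$ be a uniform random member of $\mathcal B(2n,3n)$. Then $$b_1(G_n)=\Theta_p(n),\qquad\text{and}\qquad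 b_i(G_n)=\Theta_p\bigl(n^{1/(\alpha-2)}\bigr)\quad\text{for every fixed } i\ge 2.$$ -/

import Mathlib

open Filter Asymptotics

/-- A finite vertex-labelled undirected multigraph, loops and multiple edges allowed. Its vertices
are labelled by natural numbers and its edges form a multiset of unordered pairs of vertices; the
pair `s(v, v)` is a loop at `v`. Parallel edges carry no labels of their own. -/
@[ext]
structure Multigraph where
  /-- the vertex set -/
  verts : Finset ℕ
  /-- the edges, with multiplicity -/
  edges : Multiset (Sym2 ℕ)
  /-- both ends of an edge are vertices -/
  incidence : ∀ e ∈ edges, ∀ v ∈ e, v ∈ verts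

namespace Multigraph

/-- The copy of `H` in which every vertex `v` is renamed to `σ v`. -/
def relabel (H : Multigraph) (σ : Equiv.Perm ℕ) : Multigraph where
  verts := H.verts.map σ.toEmbedding
  edges := H.edges.map (Sym2.map σ)
  incidence := by
    intro e he v hv
    obtain ⟨e', he', rfl⟩ := Multiset.mem_map.mp he
    obtain ⟨u, hu, rfl⟩ := Sym2.mem_map.mp hv
    exact Finset.mem_map.mpr ⟨u, H.incidence e' he' u hu, rfl⟩

/-- The subgraph induced by the vertices in `S`. -/
def induce (H : Multigraph) (S : Finset ℕ) : Multigraph where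
  verts := H.verts ∩ S
  edges := H.edges.filter (fun e => e ∈ S.sym2)
  incidence := by
    intro e he v hv
    obtain ⟨h₁, h₂⟩ := Multiset.mem_filter.mp he
    exact Finset.mem_inter.mpr ⟨H.incidence e h₁ v hv, Finset.mem_sym2_iff.mp h₂ v hv⟩

/-- Delete one copy of the edge `e`. -/
def deleteEdge (H : Multigraph) (e : Sym2 ℕ) : Multigraph where
  verts := H.verts
  edges := H.edges.erase e
  incidence := fun e' he' => H.incidence e' (Multiset.mem_of_mem_erase he')

/-- Any two vertices are joined by a walk, and there is at least one vertex. -/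
def Connected (H : Multigraph) : Prop :=
  H.verts.Nonempty ∧
    ∀ u ∈ H.verts, ∀ v ∈ H.verts, Relation.ReflTransGen (fun a b => s(a, b) ∈ H.edges) u v

/-- The degree of `v`; a loop at `v` contributes two. -/
def degree (H : Multigraph) (v : ℕ) : ℕ :=
  H.edges.countP (fun e => v ∈ e) + H.edges.count s(v, v)

/-- All degrees are equal to three. -/
def IsCubic (H : Multigraph) : Prop := ∀ v ∈ H.verts, H.degree v = 3

/-- The compensation factor of a multigraph: a factor `1 / 2` for each loop, and a factor
`1 / k!` for each pair of distinct vertices joined by exactly `k` edges and for each vertex carrying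
exactly `k` loops. -/
noncomputable def weight (H : Multigraph) : ℝ :=
  (1 / 2 : ℝ) ^ H.edges.countP Sym2.IsDiag *
    ∏ e ∈ H.edges.toFinset, ((H.edges.count e).factorial : ℝ)⁻¹

/-- The vertex set `S`, of size at least two, induces a 2-connected subgraph: connected, without
cut vertices and without bridges. (For three or more vertices the last condition follows from the
first two; for two vertices it says that they are joined by at least two parallel edges.) -/
def IsTwoConnectedOn (H : Multigraph) (S : Finset ℕ) : Prop :=
  S ⊆ H.verts ∧ 2 ≤ S.card ∧ (H.induce S).Connected ∧
    (∀ v ∈ S, (H.induce (S.erase v)).Connected) ∧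
    ∀ e ∈ (H.induce S).edges, ((H.induce S).deleteEdge e).Connected

/-- `S` is the vertex set of a block of `H`: either of a maximal 2-connected subgraph, or of a
single vertex with a loop. A bridge does not form a block. -/
def IsBlock (H : Multigraph) (S : Finset ℕ) : Prop :=
  Maximal H.IsTwoConnectedOn S ∨ ∃ v ∈ H.verts, s(v, v) ∈ H.edges ∧ S = {v}

open Classical in
/-- The vertex sets of the blocks of `H`. -/
noncomputable def blocks (H : Multigraph) : Finset (Finset ℕ) :=
  H.verts.powerset.filter H.IsBlock

/-- The number of vertices of the `i`-th largest block of `H`, for `i ≥ 1`: entry `i` of the list of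
the block orders in decreasing order (and `0` if there are fewer than `i` blocks). -/
noncomputable def blockOrder (i : ℕ) (H : Multigraph) : ℕ :=
  ((H.blocks.val.map Finset.card).sort (· ≥ ·)).getD (i - 1) 0

/-- `H₃` can be obtained from `H₁` and `H₂` by a bridge insertion: an edge `y₁z₁` of `H₁` and an edge
`y₂z₂` of `H₂` (loops allowed) are subdivided by new vertices `w` and `x`, respectively, and the edge
`wx` is added. -/
def IsBridgeInsertion (H₁ H₂ H₃ : Multigraph) : Prop :=
  H₁.Connected ∧ H₂.Connected ∧ H₃.Connected ∧
  ∃ w x y₁ z₁ y₂ z₂ : ℕ,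
    s(y₁, z₁) ∈ H₁.edges ∧ s(y₂, z₂) ∈ H₂.edges ∧
    Disjoint H₁.verts H₂.verts ∧ w ≠ x ∧ w ∉ H₁.verts ∪ H₂.verts ∧ x ∉ H₁.verts ∪ H₂.verts ∧
    H₃.verts = H₁.verts ∪ H₂.verts ∪ {w, x} ∧
    H₃.edges = H₁.edges.erase s(y₁, z₁) + H₂.edges.erase s(y₂, z₂) +
      {s(w, y₁), s(w, z₁), s(w, x), s(x, y₂), s(x, z₂)}

/-- The members of the class `𝓑` on the vertex set `{1, …, n}` with exactly `m` edges. -/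
def ofSize (𝓑 : Set Multigraph) (n m : ℕ) : Set Multigraph :=
  {H ∈ 𝓑 | H.verts = Finset.Icc 1 n ∧ H.edges.card = m}

/-- There are only finitely many multigraphs of a given size. -/
theorem finite_ofSize (𝓑 : Set Multigraph) (n m : ℕ) : (ofSize 𝓑 n m).Finite := by
  have h : ((fun s : Sym (Sym2 ℕ) m => (s : Multiset (Sym2 ℕ))) ''
      ((((Finset.Icc 1 n).sym2).sym m : Finset (Sym (Sym2 ℕ) m)) : Set (Sym (Sym2 ℕ) m))).Finite :=
    (Finset.finite_toSet _).image _
  refine Set.Finite.of_finite_image (f := Multigraph.edges) (h.subset ?_) ?_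
  · rintro _ ⟨H, ⟨_, hv, hc⟩, rfl⟩
    refine ⟨⟨H.edges, hc⟩, ?_, rfl⟩
    refine Finset.mem_coe.mpr (Finset.mem_sym_iff.mpr fun e he => ?_)
    exact Finset.mem_sym2_iff.mpr fun v hve => hv ▸ H.incidence e he v hve
  · rintro H ⟨_, hv, _⟩ H' ⟨_, hv', _⟩ he
    exact Multigraph.ext (hv.trans hv'.symm) he

/-- The size of a finite class of multigraphs, counted with weights. -/
noncomputable def totalWeight (A : Set Multigraph) : ℝ := ∑ᶠ H ∈ A, H.weight

/-- A class of connected multigraphs (closed under renaming the vertices) is bridge-stable with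
critical exponent `α` if bridge insertions and their reversals do not lead out of it, and if its
members on `{1, …, 2n}` with `3n` edges have total weight `(1 + o(1)) c n ^ (-α) γ ^ n (2n)!` for some
constants `γ, c > 0`. -/
structure IsBridgeStable (𝓑 : Set Multigraph) (α : ℝ) : Prop where
  connected : ∀ H ∈ 𝓑, H.Connected
  relabel : ∀ H ∈ 𝓑, ∀ σ : Equiv.Perm ℕ, H.relabel σ ∈ 𝓑
  stability : ∀ H₁ H₂ H₃, IsBridgeInsertion H₁ H₂ H₃ → ((H₁ ∈ 𝓑 ∧ H₂ ∈ 𝓑) ↔ H₃ ∈ 𝓑)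
  asymptotics : ∃ γ c : ℝ, 0 < γ ∧ 0 < c ∧
    (fun n : ℕ => totalWeight (ofSize 𝓑 (2 * n) (3 * n))) ~[atTop]
      fun n : ℕ => c * (n : ℝ) ^ (-α) * γ ^ n * ((2 * n).factorial : ℝ)

/-- The probability that a random member of `𝓑` on `{1, …, 2n}` with `3n` edges lies in `E`. Here each
multigraph is chosen with probability proportional to its weight, which is what a uniformly random
multigraph means. -/
noncomputable def prob (𝓑 : Set Multigraph) (n : ℕ) (E : Set Multigraph) : ℝ :=
  totalWeight (ofSize 𝓑 (2 * n) (3 * n) ∩ E) / totalWeight (ofSize 𝓑 (2 * n) (3 * n))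

end Multigraph

/-- `X n = O_p(f n)`, where the `n`-th random variable has the underlying probability `P n`. -/
def IsBigOP {Ω : Type*} (P : ℕ → Set Ω → ℝ) (X : ℕ → Ω → ℝ) (f : ℕ → ℝ) : Prop :=
  ∀ δ > 0, ∃ c > 0, ∃ N : ℕ, ∀ n ≥ N, 1 - δ ≤ P n {ω | |X n ω| ≤ c * f n}

/-- `X n = Ω_p(f n)`, where the `n`-th random variable has the underlying probability `P n`. -/
def IsBigOmegaP {Ω : Type*} (P : ℕ → Set Ω → ℝ) (X : ℕ → Ω → ℝ) (f : ℕ → ℝ) : Prop :=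
  ∀ δ > 0, ∃ c > 0, ∃ N : ℕ, ∀ n ≥ N, 1 - δ ≤ P n {ω | c * f n ≤ |X n ω|}

/-- `X n = Θ_p(f n)`, where the `n`-th random variable has the underlying probability `P n`. -/
def IsThetaP {Ω : Type*} (P : ℕ → Set Ω → ℝ) (X : ℕ → Ω → ℝ) (f : ℕ → ℝ) : Prop :=
  IsBigOP P X f ∧ IsBigOmegaP P X f

/-! When all degrees are at most three, a vertex set with at least two elements is 2-connected
exactly when it is 2-edge-connected: separating it at a vertex would require four edges there.
Blocks are therefore governed by bridges. The sides of bridges do not cross (`IsPendant.laminar`).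
The vertices that lie on no side of at most half the order form the core, which is 2-edge-connected
(`twoEdgeConn_core`), and every block is the core or lies inside such a small side
(`IsBlock.eq_core_or`). So the largest block is at least as large as the core (if that has two
vertices), and every further block is at most as large as the largest small side.

Sides of bridges can be counted. By (B1), a member with a prescribed side `S` is the same as a
choice of the ends of the bridge together with one edge-rooted member on either side, and weights
multiply (`sum_pendant_eq`). Write `g n ~ n ^ (-α)` for the normalized total weight. For `2k + 1 ≤
n`, the expected number of sides with `2k + 1` vertices is then at most of order `n * k ^ (1 - α)`
(`Asymp.exists_goodSum_le`). Two first moment bounds follow. Since `α > 3`, the series of `k * k ^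
(1 - α)` converges, so few vertices lie on long small sides. The remaining vertices outside the core
lie on bounded sides attached to it by a bridge, and there are at most three of these per core
vertex; hence the core has linear order (`Asymp.exists_core_ge`). Moreover the expected number of
small sides with `k > M` is of order at most `n * M ^ (2 - α)`, which is small for `M = A * n ^ (1 /
(α - 2))` with `A` large. This is the upper bound for `i ≥ 2` (`Asymp.isBigOP_second`).

The lower bound for `i ≥ 2` is a second moment argument. A side is good if its order lies in a
window around a small multiple of `n ^ (1 / (α - 2))` and the bridge ends in a 2-edge-connected set
of at least `t` vertices inside it. The window is shorter than `t`, so good sides are pairwise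
disjoint and yield distinct blocks of order at least `t` (`card_goodSets_le`). Because the core of a
random member is linear, a positive proportion of rooted members has a good root
(`Asymp.exists_rate_ge`), so the mean number `μ` of good sides can be made large
(`Asymp.exists_window`). Cutting off one good side leaves the other ones good, so the second
factorial moment is at most about `μ ^ 2` (`Asymp.sum_sq_le`), and Chebyshev's inequality gives at
least `i` good sides. -/

namespace Multigraph

/-! ### Edge cuts, and 2-connectivity under a degree bound. -/

/-- `e` has one end in `A` and the other one in `B`. -/
def Joins (A B : Finset ℕ) (e : Sym2 ℕ) : Prop := ∃ a ∈ A, ∃ b ∈ B, e = s(a, b)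

instance (A B : Finset ℕ) : DecidablePred (Joins A B) := fun e => by
  unfold Joins; infer_instance

/-- The number of edges in `E` with one end in `A` and the other one in `B`. -/
def cut (E : Multiset (Sym2 ℕ)) (A B : Finset ℕ) : ℕ := E.countP (Joins A B)

/-- Every partition of `D` into two nonempty parts is crossed by at least two edges. -/
def TwoEdgeConn (E : Multiset (Sym2 ℕ)) (D : Finset ℕ) : Prop :=
  ∀ A ⊆ D, A.Nonempty → A ≠ D → 2 ≤ cut E A (D \ A)

theorem joins_mk {A B : Finset ℕ} {a b : ℕ} :
    Joins A B s(a, b) ↔ (a ∈ A ∧ b ∈ B) ∨ (b ∈ A ∧ a ∈ B) := by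
  constructor
  · rintro ⟨x, hx, y, hy, h⟩
    rcases Sym2.eq_iff.mp h with ⟨rfl, rfl⟩ | ⟨rfl, rfl⟩
    · exact Or.inl ⟨hx, hy⟩
    · exact Or.inr ⟨hx, hy⟩
  · rintro (⟨h₁, h₂⟩ | ⟨h₁, h₂⟩)
    · exact ⟨a, h₁, b, h₂, rfl⟩
    · exact ⟨b, h₁, a, h₂, Sym2.eq_swap⟩

theorem joins_comm {A B : Finset ℕ} {e : Sym2 ℕ} : Joins A B e ↔ Joins B A e := by
  induction e with | _ a b => rw [joins_mk, joins_mk]; tauto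

theorem cut_comm (E : Multiset (Sym2 ℕ)) (A B : Finset ℕ) : cut E A B = cut E B A :=
  Multiset.countP_congr rfl fun _ _ => propext joins_comm

theorem countP_le_countP_of_imp {ι : Type*} {p q : ι → Prop} [DecidablePred p] [DecidablePred q]
    {E : Multiset ι} (h : ∀ e ∈ E, p e → q e) : E.countP p ≤ E.countP q := by
  rw [Multiset.countP_eq_card_filter, Multiset.countP_eq_card_filter]
  refine Multiset.card_le_card (Multiset.le_filter.mpr ⟨Multiset.filter_le _ _, fun e he => ?_⟩)
  obtain ⟨h₁, h₂⟩ := Multiset.mem_filter.mp he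
  exact h e h₁ h₂

theorem countP_add_countP_le {ι : Type*} {p q r : ι → Prop} [DecidablePred p] [DecidablePred q]
    [DecidablePred r] {E : Multiset ι} (hp : ∀ e ∈ E, p e → r e) (hq : ∀ e ∈ E, q e → r e)
    (hpq : ∀ e ∈ E, p e → ¬ q e) : E.countP p + E.countP q ≤ E.countP r := by
  induction E using Multiset.induction_on with
  | empty => simp
  | cons a E ih =>
    have := ih (fun e he => hp e (Multiset.mem_cons_of_mem he))
      (fun e he => hq e (Multiset.mem_cons_of_mem he))
      (fun e he => hpq e (Multiset.mem_cons_of_mem he))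
    have h₁ := hp a (Multiset.mem_cons_self a E)
    have h₂ := hq a (Multiset.mem_cons_self a E)
    have h₃ := hpq a (Multiset.mem_cons_self a E)
    simp only [Multiset.countP_cons]
    split_ifs <;> first | omega | tauto

theorem countP_le_countP_add_countP {ι : Type*} {p q r : ι → Prop} [DecidablePred p]
    [DecidablePred q] [DecidablePred r] {E : Multiset ι} (h : ∀ e ∈ E, r e → p e ∨ q e) :
    E.countP r ≤ E.countP p + E.countP q := by
  induction E using Multiset.induction_on with
  | empty => simp
  | cons a E ih =>
    have := ih (fun e he => h e (Multiset.mem_cons_of_mem he))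
    have h₁ := h a (Multiset.mem_cons_self a E)
    simp only [Multiset.countP_cons]
    split_ifs <;> first | omega | tauto

theorem cut_le_cut {E : Multiset (Sym2 ℕ)} {A B A' B' : Finset ℕ}
    (h : ∀ a ∈ A, ∀ b ∈ B, s(a, b) ∈ E → (a ∈ A' ∧ b ∈ B') ∨ (b ∈ A' ∧ a ∈ B')) :
    cut E A B ≤ cut E A' B' := by
  refine countP_le_countP_of_imp ?_
  rintro _ he ⟨a, ha, b, hb, rfl⟩
  exact joins_mk.mpr (h a ha b hb he)

theorem cut_mono {E : Multiset (Sym2 ℕ)} {A B A' B' : Finset ℕ} (hA : A ⊆ A') (hB : B ⊆ B') :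
    cut E A B ≤ cut E A' B' :=
  cut_le_cut fun _ ha _ hb _ => Or.inl ⟨hA ha, hB hb⟩

theorem cut_union_le (E : Multiset (Sym2 ℕ)) (A B B' : Finset ℕ) :
    cut E A (B ∪ B') ≤ cut E A B + cut E A B' := by
  refine countP_le_countP_add_countP ?_
  rintro _ he ⟨a, ha, b, hb, rfl⟩
  rcases Finset.mem_union.mp hb with hb | hb
  · exact Or.inl ⟨a, ha, b, hb, rfl⟩
  · exact Or.inr ⟨a, ha, b, hb, rfl⟩

theorem cut_pos_iff {E : Multiset (Sym2 ℕ)} {A B : Finset ℕ} :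
    0 < cut E A B ↔ ∃ a ∈ A, ∃ b ∈ B, s(a, b) ∈ E := by
  rw [cut, Multiset.countP_pos]
  constructor
  · rintro ⟨_, he, a, ha, b, hb, rfl⟩
    exact ⟨a, ha, b, hb, he⟩
  · rintro ⟨a, ha, b, hb, he⟩
    exact ⟨_, he, a, ha, b, hb, rfl⟩

/-- Edges leaving a single vertex `v` towards two disjoint sets avoiding `v`. -/
theorem cut_add_cut_le_degree (H : Multigraph) {v : ℕ} {A B : Finset ℕ} (hAB : Disjoint A B)
    (hA : v ∉ A) (hB : v ∉ B) :
    cut H.edges {v} A + cut H.edges {v} B + 2 * H.edges.count s(v, v) ≤ H.degree v := by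
  have h₁ : cut H.edges {v} A + cut H.edges {v} B ≤
      H.edges.countP (fun e => v ∈ e ∧ e ≠ s(v, v)) := by
    refine countP_add_countP_le ?_ ?_ ?_
    · rintro _ _ ⟨a, ha, b, hb, rfl⟩
      rw [Finset.mem_singleton] at ha
      subst ha
      refine ⟨Sym2.mem_mk_left _ _, fun h => hA ?_⟩
      rw [Sym2.congr_right] at h
      exact h ▸ hb
    · rintro _ _ ⟨a, ha, b, hb, rfl⟩
      rw [Finset.mem_singleton] at ha
      subst ha
      refine ⟨Sym2.mem_mk_left _ _, fun h => hB ?_⟩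
      rw [Sym2.congr_right] at h
      exact h ▸ hb
    · rintro _ _ ⟨a, ha, b, hb, rfl⟩ ⟨a', ha', b', hb', h⟩
      rw [Finset.mem_singleton] at ha ha'
      subst ha ha'
      rw [Sym2.congr_right] at h
      exact Finset.disjoint_left.mp hAB hb (h ▸ hb')
  have h₂ : H.edges.countP (fun e => v ∈ e ∧ e ≠ s(v, v)) + H.edges.count s(v, v) ≤
      H.edges.countP (fun e => v ∈ e) := by
    refine countP_add_countP_le (fun _ _ h => h.1) ?_ ?_
    · rintro _ _ rfl
      exact Sym2.mem_mk_left _ _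
    · rintro e _ h h'
      exact h.2 h'.symm
  unfold degree
  omega

/-- Trades walks for cuts. In one direction, a walk cannot leave a set that no edge leaves; in the
other, the set of vertices reachable from `u` has no leaving edge. -/
theorem connected_iff (H : Multigraph) : H.Connected ↔ H.verts.Nonempty ∧
    ∀ A ⊆ H.verts, A.Nonempty → A ≠ H.verts → ∃ a ∈ A, ∃ b ∈ H.verts \ A, s(a, b) ∈ H.edges := by
  classical
  refine and_congr_right fun hne => ⟨fun h A hA hAne hAV => ?_, fun h u hu v hv => ?_⟩
  · by_contra! hcon
    obtain ⟨u, hu⟩ := hAne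
    obtain ⟨v, hv, hvA⟩ : ∃ v ∈ H.verts, v ∉ A := by
      by_contra! hsub
      exact hAV (Finset.Subset.antisymm hA hsub)
    have key : ∀ x, Relation.ReflTransGen (fun a b => s(a, b) ∈ H.edges) u x → x ∈ A := by
      intro x hx
      induction hx with
      | refl => exact hu
      | tail _ hbc ih =>
        by_contra hc
        exact hcon _ ih _ (Finset.mem_sdiff.mpr
          ⟨H.incidence _ hbc _ (Sym2.mem_mk_right _ _), hc⟩) hbc
    exact hvA (key v (h u (hA hu) v hv))
  · by_contra hcon
    obtain ⟨a, ha, b, hb, hab⟩ := h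
      (H.verts.filter (Relation.ReflTransGen (fun a b => s(a, b) ∈ H.edges) u))
      (Finset.filter_subset _ _) ⟨u, Finset.mem_filter.mpr ⟨hu, Relation.ReflTransGen.refl⟩⟩
      (fun h => hcon (Finset.mem_filter.mp (h ▸ hv)).2)
    simp only [Finset.mem_filter, Finset.mem_sdiff, not_and] at ha hb
    exact hb.2 hb.1 (ha.2.tail hab)

theorem Connected.exists_crossing {H : Multigraph} (hH : H.Connected) {A : Finset ℕ}
    (hA : A ⊆ H.verts) (hne : A.Nonempty) (hneq : A ≠ H.verts) :
    ∃ a ∈ A, ∃ b ∈ H.verts \ A, s(a, b) ∈ H.edges :=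
  ((connected_iff H).mp hH).2 A hA hne hneq

theorem induce_verts {H : Multigraph} {D : Finset ℕ} (hD : D ⊆ H.verts) :
    (H.induce D).verts = D := Finset.inter_eq_right.mpr hD

theorem mem_induce_edges {H : Multigraph} {D : Finset ℕ} {a b : ℕ} :
    s(a, b) ∈ (H.induce D).edges ↔ s(a, b) ∈ H.edges ∧ a ∈ D ∧ b ∈ D := by
  simp [induce, Finset.mem_sym2_iff]

/-- Connectedness supplies one crossing edge, and the absence of bridges supplies another one after
that edge is deleted. -/
theorem IsTwoConnectedOn.twoEdgeConn {H : Multigraph} {D : Finset ℕ}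
    (h : H.IsTwoConnectedOn D) : TwoEdgeConn H.edges D := by
  obtain ⟨hD, -, hconn, -, hdel⟩ := h
  intro A hA hne hneq
  have hv := induce_verts hD
  obtain ⟨a, ha, b, hb, hab⟩ := hconn.exists_crossing (A := A) (by rw [hv]; exact hA) hne
    (by rw [hv]; exact hneq)
  obtain ⟨a', ha', b', hb', hab'⟩ := (hdel _ hab).exists_crossing (A := A)
    (by simpa [deleteEdge, hv] using hA) hne (by simpa [deleteEdge, hv] using hneq)
  simp only [deleteEdge, hv] at hb' hab'
  rw [hv] at hb
  have hle : (H.induce D).edges ≤ H.edges := Multiset.filter_le _ _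
  refine le_trans ?_ (Multiset.countP_le_of_le _ hle)
  rw [← Multiset.cons_erase hab, Multiset.countP_cons_of_pos _ ⟨a, ha, b, hb, rfl⟩]
  have : 0 < Multiset.countP (Joins A (D \ A)) ((H.induce D).edges.erase s(a, b)) :=
    Multiset.countP_pos_of_mem hab' ⟨a', ha', b', hb', rfl⟩
  omega

/-- The degree bound excludes cut vertices. If removing `v` separated `D` into `A` and `B`, at least
two edges would leave each of `A` and `B`, all of them towards `v`, so `v` would have degree at
least four. -/
theorem TwoEdgeConn.isTwoConnectedOn {H : Multigraph} {D : Finset ℕ} (hD : D ⊆ H.verts)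
    (hdeg : ∀ v ∈ D, H.degree v ≤ 3) (h2 : 2 ≤ D.card) (h : TwoEdgeConn H.edges D) :
    H.IsTwoConnectedOn D := by
  have hne : D.Nonempty := Finset.card_pos.mp (by omega)
  have hv := induce_verts hD
  refine ⟨hD, h2, ?_, fun v hvD => ?_, fun e he => ?_⟩
  · rw [connected_iff, hv]
    refine ⟨hne, fun A hA hAne hAD => ?_⟩
    obtain ⟨a, ha, b, hb, hab⟩ := cut_pos_iff.mp (lt_of_lt_of_le two_pos (h A hA hAne hAD))
    exact ⟨a, ha, b, hb, mem_induce_edges.mpr ⟨hab, hA ha, (Finset.mem_sdiff.mp hb).1⟩⟩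
  · have hv' := induce_verts ((Finset.erase_subset v D).trans hD)
    rw [connected_iff, hv']
    refine ⟨Finset.card_pos.mp (by rw [Finset.card_erase_of_mem hvD]; omega),
      fun A hA hAne hAD => ?_⟩
    by_contra! hcon
    have hvA : v ∉ A := fun h => Finset.notMem_erase v D (hA h)
    have hAD' : A ⊆ D := hA.trans (Finset.erase_subset _ _)
    set B := D.erase v \ A with hB
    have hzero : cut H.edges A B = 0 := by
      by_contra h0
      obtain ⟨a, ha, b, hb, hab⟩ := cut_pos_iff.mp (Nat.pos_of_ne_zero h0)
      exact hcon a ha b hb (mem_induce_edges.mpr ⟨hab, hA ha, (Finset.mem_sdiff.mp hb).1⟩)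
    have hBne : B.Nonempty := by
      rw [hB, Finset.sdiff_nonempty]
      exact fun h => hAD (Finset.Subset.antisymm hA h)
    have hvB : v ∉ B := fun h => Finset.notMem_erase v D (Finset.mem_sdiff.mp h).1
    have hBD : B ⊆ D := Finset.sdiff_subset.trans (Finset.erase_subset _ _)
    have e₁ : D \ A = B ∪ {v} := by
      ext x
      simp only [hB, Finset.mem_sdiff, Finset.mem_union, Finset.mem_erase, Finset.mem_singleton]
      by_cases hx : x = v
      · subst hx; tauto
      · tauto
    have hdisj : Disjoint A B := Finset.disjoint_sdiff
    have e₂ : D \ B = A ∪ {v} := by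
      ext x
      simp only [hB, Finset.mem_sdiff, Finset.mem_union, Finset.mem_erase, Finset.mem_singleton]
      by_cases hx : x = v
      · subst hx; tauto
      · have := @hAD' x
        tauto
    have c₁ := h A hAD' hAne (fun h => hvA (h ▸ hvD))
    have c₂ := h B hBD hBne (fun h => hvB (h ▸ hvD))
    rw [e₁] at c₁
    rw [e₂] at c₂
    have d₁ := cut_union_le H.edges A B {v}
    have d₂ := cut_union_le H.edges B A {v}
    rw [cut_comm H.edges B A] at d₂
    have d₃ := cut_add_cut_le_degree H hdisj hvA hvB
    rw [cut_comm H.edges {v}, cut_comm H.edges {v}] at d₃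
    have := hdeg v hvD
    omega
  · rw [connected_iff]
    simp only [deleteEdge, hv]
    refine ⟨hne, fun A hA hAne hAD => ?_⟩
    have h₁ : cut H.edges A (D \ A) ≤ cut (H.induce D).edges A (D \ A) := by
      unfold cut induce
      rw [Multiset.countP_filter]
      refine countP_le_countP_of_imp ?_
      rintro _ _ ⟨a, ha, b, hb, rfl⟩
      exact ⟨⟨a, ha, b, hb, rfl⟩, by simp [hA ha, (Finset.mem_sdiff.mp hb).1]⟩
    have h₂ := h A hA hAne hAD
    unfold cut at h₁ h₂
    rw [← Multiset.cons_erase he, Multiset.countP_cons] at h₁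
    exact cut_pos_iff.mp (by unfold cut; split_ifs at h₁ <;> omega)

/-! ### Sides of bridges. -/

/-- `S` is one of the two sides of a bridge of `G`. -/
def IsPendant (G : Multigraph) (S : Finset ℕ) : Prop :=
  S ⊆ G.verts ∧ cut G.edges S (G.verts \ S) = 1

namespace IsPendant
variable {G : Multigraph} {S T : Finset ℕ}

theorem exists_bridge (h : G.IsPendant S) :
    ∃ w ∈ S, ∃ x ∈ G.verts \ S, s(w, x) ∈ G.edges :=
  cut_pos_iff.mp (by rw [h.2]; exact one_pos)

theorem eq_of_crossing (h : G.IsPendant S) {w x a b : ℕ} (hw : w ∈ S) (hx : x ∉ S)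
    (hwx : s(w, x) ∈ G.edges) (ha : a ∈ S) (hb : b ∉ S) (hab : s(a, b) ∈ G.edges) :
    a = w ∧ b = x := by
  have hx' : x ∈ G.verts \ S :=
    Finset.mem_sdiff.mpr ⟨G.incidence _ hwx _ (Sym2.mem_mk_right _ _), hx⟩
  have hb' : b ∈ G.verts \ S :=
    Finset.mem_sdiff.mpr ⟨G.incidence _ hab _ (Sym2.mem_mk_right _ _), hb⟩
  by_contra hne
  have hne' : s(a, b) ≠ s(w, x) := by
    intro h
    rcases Sym2.eq_iff.mp h with h | ⟨rfl, rfl⟩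
    · exact hne h
    · exact hx ha
  have := h.2
  rw [cut, ← Multiset.cons_erase hwx, Multiset.countP_cons_of_pos _ ⟨w, hw, x, hx', rfl⟩] at this
  have hpos : 0 < Multiset.countP (Joins S (G.verts \ S)) (G.edges.erase s(w, x)) :=
    Multiset.countP_pos_of_mem ((Multiset.mem_erase_of_ne hne').mpr hab) ⟨a, ha, b, hb', rfl⟩
  omega

theorem compl (h : G.IsPendant S) : G.IsPendant (G.verts \ S) :=
  ⟨Finset.sdiff_subset, by rw [Finset.sdiff_sdiff_eq_self h.1, cut_comm, h.2]⟩

/-- Either side of a bridge is connected. If `A` avoids the end `w` of the bridge in `S`, an edge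
leaving `A` is not the bridge and hence stays in `S`; otherwise the argument applies to `S \ A`. -/
theorem exists_inner_crossing (hG : G.Connected) (h : G.IsPendant S) {A : Finset ℕ} (hA : A ⊆ S)
    (hne : A.Nonempty) (hAS : A ≠ S) : ∃ a ∈ A, ∃ b ∈ S \ A, s(a, b) ∈ G.edges := by
  obtain ⟨w, hw, x, hx, hwx⟩ := h.exists_bridge
  have main : ∀ A ⊆ S, A.Nonempty → w ∉ A → ∃ a ∈ A, ∃ b ∈ S \ A, s(a, b) ∈ G.edges := by
    intro A hA hne hwA
    obtain ⟨a, ha, b, hb, hab⟩ := hG.exists_crossing (hA.trans h.1) hne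
      (fun he => hwA (he ▸ h.1 hw))
    rw [Finset.mem_sdiff] at hb
    by_cases hbS : b ∈ S
    · exact ⟨a, ha, b, Finset.mem_sdiff.mpr ⟨hbS, hb.2⟩, hab⟩
    · obtain ⟨rfl, -⟩ := h.eq_of_crossing hw (Finset.mem_sdiff.mp hx).2 hwx (hA ha) hbS hab
      exact absurd ha hwA
  by_cases hwA : w ∈ A
  · obtain ⟨a, ha, b, hb, hab⟩ := main (S \ A) Finset.sdiff_subset
      (Finset.sdiff_nonempty.mpr fun h => hAS (Finset.Subset.antisymm hA h))
      (fun h => (Finset.mem_sdiff.mp h).2 hwA)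
    rw [Finset.sdiff_sdiff_eq_self hA] at hb
    exact ⟨b, hb, a, ha, Sym2.eq_swap ▸ hab⟩
  · exact main A hA hne hwA

/-- A 2-edge-connected set meeting both sides would send two edges across a cut that has only one.
-/
theorem subset_or_disjoint (h : G.IsPendant S) {D : Finset ℕ} (hDV : D ⊆ G.verts)
    (hD : TwoEdgeConn G.edges D) : D ⊆ S ∨ Disjoint D S := by
  by_contra! hcon
  have h₁ := hD (D ∩ S) Finset.inter_subset_left
    (Finset.nonempty_iff_ne_empty.mpr fun h => hcon.2 (Finset.disjoint_iff_inter_eq_empty.mpr h))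
    (fun h => hcon.1 (Finset.inter_eq_left.mp h))
  have h₂ : cut G.edges (D ∩ S) (D \ (D ∩ S)) ≤ cut G.edges S (G.verts \ S) := by
    refine cut_mono Finset.inter_subset_right fun x hx => ?_
    simp only [Finset.mem_sdiff, Finset.mem_inter, not_and] at hx ⊢
    exact ⟨hDV hx.1, hx.2 hx.1⟩
  rw [h.2] at h₂
  omega

/-- Two sides of bridges do not cross. -/
theorem laminar (hG : G.Connected) (hS : G.IsPendant S) (hT : G.IsPendant T) :
    S ⊆ T ∨ T ⊆ S ∨ Disjoint S T ∨ S ∪ T = G.verts := by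
  by_contra! hcon
  obtain ⟨h₁, h₂, h₃, h₄⟩ := hcon
  -- If all four parts are nonempty, connectedness of `S` and that of its complement each provide an
  -- edge crossing `T`. One lies inside `S` and the other outside, so they differ, although only one
  -- edge crosses `T`.
  obtain ⟨a, ha, b, hb, hab⟩ := hS.exists_inner_crossing hG (A := S ∩ T) Finset.inter_subset_left
    (Finset.nonempty_iff_ne_empty.mpr fun h => h₃ (Finset.disjoint_iff_inter_eq_empty.mpr h))
    (fun h => h₁ (Finset.inter_eq_left.mp h))
  obtain ⟨c, hc, d, hd, hcd⟩ := hS.compl.exists_inner_crossing hG (A := T \ S)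
    (Finset.sdiff_subset_sdiff hT.1 le_rfl) (Finset.sdiff_nonempty.mpr h₂) (fun h => h₄ (by
      rw [← Finset.union_sdiff_self_eq_union, h, Finset.union_sdiff_of_subset hS.1]))
  simp only [Finset.mem_inter, Finset.mem_sdiff, not_and, not_not] at ha hb hc hd
  have hbT : b ∉ T := fun h => hb.2 hb.1 h
  have hdT : d ∉ T := fun h => hd.1.2 (hd.2 h)
  obtain ⟨rfl, -⟩ := hT.eq_of_crossing ha.2 hbT hab hc.1 hdT hcd
  exact hc.2 ha.1

/-- A side of a bridge is determined by the bridge and its direction. -/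
theorem eq_of_bridge (hG : G.Connected) (hS : G.IsPendant S) (hT : G.IsPendant T) {w x : ℕ}
    (hwx : s(w, x) ∈ G.edges) (hwS : w ∈ S) (hxS : x ∉ S) (hwT : w ∈ T) (hxT : x ∉ T) :
    S = T := by
  have main : ∀ {S T : Finset ℕ}, G.IsPendant S → G.IsPendant T → w ∈ S → x ∉ S → w ∈ T → x ∉ T →
      S ⊆ T → S = T := by
    intro S T hS hT hwS hxS hwT hxT hST
    by_contra hne
    obtain ⟨a, ha, b, hb, hab⟩ := hT.exists_inner_crossing hG hST ⟨w, hwS⟩ hne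
    rw [Finset.mem_sdiff] at hb
    obtain ⟨-, rfl⟩ := hS.eq_of_crossing hwS hxS hwx ha hb.2 hab
    exact hxT hb.1
  rcases hS.laminar hG hT with h | h | h | h
  · exact main hS hT hwS hxS hwT hxT h
  · exact (main hT hS hwT hxT hwS hxS h).symm
  · exact absurd hwT (Finset.disjoint_left.mp h hwS)
  · have : x ∈ S ∪ T := h ▸ G.incidence _ hwx _ (Sym2.mem_mk_right _ _)
    rcases Finset.mem_union.mp this with h | h
    · exact absurd h hxS
    · exact absurd h hxT

/-- If the bridge at `S` ends in `T` and the bridge at `T` ends in `S`, then there is nothing else. -/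
theorem union_eq_verts (hG : G.Connected) (hS : G.IsPendant S) (hT : G.IsPendant T) {w x : ℕ}
    (hwx : s(w, x) ∈ G.edges) (hwS : w ∈ S) (hxS : x ∉ S) (hxT : x ∈ T) (hwT : w ∉ T) :
    S ∪ T = G.verts := by
  by_contra hne
  obtain ⟨a, ha, b, hb, hab⟩ := hG.exists_crossing (Finset.union_subset hS.1 hT.1)
    ⟨w, Finset.mem_union_left _ hwS⟩ hne
  simp only [Finset.mem_sdiff, Finset.mem_union, not_or] at ha hb
  rcases ha with ha | ha
  · obtain ⟨-, rfl⟩ := hS.eq_of_crossing hwS hxS hwx ha hb.2.1 hab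
    exact hb.2.2 hxT
  · obtain ⟨-, rfl⟩ := hT.eq_of_crossing hxT hwT (Sym2.eq_swap ▸ hwx) ha hb.2.2 hab
    exact hb.2.1 hwS

end IsPendant

end Multigraph

/-! ### Small sides, the core, and good sides. -/

namespace Multigraph

theorem countP_eq_sum_map {ι : Type*} (p : ι → Prop) [DecidablePred p] (E : Multiset ι) :
    E.countP p = (E.map fun e => if p e then 1 else 0).sum := by
  induction E using Multiset.induction_on with
  | empty => simp
  | cons a E ih => rw [Multiset.countP_cons, Multiset.map_cons, Multiset.sum_cons, ih, add_comm]

/-- The number of edges of `E` inside `S`. -/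
def inner (E : Multiset (Sym2 ℕ)) (S : Finset ℕ) : ℕ := E.countP (fun e => e ∈ S.sym2)

/-- The handshake lemma for a set of vertices. -/
theorem sum_degree (H : Multigraph) {S : Finset ℕ} :
    ∑ v ∈ S, H.degree v = 2 * inner H.edges S + cut H.edges S (H.verts \ S) := by
  -- Either side counts the ends of `e` in `S`, where a loop has two.
  have key : ∀ e ∈ H.edges, ∑ v ∈ S, ((if v ∈ e then 1 else 0) + if s(v, v) = e then 1 else 0) =
      2 * (if e ∈ S.sym2 then 1 else 0) + if Joins S (H.verts \ S) e then 1 else 0 := by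
    intro e he
    induction e with | _ a b => ?_
    have haV := H.incidence _ he a (Sym2.mem_mk_left a b)
    have hbV := H.incidence _ he b (Sym2.mem_mk_right a b)
    have h₁ : ∀ v, ((if v ∈ s(a, b) then 1 else 0) + if s(v, v) = s(a, b) then 1 else 0) =
        (if v = a then 1 else 0) + if v = b then 1 else 0 := by
      intro v
      simp only [Sym2.mem_iff, Sym2.eq_iff]
      split_ifs <;> first | rfl | tauto
    simp only [h₁, Finset.sum_add_distrib, Finset.sum_ite_eq', joins_mk, Finset.mem_sdiff,
      Finset.mk_mem_sym2_iff, haV, hbV, true_and]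
    by_cases h₁ : a ∈ S <;> by_cases h₂ : b ∈ S <;> simp [h₁, h₂]
  have h₂ : ∑ v ∈ S, H.degree v = (H.edges.map fun e => ∑ v ∈ S,
      ((if v ∈ e then 1 else 0) + if s(v, v) = e then 1 else 0)).sum := by
    rw [Multiset.sum_map_sum]
    refine Finset.sum_congr rfl fun v _ => ?_
    rw [Multiset.sum_map_add, degree, ← countP_eq_sum_map, ← countP_eq_sum_map]
    rfl
  rw [h₂, Multiset.map_congr rfl key, Multiset.sum_map_add, Multiset.sum_map_mul_left,
    ← countP_eq_sum_map, ← countP_eq_sum_map]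
  rfl

theorem IsCubic.sum_degree {H : Multigraph} (hH : H.IsCubic) {S : Finset ℕ} (hS : S ⊆ H.verts) :
    3 * S.card = 2 * inner H.edges S + cut H.edges S (H.verts \ S) := by
  rw [← Multigraph.sum_degree, Finset.sum_congr rfl fun v hv => hH v (hS hv), Finset.sum_const,
    smul_eq_mul, mul_comm]

/-- The sides of bridges with at most half of the vertices. -/
def IsSmall (G : Multigraph) (S : Finset ℕ) : Prop := G.IsPendant S ∧ 2 * S.card ≤ G.verts.card

open Classical in
noncomputable def smallSets (G : Multigraph) : Finset (Finset ℕ) := G.verts.powerset.filter G.IsSmall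

theorem mem_smallSets {G : Multigraph} {S : Finset ℕ} : S ∈ G.smallSets ↔ G.IsSmall S := by
  classical
  unfold smallSets
  rw [Finset.mem_filter, Finset.mem_powerset]
  exact ⟨fun h => h.2, fun h => ⟨h.1.1, h⟩⟩

/-- The vertices that are on the larger side of every bridge. -/
noncomputable def core (G : Multigraph) : Finset ℕ := G.verts \ G.smallSets.biUnion id

theorem mem_core {G : Multigraph} {v : ℕ} :
    v ∈ G.core ↔ v ∈ G.verts ∧ ∀ S, G.IsSmall S → v ∉ S := by
  unfold core
  simp [mem_smallSets]

theorem core_subset (G : Multigraph) : G.core ⊆ G.verts := Finset.sdiff_subset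

/-- Suppose that at most one edge joins `A` to the rest of the core. Attach to `A` all small sides
whose bridge ends in `A`. Every edge leaving the resulting set `U` joins `A` to the rest of the
core, so `U` is a side of a bridge. Both `U` and its complement contain core vertices, yet one of
them is small. -/
theorem twoEdgeConn_core {G : Multigraph} (hG : G.Connected) : TwoEdgeConn G.edges G.core := by
  classical
  intro A hA hne hAC
  by_contra! hlt
  obtain ⟨a₀, ha₀⟩ := hne
  obtain ⟨b₀, hb₀, hb₀A⟩ : ∃ b ∈ G.core, b ∉ A := by
    by_contra! h
    exact hAC (Finset.Subset.antisymm hA h)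
  set U := G.verts.filter (fun v => v ∈ A ∨
    ∃ S, G.IsSmall S ∧ v ∈ S ∧ ∃ w ∈ S, ∃ x ∈ A, s(w, x) ∈ G.edges) with hU
  have hUV : U ⊆ G.verts := Finset.filter_subset _ _
  have haU : a₀ ∈ U := Finset.mem_filter.mpr ⟨core_subset G (hA ha₀), Or.inl ha₀⟩
  have hbU : b₀ ∉ U := by
    simp only [hU, Finset.mem_filter, not_and, not_or, not_exists]
    refine fun _ => ⟨hb₀A, fun S hS hb => ?_⟩
    exact absurd hb ((mem_core.mp hb₀).2 S hS)
  have hcut : cut G.edges U (G.verts \ U) ≤ cut G.edges A (G.core \ A) := by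
    refine cut_le_cut fun a ha b hb hab => ?_
    obtain ⟨hbV, hbU⟩ := Finset.mem_sdiff.mp hb
    have hbU' : ¬ (b ∈ A ∨ ∃ S, G.IsSmall S ∧ b ∈ S ∧ ∃ w ∈ S, ∃ x ∈ A, s(w, x) ∈ G.edges) :=
      fun h => hbU (Finset.mem_filter.mpr ⟨hbV, h⟩)
    rw [not_or] at hbU'
    rcases (Finset.mem_filter.mp ha).2 with haA | ⟨S, hS, haS, w, hw, x, hx, hwx⟩
    · by_cases hbC : b ∈ G.core
      · exact Or.inl ⟨haA, Finset.mem_sdiff.mpr ⟨hbC, hbU'.1⟩⟩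
      · rw [mem_core] at hbC
        push Not at hbC
        obtain ⟨S, hS, hbS⟩ := hbC hbV
        exact absurd ⟨S, hS, hbS, b, hbS, a, haA, Sym2.eq_swap ▸ hab⟩ hbU'.2
    · have hbS : b ∉ S := fun h => hbU'.2 ⟨S, hS, h, w, hw, x, hx, hwx⟩
      have hxS : x ∉ S := (mem_core.mp (hA hx)).2 S hS
      obtain ⟨-, rfl⟩ := hS.1.eq_of_crossing hw hxS hwx haS hbS hab
      exact absurd hx hbU'.1
  have hpos : 0 < cut G.edges U (G.verts \ U) := cut_pos_iff.mpr
    (hG.exists_crossing hUV ⟨a₀, haU⟩ fun h => hbU (h ▸ core_subset G hb₀))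
  have hpend : G.IsPendant U := ⟨hUV, by omega⟩
  have hcard := Finset.card_sdiff_add_card_eq_card hUV
  by_cases hsm : 2 * U.card ≤ G.verts.card
  · exact (mem_core.mp (hA ha₀)).2 U ⟨hpend, hsm⟩ haU
  · exact (mem_core.mp hb₀).2 _ ⟨hpend.compl, by omega⟩
      (Finset.mem_sdiff.mpr ⟨core_subset G hb₀, hbU⟩)

theorem IsBlock.subset {G : Multigraph} {D : Finset ℕ} (h : G.IsBlock D) : D ⊆ G.verts := by
  rcases h with h | ⟨v, hv, -, rfl⟩
  · exact h.prop.1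
  · exact Finset.singleton_subset_iff.mpr hv

theorem IsBlock.twoEdgeConn {G : Multigraph} {D : Finset ℕ} (h : G.IsBlock D) :
    TwoEdgeConn G.edges D := by
  rcases h with h | ⟨v, hv, -, rfl⟩
  · exact h.prop.twoEdgeConn
  · intro A hA hne hneq
    rcases Finset.subset_singleton_iff.mp hA with rfl | rfl
    · simp at hne
    · exact absurd rfl hneq

/-- Every block except possibly the core lies on the small side of some bridge. -/
theorem IsBlock.eq_core_or {G : Multigraph} (hG : G.Connected) (hdeg : ∀ v ∈ G.verts, G.degree v ≤ 3)
    {D : Finset ℕ} (h : G.IsBlock D) : D = G.core ∨ ∃ S, G.IsSmall S ∧ D ⊆ S := by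
  by_cases hDC : D ⊆ G.core
  · left
    have hcore := fun h2 => (twoEdgeConn_core hG).isTwoConnectedOn (core_subset G)
      (fun v hv => hdeg v (core_subset G hv)) h2
    rcases h with h | ⟨v, hv, hloop, rfl⟩
    · exact h.eq_of_le (hcore (h.prop.2.1.trans (Finset.card_le_card hDC))) hDC
    -- If the core had a further vertex, two edges would join `v` to the rest of it, which together
    -- with the loop makes degree at least four.
    · by_contra hne
      have h₁ := twoEdgeConn_core hG {v} hDC (Finset.singleton_nonempty v) hne
      have h₂ := cut_add_cut_le_degree G (v := v) (A := G.core \ {v}) (B := ∅)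
        (Finset.disjoint_empty_right _) (by simp) (by simp)
      have h₃ := Multiset.count_pos.mpr hloop
      have h₄ := hdeg v hv
      omega
  · right
    obtain ⟨v, hvD, hvC⟩ := Finset.not_subset.mp hDC
    rw [mem_core] at hvC
    push Not at hvC
    obtain ⟨S, hS, hvS⟩ := hvC (h.subset hvD)
    refine ⟨S, hS, (hS.1.subset_or_disjoint h.subset h.twoEdgeConn).resolve_right fun hd => ?_⟩
    exact Finset.disjoint_left.mp hd hvD hvS

/-- Away from the core, each vertex is on the small side of a bridge that ends in the core. -/
theorem exists_small_of_notMem_core {G : Multigraph} (hG : G.Connected)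
    (hbal : ∀ S, G.IsSmall S → 2 * S.card < G.verts.card) {v : ℕ} (hv : v ∈ G.verts)
    (hvC : v ∉ G.core) :
    ∃ S, G.IsSmall S ∧ v ∈ S ∧ ∃ w ∈ S, ∃ x ∈ G.core, s(w, x) ∈ G.edges := by
  classical
  have hvC' := hvC
  rw [mem_core] at hvC'
  push Not at hvC'
  obtain ⟨S₀, hS₀, hvS₀⟩ := hvC' hv
  -- Take a largest small side through `v`. If its bridge ended in another small side `T`, then
  -- laminarity would force `S ⊆ T`, against maximality, or `S ∪ T = G.verts`, although both have
  -- less than half of the vertices.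
  obtain ⟨S, hS, hmax⟩ := Finset.exists_max_image
    (G.smallSets.filter (fun S => v ∈ S)) Finset.card
    ⟨S₀, Finset.mem_filter.mpr ⟨mem_smallSets.mpr hS₀, hvS₀⟩⟩
  rw [Finset.mem_filter, mem_smallSets] at hS
  obtain ⟨w, hw, x, hx, hwx⟩ := hS.1.1.exists_bridge
  rw [Finset.mem_sdiff] at hx
  refine ⟨S, hS.1, hS.2, w, hw, x, ?_, hwx⟩
  by_contra hxC
  rw [mem_core] at hxC
  push Not at hxC
  obtain ⟨T, hT, hxT⟩ := hxC hx.1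
  have hST : ¬ S ⊆ T := by
    intro h
    have := hmax T (Finset.mem_filter.mpr ⟨mem_smallSets.mpr hT, h hS.2⟩)
    exact hx.2 ((Finset.eq_of_subset_of_card_le h this) ▸ hxT)
  have hcov : S ∪ T = G.verts := by
    rcases hS.1.1.laminar hG hT.1 with h | h | h | h
    · exact absurd h hST
    · exact absurd (h hxT) hx.2
    · exact hS.1.1.union_eq_verts hG hT.1 hwx hw hx.2 hxT (Finset.disjoint_left.mp h hw)
    · exact h
  have h₁ := Finset.card_union_le S T
  have h₂ := hbal S hS.1
  have h₃ := hbal T hT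
  rw [hcov] at h₁
  omega

theorem card_neighbors_le (G : Multigraph) (x : ℕ) :
    (G.verts.filter (fun w => s(w, x) ∈ G.edges)).card ≤ G.degree x := by
  have h₁ : (G.verts.filter (fun w => s(w, x) ∈ G.edges)).card ≤
      (G.edges.filter (fun e => x ∈ e)).toFinset.card := by
    refine Finset.card_le_card_of_injOn (fun w => s(w, x)) ?_ ?_
    · intro w hw
      simp only [Finset.coe_filter, Set.mem_ofPred_eq] at hw
      simp [hw.2]
    · intro w _ w' _ h
      exact Sym2.congr_left.mp h
  refine h₁.trans ((Multiset.toFinset_card_le _).trans ?_)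
  rw [← Multiset.countP_eq_card_filter]
  exact Nat.le_add_right _ _

/-- Vertices outside the core lie on large small sides, or on the at most `3|C|` short ones. -/
theorem card_verts_le {G : Multigraph} (hG : G.Connected) (hdeg : ∀ v ∈ G.verts, G.degree v ≤ 3)
    (hbal : ∀ S, G.IsSmall S → 2 * S.card < G.verts.card) (L : ℕ) :
    G.verts.card ≤ G.core.card + ∑ S ∈ G.smallSets.filter (fun S => L < S.card), S.card +
      3 * L * G.core.card := by
  classical
  -- `P` lists the directed edges at the core and `F` the short sides attached to the core. A side
  -- is determined by its directed bridge, so `F` has at most `|P| ≤ 3 |C|` members.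
  set P := G.core.sigma (fun x => G.verts.filter (fun w => s(w, x) ∈ G.edges)) with hP
  set F := G.smallSets.filter
    (fun S => S.card ≤ L ∧ ∃ w ∈ S, ∃ x ∈ G.core, s(w, x) ∈ G.edges) with hF
  have hPcard : P.card ≤ 3 * G.core.card := by
    rw [hP, Finset.card_sigma, mul_comm]
    refine Finset.sum_le_card_nsmul _ _ _ fun x hx => ?_
    exact (card_neighbors_le G x).trans (hdeg x (core_subset G hx))
  have hFP : F.card ≤ P.card := by
    refine Finset.card_le_card_of_forall_subsingleton
      (fun S p => p.2 ∈ S ∧ p.1 ∉ S) ?_ ?_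
    · intro S hS
      rw [hF, Finset.mem_filter, mem_smallSets] at hS
      obtain ⟨hS, -, w, hw, x, hx, hwx⟩ := hS
      refine ⟨⟨x, w⟩, ?_, hw, (mem_core.mp hx).2 S hS⟩
      simp only [hP, Finset.mem_sigma, Finset.mem_filter]
      exact ⟨hx, hS.1.1 hw, hwx⟩
    · rintro ⟨x, w⟩ hp S ⟨hS, hS'⟩ T ⟨hT, hT'⟩
      rw [hF, Finset.mem_filter, mem_smallSets] at hS hT
      simp only [hP, Finset.mem_sigma, Finset.mem_filter] at hp
      exact hS.1.1.eq_of_bridge hG hT.1.1 hp.2.2 hS'.1 hS'.2 hT'.1 hT'.2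
  have hcov : G.verts ⊆ (G.core ∪ (G.smallSets.filter (fun S => L < S.card)).biUnion id) ∪
      F.biUnion id := by
    intro v hv
    by_cases hvC : v ∈ G.core
    · simp [hvC]
    · obtain ⟨S, hS, hvS, hw⟩ := exists_small_of_notMem_core hG hbal hv hvC
      simp only [Finset.mem_union, Finset.mem_biUnion, Finset.mem_filter, hF, mem_smallSets, id]
      by_cases hL : L < S.card
      · exact Or.inl (Or.inr ⟨S, ⟨hS, hL⟩, hvS⟩)
      · exact Or.inr ⟨S, ⟨hS, not_lt.mp hL, hw⟩, hvS⟩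
  refine (Finset.card_le_card hcov).trans ((Finset.card_union_le _ _).trans ?_)
  refine add_le_add ((Finset.card_union_le _ _).trans (add_le_add le_rfl Finset.card_biUnion_le)) ?_
  calc (F.biUnion id).card ≤ F.card * L := Finset.card_biUnion_le_card_mul _ _ _ fun S hS => by
        rw [hF, Finset.mem_filter] at hS
        exact hS.2.1
    _ ≤ 3 * G.core.card * L := Nat.mul_le_mul_right _ (hFP.trans hPcard)
    _ = 3 * L * G.core.card := by ring

/-- The core is large when few vertices are on long small sides. -/
theorem card_core_ge {G : Multigraph} (hG : G.Connected) (hdeg : ∀ v ∈ G.verts, G.degree v ≤ 3)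
    (L : ℕ) (hL : 2 * L < G.verts.card)
    (hsum : 4 * ∑ S ∈ G.smallSets.filter (fun S => L < S.card), S.card ≤ G.verts.card) :
    3 * G.verts.card ≤ 4 * (1 + 3 * L) * G.core.card := by
  -- A side with exactly half of the vertices would be longer than `L` and would alone violate
  -- `hsum`.
  have hbal : ∀ S, G.IsSmall S → 2 * S.card < G.verts.card := by
    intro S hS
    refine lt_of_le_of_ne hS.2 fun he => ?_
    have hmem : S ∈ G.smallSets.filter (fun S => L < S.card) :=
      Finset.mem_filter.mpr ⟨mem_smallSets.mpr hS, by omega⟩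
    have := Finset.single_le_sum (f := Finset.card) (fun _ _ => Nat.zero_le _) hmem
    omega
  have := card_verts_le hG hdeg hbal L
  nlinarith

/-- The order of a two-edge-connected set is at most the number of edges inside it. -/
theorem TwoEdgeConn.card_le_inner {H : Multigraph} {D : Finset ℕ} (h : TwoEdgeConn H.edges D)
    (hD : D ⊆ H.verts) (h2 : 2 ≤ D.card) : D.card ≤ inner H.edges D := by
  set H' := H.induce D
  have hv : H'.verts = D := induce_verts hD
  have h₁ := sum_degree H' (S := D)
  have h₂ : cut H'.edges D (H'.verts \ D) = 0 := by
    rw [hv, Finset.sdiff_self]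
    by_contra h0
    obtain ⟨a, _, b, hb, _⟩ := cut_pos_iff.mp (Nat.pos_of_ne_zero h0)
    simp at hb
  have h₃ : inner H'.edges D ≤ inner H.edges D :=
    Multiset.countP_le_of_le _ (Multiset.filter_le _ _)
  -- Each vertex of `D` is joined to the rest of `D` by two edges; the handshake lemma turns this
  -- into a bound on the number of edges.
  have h₄ : ∑ v ∈ D, 2 ≤ ∑ v ∈ D, H'.degree v := by
    refine Finset.sum_le_sum fun v hvD => ?_
    have c₁ := h {v} (Finset.singleton_subset_iff.mpr hvD) (Finset.singleton_nonempty v)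
      (by rintro rfl; simp at h2)
    have c₂ : cut H.edges {v} (D \ {v}) ≤ cut H'.edges {v} (D \ {v}) := by
      show cut H.edges {v} (D \ {v}) ≤ Multiset.countP _ (Multiset.filter _ _)
      rw [Multiset.countP_filter]
      refine countP_le_countP_of_imp ?_
      rintro _ _ ⟨a, ha, b, hb, rfl⟩
      rw [Finset.mem_singleton] at ha
      subst ha
      exact ⟨⟨a, by simp, b, hb, rfl⟩, by simp [hvD, (Finset.mem_sdiff.mp hb).1]⟩
    have c₃ := cut_add_cut_le_degree H' (v := v) (A := D \ {v}) (B := ∅)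
      (Finset.disjoint_empty_right _) (by simp) (by simp)
    omega
  rw [Finset.sum_const, smul_eq_mul] at h₄
  omega

/-- The sides `S` of bridges such that `S` has `2k+1` vertices for some `k ∈ I` and the end of the
bridge in `S` lies in a two-edge-connected subset of `S` with at least `t` vertices. -/
def IsGood (G : Multigraph) (I : Finset ℕ) (t : ℕ) (S : Finset ℕ) : Prop :=
  G.IsPendant S ∧ (∃ k ∈ I, S.card = 2 * k + 1) ∧
    ∃ D ⊆ S, t ≤ D.card ∧ TwoEdgeConn G.edges D ∧ ∃ w ∈ D, ∃ x ∈ G.verts \ S, s(w, x) ∈ G.edges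

open Classical in
noncomputable def goodSets (G : Multigraph) (I : Finset ℕ) (t : ℕ) : Finset (Finset ℕ) :=
  G.verts.powerset.filter (G.IsGood I t)

theorem mem_goodSets {G : Multigraph} {I : Finset ℕ} {t : ℕ} {S : Finset ℕ} :
    S ∈ G.goodSets I t ↔ G.IsGood I t S := by
  classical
  unfold goodSets
  rw [Finset.mem_filter, Finset.mem_powerset]
  exact ⟨fun h => h.2, fun h => ⟨h.1.1, h⟩⟩

/-- Suppose `T ⊆ S` and let `D` be the 2-edge-connected set of `S`. If `D` lies in `T`, both sides
have the same directed bridge and coincide. If `D` misses `T`, then `S` has at least `t` more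
vertices than `T`, which the window `ht` forbids. By laminarity only disjointness or a covering of
all vertices remains, and `hV` excludes the latter. -/
theorem IsGood.disjoint {G : Multigraph} (hG : G.Connected) {m m' t : ℕ}
    (ht : 2 * m' < 2 * m + t) (hV : 4 * m' + 2 < G.verts.card) {S T : Finset ℕ}
    (hS : G.IsGood (Finset.Icc m m') t S) (hT : G.IsGood (Finset.Icc m m') t T) (hne : S ≠ T) :
    Disjoint S T := by
  have main : ∀ {S T : Finset ℕ}, G.IsGood (Finset.Icc m m') t S →
      G.IsGood (Finset.Icc m m') t T → S ≠ T → ¬ T ⊆ S := by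
    rintro S T ⟨hS, ⟨k, hk, hSk⟩, D, hDS, htD, hD, w, hwD, x, hx, hwx⟩ ⟨hT, ⟨l, hl, hTl⟩, -⟩ hne hTS
    rw [Finset.mem_Icc] at hk hl
    rw [Finset.mem_sdiff] at hx
    rcases hT.subset_or_disjoint (hDS.trans hS.1) hD with h | h
    · exact hne (hS.eq_of_bridge hG hT hwx (hDS hwD) hx.2 (h hwD) fun h => hx.2 (hTS h))
    · have h₁ := Finset.card_le_card (Finset.union_subset hDS hTS)
      rw [Finset.card_union_of_disjoint h] at h₁
      omega
  rcases hS.1.laminar hG hT.1 with h | h | h | h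
  · exact absurd h (main hT hS hne.symm)
  · exact absurd h (main hS hT hne)
  · exact h
  · have h₁ := Finset.card_union_le S T
    obtain ⟨-, ⟨k, hk, hSk⟩, -⟩ := hS
    obtain ⟨-, ⟨l, hl, hTl⟩, -⟩ := hT
    rw [Finset.mem_Icc] at hk hl
    rw [h] at h₁
    omega

/-- The 2-edge-connected set inside a good side extends to a block, which cannot leave the side. As
distinct good sides are disjoint, they receive distinct blocks. -/
theorem card_goodSets_le {G : Multigraph} (hG : G.Connected)
    (hdeg : ∀ v ∈ G.verts, G.degree v ≤ 3) {m m' t : ℕ}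
    (ht : 2 * m' < 2 * m + t) (hV : 4 * m' + 2 < G.verts.card) (h2 : 2 ≤ t) :
    (G.goodSets (Finset.Icc m m') t).card ≤ (G.blocks.filter (fun D => t ≤ D.card)).card := by
  classical
  refine Finset.card_le_card_of_forall_subsingleton (fun S D => D.Nonempty ∧ D ⊆ S) ?_ ?_
  · intro S hS
    rw [mem_goodSets] at hS
    obtain ⟨hS, -, D, hDS, htD, hD, -⟩ := hS
    have hDV := hDS.trans hS.1
    have hDtc := hD.isTwoConnectedOn hDV (fun v hv => hdeg v (hDV hv)) (h2.trans htD)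
    obtain ⟨B, hDB, hB⟩ := Set.Finite.exists_le_maximal
      (s := {B | G.IsTwoConnectedOn B}) (G.verts.powerset.finite_toSet.subset
        (fun B hB => by simpa using hB.1)) hDtc
    have hcard := Finset.card_le_card hDB
    have hDne : D.Nonempty := Finset.card_pos.mp (by omega)
    have hBb : G.IsBlock B := Or.inl hB
    refine ⟨B, ?_, hDne.mono hDB, ?_⟩
    · rw [Finset.mem_filter, blocks, Finset.mem_filter, Finset.mem_powerset]
      exact ⟨⟨hBb.subset, hBb⟩, htD.trans hcard⟩
    · refine (hS.subset_or_disjoint hBb.subset hBb.twoEdgeConn).resolve_right fun h => ?_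
      obtain ⟨v, hv⟩ := hDne
      exact Finset.disjoint_left.mp h (hDB hv) (hDS hv)
  · rintro D - S ⟨hS, hDne, hDS⟩ T ⟨hT, -, hDT⟩
    by_contra hne
    obtain ⟨v, hv⟩ := hDne
    exact Finset.disjoint_left.mp
      ((mem_goodSets.mp hS).disjoint hG ht hV (mem_goodSets.mp hT) hne) (hDS hv) (hDT hv)

end Multigraph

/-! ### Weights under subdivision, and cutting at a bridge. -/

namespace Multigraph

/-- The compensation factor of a multiset of edges. -/
noncomputable def edgeWeight (E : Multiset (Sym2 ℕ)) : ℝ :=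
  (1 / 2 : ℝ) ^ E.countP Sym2.IsDiag * ∏ e ∈ E.toFinset, ((E.count e).factorial : ℝ)⁻¹

theorem weight_eq_edgeWeight (H : Multigraph) : H.weight = edgeWeight H.edges := rfl

theorem edgeWeight_pos (E : Multiset (Sym2 ℕ)) : 0 < edgeWeight E := by
  unfold edgeWeight
  positivity

theorem weight_pos (H : Multigraph) : 0 < H.weight := edgeWeight_pos _

theorem edgeWeight_eq_prod {E : Multiset (Sym2 ℕ)} {F : Finset (Sym2 ℕ)} (h : E.toFinset ⊆ F) :
    edgeWeight E = (1 / 2 : ℝ) ^ E.countP Sym2.IsDiag *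
      ∏ e ∈ F, ((E.count e).factorial : ℝ)⁻¹ := by
  unfold edgeWeight
  congr 1
  refine Finset.prod_subset h fun e _ he => ?_
  rw [Multiset.mem_toFinset, ← Multiset.count_eq_zero] at he
  simp [he]

theorem edgeWeight_add {E F : Multiset (Sym2 ℕ)} (h : ∀ e ∈ E, e ∉ F) :
    edgeWeight (E + F) = edgeWeight E * edgeWeight F := by
  have hd : Disjoint E.toFinset F.toFinset := by
    rw [Finset.disjoint_left]
    simpa using h
  unfold edgeWeight
  rw [Multiset.toFinset_add, Finset.prod_union hd, Multiset.countP_add, pow_add]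
  have h₁ : ∏ e ∈ E.toFinset, (((E + F).count e).factorial : ℝ)⁻¹ =
      ∏ e ∈ E.toFinset, ((E.count e).factorial : ℝ)⁻¹ := by
    refine Finset.prod_congr rfl fun e he => ?_
    rw [Multiset.count_add, Multiset.count_eq_zero.mpr (h e (Multiset.mem_toFinset.mp he)),
      add_zero]
  have h₂ : ∏ e ∈ F.toFinset, (((E + F).count e).factorial : ℝ)⁻¹ =
      ∏ e ∈ F.toFinset, ((F.count e).factorial : ℝ)⁻¹ := by
    refine Finset.prod_congr rfl fun e he => ?_
    rw [Multiset.count_add, Multiset.count_eq_zero.mpr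
      (fun h' => h e h' (Multiset.mem_toFinset.mp he)), zero_add]
  rw [h₁, h₂]
  ring

/-- Choosing one of the parallel copies of `e` cancels the top factor of the factorial, so a rooted
multigraph weighs as much as the rest, up to the factor `1 / 2` of a loop. -/
theorem count_mul_edgeWeight {E : Multiset (Sym2 ℕ)} {e : Sym2 ℕ} (he : e ∈ E) :
    (E.count e : ℝ) * edgeWeight E =
      (if e.IsDiag then 1 / 2 else 1) * edgeWeight (E.erase e) := by
  obtain ⟨E, rfl⟩ := Multiset.exists_cons_of_mem he
  rw [Multiset.erase_cons_head]
  rw [edgeWeight_eq_prod (E := e ::ₘ E) (F := insert e E.toFinset) (by simp),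
    edgeWeight_eq_prod (E := E) (F := insert e E.toFinset) (by simp)]
  rw [← Finset.mul_prod_erase _ _ (Finset.mem_insert_self e E.toFinset),
    ← Finset.mul_prod_erase _ _ (Finset.mem_insert_self e E.toFinset)]
  have h₁ : ∏ x ∈ (insert e E.toFinset).erase e, (((e ::ₘ E).count x).factorial : ℝ)⁻¹ =
      ∏ x ∈ (insert e E.toFinset).erase e, ((E.count x).factorial : ℝ)⁻¹ := by
    refine Finset.prod_congr rfl fun x hx => ?_
    rw [Multiset.count_cons_of_ne (Finset.ne_of_mem_erase hx)]
  rw [h₁, Multiset.count_cons_self, Multiset.countP_cons, Nat.factorial_succ]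
  have h₂ : ((E.count e + 1 : ℕ) : ℝ) ≠ 0 := by positivity
  push_cast at h₂ ⊢
  split_ifs
  · rw [pow_succ]
    field_simp
  · field_simp
    simp

/-- The edges joining `w` to the ends of `e`. -/
def spokes (w : ℕ) (e : Sym2 ℕ) : Multiset (Sym2 ℕ) := e.toMultiset.map fun a => s(w, a)

theorem spokes_mk (w a b : ℕ) : spokes w s(a, b) = {s(w, a), s(w, b)} := rfl

theorem mem_spokes {w : ℕ} {e e' : Sym2 ℕ} : e' ∈ spokes w e ↔ ∃ a ∈ e, s(w, a) = e' := by
  simp [spokes, Sym2.mem_toMultiset]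

theorem card_spokes (w : ℕ) (e : Sym2 ℕ) : (spokes w e).card = 2 := by
  simp [spokes, Sym2.card_toMultiset]

theorem spokes_injective (w : ℕ) : Function.Injective (spokes w) := by
  intro e e' h
  have h' := Multiset.map_injective (fun a b h => Sym2.congr_right.mp h) h
  induction e with | _ a b => induction e' with | _ c d =>
    change ({a, b} : Multiset ℕ) = {c, d} at h'
    rw [Sym2.eq_iff]
    rw [Multiset.insert_eq_cons, Multiset.insert_eq_cons, Multiset.cons_eq_cons] at h'
    rcases h' with ⟨rfl, h₀⟩ | ⟨-, cs, h₁, h₂⟩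
    · exact Or.inl ⟨rfl, Multiset.singleton_inj.mp h₀⟩
    · obtain ⟨rfl, rfl⟩ : b = c ∧ cs = 0 := by
        rw [← Multiset.singleton_eq_cons_iff]
        exact h₁
      rw [Multiset.singleton_eq_cons_iff] at h₂
      exact Or.inr ⟨h₂.1.symm, rfl⟩

/-- A subdivided loop becomes a double edge, whose factor `1 / 2!` replaces the `1 / 2` of the loop.
This agreement is what makes the weights multiplicative under bridge insertion. -/
theorem edgeWeight_spokes {w : ℕ} {e : Sym2 ℕ} (hw : w ∉ e) :
    edgeWeight (spokes w e) = if e.IsDiag then 1 / 2 else 1 := by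
  induction e with | _ a b =>
  rw [Sym2.mem_iff, not_or] at hw
  rw [spokes_mk]
  unfold edgeWeight
  by_cases hab : a = b
  · subst hab
    have : Multiset.countP Sym2.IsDiag ({s(w, a), s(w, a)} : Multiset (Sym2 ℕ)) = 0 := by
      simp [Multiset.countP_eq_zero, hw]
    rw [this]
    simp
  · have : Multiset.countP Sym2.IsDiag ({s(w, a), s(w, b)} : Multiset (Sym2 ℕ)) = 0 := by
      simp [Multiset.countP_eq_zero, hw]
    have hne : s(w, a) ≠ s(w, b) := fun h => hab (Sym2.congr_right.mp h)
    have hnd : Multiset.Nodup ({s(w, a), s(w, b)} : Multiset (Sym2 ℕ)) := by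
      simpa [Multiset.insert_eq_cons] using hne
    rw [this, Finset.prod_eq_one]
    · simp [hab]
    · intro e he
      rw [Multiset.count_eq_one_of_mem hnd (Multiset.mem_toFinset.mp he)]
      simp

/-- Subdivide the edge `e` of `H` by a new vertex `w`. -/
def subdivide (H : Multigraph) (e : Sym2 ℕ) (w : ℕ) : Multigraph where
  -- The ends of `e` are included so that incidence holds even if `e` is not an edge of `H`.
  verts := insert w (H.verts ∪ e.toFinset)
  edges := H.edges.erase e + spokes w e
  incidence := by
    intro e' he' v hv
    rw [Finset.mem_insert, Finset.mem_union]
    rcases Multiset.mem_add.mp he' with h | h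
    · exact Or.inr (Or.inl (H.incidence _ (Multiset.mem_of_mem_erase h) v hv))
    · obtain ⟨a, ha, rfl⟩ := mem_spokes.mp h
      rcases Sym2.mem_iff.mp hv with rfl | rfl
      · exact Or.inl rfl
      · exact Or.inr (Or.inr (Sym2.mem_toFinset.mpr ha))

/-- Join disjoint multigraphs by an edge between `w` and `x`. -/
def bridgeJoin (P : Multigraph) (w : ℕ) (Q : Multigraph) (x : ℕ) : Multigraph where
  verts := P.verts ∪ Q.verts ∪ {w, x}
  edges := P.edges + Q.edges + {s(w, x)}
  incidence := by
    intro e he v hv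
    simp only [Multiset.mem_add, Multiset.mem_singleton, or_assoc] at he
    simp only [Finset.mem_union, Finset.mem_insert, Finset.mem_singleton]
    rcases he with h | h | rfl
    · exact Or.inl (Or.inl (P.incidence e h v hv))
    · exact Or.inl (Or.inr (Q.incidence e h v hv))
    · exact Or.inr (Sym2.mem_iff.mp hv)

theorem subdivide_verts {H : Multigraph} {e : Sym2 ℕ} (he : e ∈ H.edges) (w : ℕ) :
    (H.subdivide e w).verts = insert w H.verts := by
  have : H.verts ∪ e.toFinset = H.verts := Finset.union_eq_left.mpr fun v hv =>
    H.incidence e he v (Sym2.mem_toFinset.mp hv)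
  exact congrArg (insert w) this

theorem notMem_edge_of_notMem_verts {H : Multigraph} {e : Sym2 ℕ} (he : e ∈ H.edges) {w : ℕ}
    (hw : w ∉ H.verts) : w ∉ e := fun h => hw (H.incidence e he w h)

theorem weight_subdivide {H : Multigraph} {e : Sym2 ℕ} (he : e ∈ H.edges) {w : ℕ}
    (hw : w ∉ H.verts) : (H.subdivide e w).weight = H.edges.count e * H.weight := by
  rw [weight_eq_edgeWeight, weight_eq_edgeWeight, count_mul_edgeWeight he]
  change edgeWeight (H.edges.erase e + spokes w e) = _
  rw [edgeWeight_add, edgeWeight_spokes (notMem_edge_of_notMem_verts he hw), mul_comm]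
  intro e' he' h
  obtain ⟨a, -, rfl⟩ := mem_spokes.mp h
  exact hw (H.incidence _ (Multiset.mem_of_mem_erase he') w (Sym2.mem_mk_left _ _))

theorem weight_bridgeJoin {P Q : Multigraph} (hPQ : Disjoint P.verts Q.verts) {w x : ℕ}
    (hw : w ∈ P.verts) (hx : x ∈ Q.verts) :
    (bridgeJoin P w Q x).weight = P.weight * Q.weight := by
  rw [weight_eq_edgeWeight]
  change edgeWeight (P.edges + Q.edges + {s(w, x)}) = _
  have hwx : w ≠ x := fun h => Finset.disjoint_left.mp hPQ hw (h ▸ hx)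
  have h₁ : edgeWeight {s(w, x)} = 1 := by
    unfold edgeWeight
    simp [Multiset.countP_eq_zero.mpr, hwx]
  rw [edgeWeight_add, edgeWeight_add, h₁, mul_one]
  · rfl
  · intro e h₁ h₂
    induction e with | _ a b =>
    exact Finset.disjoint_left.mp hPQ (P.incidence _ h₁ a (Sym2.mem_mk_left _ _))
      (Q.incidence _ h₂ a (Sym2.mem_mk_left _ _))
  · intro e he he'
    rw [Multiset.mem_singleton] at he'
    subst he'
    rcases Multiset.mem_add.mp he with h | h
    · exact Finset.disjoint_left.mp hPQ (P.incidence _ h x (Sym2.mem_mk_right _ _)) hx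
    · exact Finset.disjoint_left.mp hPQ hw (Q.incidence _ h w (Sym2.mem_mk_left _ _))

theorem Connected.subdivide {H : Multigraph} (hH : H.Connected) {e : Sym2 ℕ} (he : e ∈ H.edges)
    (w : ℕ) : (H.subdivide e w).Connected := by
  have hv := subdivide_verts he w
  rw [connected_iff, hv]
  refine ⟨Finset.insert_nonempty _ _, fun A hA hne hAV => ?_⟩
  have hspoke : ∀ a ∈ e, s(w, a) ∈ (H.subdivide e w).edges := fun a ha =>
    Multiset.mem_add.mpr (Or.inr (mem_spokes.mpr ⟨a, ha, rfl⟩))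
  obtain ⟨c, hc⟩ : ∃ c, c ∈ e := by
    induction e with | _ a b => exact ⟨a, Sym2.mem_mk_left _ _⟩
  have hcV := H.incidence e he c hc
  by_cases h₁ : A ∩ H.verts = ∅
  · have hcA : c ∉ A := fun h => by
      have := Finset.mem_inter.mpr ⟨h, hcV⟩
      rw [h₁] at this
      simp at this
    obtain ⟨u, hu⟩ := hne
    rcases Finset.mem_insert.mp (hA hu) with rfl | huV
    · exact ⟨u, hu, c, Finset.mem_sdiff.mpr ⟨Finset.mem_insert_of_mem hcV, hcA⟩, hspoke c hc⟩
    · have := Finset.mem_inter.mpr ⟨hu, huV⟩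
      rw [h₁] at this
      simp at this
  · by_cases h₂ : A ∩ H.verts = H.verts
    · have hsub : H.verts ⊆ A := Finset.inter_eq_right.mp h₂
      have hwA : w ∉ A := fun h => hAV (Finset.Subset.antisymm hA (Finset.insert_subset h hsub))
      exact ⟨c, hsub hcV, w, Finset.mem_sdiff.mpr ⟨Finset.mem_insert_self _ _, hwA⟩,
        Sym2.eq_swap ▸ hspoke c hc⟩
    · obtain ⟨a, ha, b, hb, hab⟩ := hH.exists_crossing Finset.inter_subset_right
        (Finset.nonempty_iff_ne_empty.mpr h₁) h₂
      rw [Finset.mem_inter] at ha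
      rw [Finset.mem_sdiff, Finset.mem_inter, not_and'] at hb
      have hbA := hb.2 hb.1
      by_cases hab' : s(a, b) = e
      · subst hab'
        by_cases hwA : w ∈ A
        · exact ⟨w, hwA, b, Finset.mem_sdiff.mpr ⟨Finset.mem_insert_of_mem hb.1, hbA⟩,
            hspoke b (Sym2.mem_mk_right _ _)⟩
        · exact ⟨a, ha.1, w, Finset.mem_sdiff.mpr ⟨Finset.mem_insert_self _ _, hwA⟩,
            by rw [Sym2.eq_swap (a := a) (b := w)]; exact hspoke a (Sym2.mem_mk_left _ _)⟩
      · exact ⟨a, ha.1, b, Finset.mem_sdiff.mpr ⟨Finset.mem_insert_of_mem hb.1, hbA⟩,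
          Multiset.mem_add.mpr (Or.inl ((Multiset.mem_erase_of_ne hab').mpr hab))⟩

theorem Connected.subset_or_disjoint {P : Multigraph} (hP : P.Connected) {A : Finset ℕ}
    (h : ∀ a ∈ A, ∀ b, b ∉ A → s(a, b) ∉ P.edges) : P.verts ⊆ A ∨ Disjoint P.verts A := by
  by_contra! hcon
  obtain ⟨a, ha, b, hb, hab⟩ := hP.exists_crossing (A := P.verts ∩ A) Finset.inter_subset_left
    (Finset.nonempty_iff_ne_empty.mpr fun h => hcon.2 (Finset.disjoint_iff_inter_eq_empty.mpr h))
    (fun h => hcon.1 (Finset.inter_eq_left.mp h))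
  rw [Finset.mem_sdiff, Finset.mem_inter, not_and] at hb
  exact h a (Finset.mem_inter.mp ha).2 b (hb.2 hb.1) hab

theorem Connected.bridgeJoin {P Q : Multigraph} (hP : P.Connected) (hQ : Q.Connected) {w x : ℕ}
    (hw : w ∈ P.verts) (hx : x ∈ Q.verts) : (bridgeJoin P w Q x).Connected := by
  have hv : (Multigraph.bridgeJoin P w Q x).verts = P.verts ∪ Q.verts :=
    Finset.union_eq_left.mpr (by
      intro v hv
      simp only [Finset.mem_insert, Finset.mem_singleton] at hv
      rcases hv with rfl | rfl
      · exact Finset.mem_union_left _ hw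
      · exact Finset.mem_union_right _ hx)
  rw [connected_iff, hv]
  refine ⟨⟨w, Finset.mem_union_left _ hw⟩, fun A hA hne hAV => ?_⟩
  by_contra! hcon
  have hcon' : ∀ a ∈ A, ∀ b, b ∉ A → s(a, b) ∉ (Multigraph.bridgeJoin P w Q x).edges := by
    intro a ha b hb hab
    refine hcon a ha b (Finset.mem_sdiff.mpr ⟨?_, hb⟩) hab
    rw [← hv]
    exact (Multigraph.bridgeJoin P w Q x).incidence _ hab _ (Sym2.mem_mk_right _ _)
  have hbr : s(w, x) ∈ (Multigraph.bridgeJoin P w Q x).edges :=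
    Multiset.mem_add.mpr (Or.inr (Multiset.mem_singleton_self _))
  have h₁ := hP.subset_or_disjoint (A := A) fun a ha b hb hab => hcon' a ha b hb
    (Multiset.mem_add.mpr (Or.inl (Multiset.mem_add.mpr (Or.inl hab))))
  have h₂ := hQ.subset_or_disjoint (A := A) fun a ha b hb hab => hcon' a ha b hb
    (Multiset.mem_add.mpr (Or.inl (Multiset.mem_add.mpr (Or.inr hab))))
  rcases h₁ with h₁ | h₁ <;> rcases h₂ with h₂ | h₂
  · exact hAV (Finset.Subset.antisymm hA (Finset.union_subset h₁ h₂))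
  · exact hcon' w (h₁ hw) x (Finset.disjoint_left.mp h₂ hx) hbr
  · exact hcon' x (h₂ hx) w (Finset.disjoint_left.mp h₁ hw) (Sym2.eq_swap ▸ hbr)
  · obtain ⟨a, ha⟩ := hne
    rcases Finset.mem_union.mp (hA ha) with h | h
    · exact Finset.disjoint_left.mp h₁ h ha
    · exact Finset.disjoint_left.mp h₂ h ha

/-- Cutting a cubic multigraph at a bridge `wx` leaves on the side of `w` a connected multigraph with
an edge subdivided by `w`. -/
theorem exists_subdivide {G : Multigraph} (hG : G.Connected) (hcub : G.IsCubic) {S : Finset ℕ}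
    (hS : G.IsPendant S) (h2 : 2 ≤ S.card) {w x : ℕ} (hw : w ∈ S) (hx : x ∈ G.verts \ S)
    (hwx : s(w, x) ∈ G.edges) :
    ∃ H : Multigraph, ∃ e ∈ H.edges, H.Connected ∧ H.verts = S.erase w ∧
      (H.subdivide e w).edges = G.edges.filter (fun e => e ∈ S.sym2) := by
  have hxS := (Finset.mem_sdiff.mp hx).2
  have hwx' : w ≠ x := fun h => hxS (h ▸ hw)
  have hdeg := hcub w (hS.1 hw)
  obtain ⟨p, hp, q, hq, hpq⟩ := hS.exists_inner_crossing hG (Finset.singleton_subset_iff.mpr hw)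
    (Finset.singleton_nonempty w) (by rintro rfl; simp at h2)
  have c₁ : 0 < cut G.edges {w} (S \ {w}) := cut_pos_iff.mpr ⟨p, hp, q, hq, hpq⟩
  have c₂ : 0 < cut G.edges {w} {x} :=
    cut_pos_iff.mpr ⟨w, Finset.mem_singleton_self _, x, Finset.mem_singleton_self _, hwx⟩
  have c₃ := cut_add_cut_le_degree G (v := w) (A := S \ {w}) (B := {x})
    (by simp [hxS]) (by simp) (by simpa using hwx')
  -- Besides the bridge, `w` has an edge into the rest of `S`, so a loop would raise its degree
  -- above three.
  have hloop : s(w, w) ∉ G.edges := by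
    rw [← Multiset.count_eq_zero]
    omega
  have hcount : G.edges.countP (fun e => w ∈ e) = 3 := by
    rw [degree, Multiset.count_eq_zero.mpr hloop] at hdeg
    exact hdeg
  set F := G.edges.filter (fun e => e ∈ S.sym2) with hF
  have hout : G.edges.countP (fun e => w ∈ e ∧ e ∉ S.sym2) ≤ cut G.edges S (G.verts \ S) := by
    refine countP_le_countP_of_imp ?_
    rintro e he ⟨hwe, heS⟩
    obtain ⟨y, rfl⟩ := hwe
    rw [Finset.mk_mem_sym2_iff, not_and] at heS
    exact ⟨w, hw, y, Finset.mem_sdiff.mpr ⟨G.incidence _ he _ (Sym2.mem_mk_right _ _), heS hw⟩, rfl⟩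
  have hout' : 0 < G.edges.countP (fun e => w ∈ e ∧ e ∉ S.sym2) :=
    Multiset.countP_pos_of_mem hwx ⟨Sym2.mem_mk_left _ _, by simp [hxS]⟩
  have hin : (F.filter (fun e => w ∈ e)).card = 2 := by
    have h₁ := Multiset.countP_eq_countP_filter_add G.edges (fun e => w ∈ e) (fun e => e ∈ S.sym2)
    rw [Multiset.countP_filter, Multiset.countP_filter] at h₁
    rw [hS.2] at hout
    rw [← Multiset.countP_eq_card_filter, hF, Multiset.countP_filter]
    omega
  obtain ⟨e₁, e₂, hFw⟩ := Multiset.card_eq_two.mp hin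
  have hend : ∀ e ∈ F.filter (fun e => w ∈ e), ∃ y ∈ S.erase w, e = s(w, y) := by
    intro e he
    simp only [Multiset.mem_filter, hF] at he
    obtain ⟨⟨heG, heS⟩, y, rfl⟩ := he
    rw [Finset.mk_mem_sym2_iff] at heS
    refine ⟨y, Finset.mem_erase.mpr ⟨?_, heS.2⟩, rfl⟩
    rintro rfl
    exact hloop heG
  obtain ⟨y, hy, rfl⟩ := hend e₁ (by rw [hFw]; simp)
  obtain ⟨z, hz, rfl⟩ := hend e₂ (by rw [hFw]; simp)
  -- Suppress `w`: its two edges inside `S` are merged into `yz`, a loop if `y = z`.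
  let H : Multigraph :=
    { verts := S.erase w
      edges := s(y, z) ::ₘ F.filter (fun e => w ∉ e)
      incidence := by
        intro e he v hv
        rcases Multiset.mem_cons.mp he with rfl | he
        · rcases Sym2.mem_iff.mp hv with rfl | rfl
          · exact hy
          · exact hz
        · obtain ⟨h₁, h₂⟩ := Multiset.mem_filter.mp he
          rw [hF, Multiset.mem_filter, Finset.mem_sym2_iff] at h₁
          exact Finset.mem_erase.mpr ⟨fun h => h₂ (h ▸ hv), h₁.2 v hv⟩ }
  have hmem : ∀ {a b : ℕ}, a ∈ S → b ∈ S → s(a, b) ∈ G.edges → w ≠ a → w ≠ b →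
      s(a, b) ∈ H.edges := by
    intro a b ha hb hab hwa hwb
    refine Multiset.mem_cons_of_mem (Multiset.mem_filter.mpr ⟨Multiset.mem_filter.mpr
      ⟨hab, Finset.mk_mem_sym2_iff.mpr ⟨ha, hb⟩⟩, ?_⟩)
    simp [hwa, hwb]
  refine ⟨H, s(y, z), Multiset.mem_cons_self _ _, ?_, rfl, ?_⟩
  · rw [connected_iff]
    -- An edge leaving `A` inside `S` cannot end at `w`, whose neighbours `y` and `z` are outside
    -- `A`, so it survives in `H`. If both `y` and `z` are in `A`, the complement is used; if
    -- exactly one is, the new edge `yz` crosses.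
    have main : ∀ A ⊆ S.erase w, A.Nonempty → y ∉ A → z ∉ A →
        ∃ a ∈ A, ∃ b ∈ S.erase w \ A, s(a, b) ∈ H.edges := by
      intro A hA hne hyA hzA
      obtain ⟨a, ha, b, hb, hab⟩ := hS.exists_inner_crossing hG
        (hA.trans (Finset.erase_subset _ _)) hne
        (fun h => hyA (h ▸ Finset.mem_of_mem_erase hy))
      have haS := Finset.mem_erase.mp (hA ha)
      rw [Finset.mem_sdiff] at hb
      have hbw : b ≠ w := by
        rintro rfl
        have : s(b, a) ∈ F.filter (fun e => b ∈ e) := Multiset.mem_filter.mpr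
          ⟨Multiset.mem_filter.mpr ⟨Sym2.eq_swap ▸ hab, Finset.mk_mem_sym2_iff.mpr ⟨hw, haS.2⟩⟩,
            Sym2.mem_mk_left _ _⟩
        rw [hFw, Multiset.insert_eq_cons, Multiset.mem_cons, Multiset.mem_singleton,
          Sym2.congr_right, Sym2.congr_right] at this
        rcases this with h | h
        · exact hyA (h ▸ ha)
        · exact hzA (h ▸ ha)
      exact ⟨a, ha, b, Finset.mem_sdiff.mpr ⟨Finset.mem_erase.mpr ⟨hbw, hb.1⟩, hb.2⟩,
        hmem haS.2 hb.1 hab haS.1.symm hbw.symm⟩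
    refine ⟨⟨y, hy⟩, fun A hA hne hAV => ?_⟩
    change A ⊆ S.erase w at hA
    change A ≠ S.erase w at hAV
    change ∃ a ∈ A, ∃ b ∈ S.erase w \ A, _
    by_cases hyA : y ∈ A <;> by_cases hzA : z ∈ A
    · obtain ⟨a, ha, b, hb, hab⟩ := main (S.erase w \ A) Finset.sdiff_subset
        (Finset.sdiff_nonempty.mpr fun h => hAV (Finset.Subset.antisymm hA h))
        (fun h => (Finset.mem_sdiff.mp h).2 hyA) (fun h => (Finset.mem_sdiff.mp h).2 hzA)
      rw [Finset.sdiff_sdiff_eq_self hA] at hb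
      exact ⟨b, hb, a, ha, Sym2.eq_swap ▸ hab⟩
    · exact ⟨y, hyA, z, Finset.mem_sdiff.mpr ⟨hz, hzA⟩, Multiset.mem_cons_self _ _⟩
    · exact ⟨z, hzA, y, Finset.mem_sdiff.mpr ⟨hy, hyA⟩, Sym2.eq_swap ▸ Multiset.mem_cons_self _ _⟩
    · exact main A hA hne hyA hzA
  · change (s(y, z) ::ₘ F.filter (fun e => w ∉ e)).erase s(y, z) + spokes w s(y, z) = F
    rw [Multiset.erase_cons_head, spokes_mk, ← hFw, add_comm, Multiset.filter_add_not]

end Multigraph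

/-! ### Relabelling invariance and weighted totals. -/

namespace Multigraph

theorem relabel_symm_relabel (H : Multigraph) (σ : Equiv.Perm ℕ) :
    (H.relabel σ).relabel σ.symm = H := by
  ext1
  · simp only [relabel, Finset.map_map]
    ext v
    simp
  · simp only [relabel, Multiset.map_map]
    conv_rhs => rw [← Multiset.map_id H.edges]
    refine Multiset.map_congr rfl fun e _ => ?_
    simp [Sym2.map_map]

theorem relabel_relabel_symm (H : Multigraph) (σ : Equiv.Perm ℕ) :
    (H.relabel σ.symm).relabel σ = H := by
  simpa using relabel_symm_relabel H σ.symm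

theorem joins_map {A B : Finset ℕ} (σ : Equiv.Perm ℕ) (e : Sym2 ℕ) :
    Joins (A.map σ.toEmbedding) (B.map σ.toEmbedding) (Sym2.map σ e) ↔ Joins A B e := by
  induction e with | _ a b => simp [joins_mk]

theorem cut_relabel (H : Multigraph) (σ : Equiv.Perm ℕ) (A B : Finset ℕ) :
    cut (H.relabel σ).edges (A.map σ.toEmbedding) (B.map σ.toEmbedding) = cut H.edges A B := by
  rw [cut, relabel, Multiset.countP_map, ← Multiset.countP_eq_card_filter]
  exact Multiset.countP_congr rfl fun e _ => propext (joins_map σ e)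

theorem TwoEdgeConn.relabel {H : Multigraph} {D : Finset ℕ} (h : TwoEdgeConn H.edges D)
    (σ : Equiv.Perm ℕ) : TwoEdgeConn (H.relabel σ).edges (D.map σ.toEmbedding) := by
  intro A hA hne hneq
  obtain ⟨A, hA', rfl⟩ := Finset.subset_map_iff.mp hA
  rw [← Finset.map_sdiff, cut_relabel]
  exact h A hA' (Finset.map_nonempty.mp hne) fun h => hneq (h ▸ rfl)

theorem degree_relabel (H : Multigraph) (σ : Equiv.Perm ℕ) (v : ℕ) :
    (H.relabel σ).degree (σ v) = H.degree v := by
  have h₁ : s(σ v, σ v) = Sym2.map σ s(v, v) := rfl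
  rw [degree, degree, h₁, relabel]
  simp only
  rw [Multiset.count_map_eq_count' _ _ (Sym2.map.injective σ.injective), Multiset.countP_map,
    ← Multiset.countP_eq_card_filter]
  congr 1
  exact Multiset.countP_congr rfl fun e _ => propext (by simp [Sym2.mem_map])

theorem weight_relabel (H : Multigraph) (σ : Equiv.Perm ℕ) : (H.relabel σ).weight = H.weight := by
  have hinj := Sym2.map.injective σ.injective
  rw [weight, weight, relabel]
  simp only
  rw [Multiset.countP_map, ← Multiset.countP_eq_card_filter]
  congr 1
  · congr 1
    exact Multiset.countP_congr rfl fun e _ => propext (by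
      induction e with | _ a b => simp)
  · rw [Multiset.toFinset_map, Finset.prod_image fun _ _ _ _ h => hinj h]
    refine Finset.prod_congr rfl fun e _ => ?_
    rw [Multiset.count_map_eq_count' _ _ hinj]

theorem relabel_subdivide (H : Multigraph) (e : Sym2 ℕ) (w : ℕ) (σ : Equiv.Perm ℕ) :
    (H.subdivide e w).relabel σ = (H.relabel σ).subdivide (Sym2.map σ e) (σ w) := by
  have hinj := Sym2.map.injective σ.injective
  ext1
  · simp only [relabel, subdivide, Finset.map_insert, Finset.map_union]
    congr 1
    congr 1
    ext v
    simp only [Finset.mem_map_equiv, Sym2.mem_toFinset, Sym2.mem_map]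
    exact ⟨fun h => ⟨_, h, by simp⟩, fun ⟨a, ha, h⟩ => by simpa [← h] using ha⟩
  · simp only [relabel, subdivide, Multiset.map_add]
    rw [Multiset.map_erase _ hinj]
    congr 1
    induction e with | _ a b => rfl

theorem mem_relabel_verts {H : Multigraph} {σ : Equiv.Perm ℕ} {v : ℕ} :
    σ v ∈ (H.relabel σ).verts ↔ v ∈ H.verts := by
  simp [relabel]

/-- The members of `𝓑` with vertex set `U` and exactly `m` edges. -/
def onVerts (𝓑 : Set Multigraph) (U : Finset ℕ) (m : ℕ) : Set Multigraph :=
  {H ∈ 𝓑 | H.verts = U ∧ H.edges.card = m}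

theorem finite_onVerts (𝓑 : Set Multigraph) (U : Finset ℕ) (m : ℕ) : (onVerts 𝓑 U m).Finite := by
  have h : ((fun s : Sym (Sym2 ℕ) m => (s : Multiset (Sym2 ℕ))) ''
      (((U.sym2).sym m : Finset (Sym (Sym2 ℕ) m)) : Set (Sym (Sym2 ℕ) m))).Finite :=
    (Finset.finite_toSet _).image _
  refine Set.Finite.of_finite_image (f := Multigraph.edges) (h.subset ?_) ?_
  · rintro _ ⟨H, ⟨_, hv, hc⟩, rfl⟩
    refine ⟨⟨H.edges, hc⟩, ?_, rfl⟩
    refine Finset.mem_coe.mpr (Finset.mem_sym_iff.mpr fun e he => ?_)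
    exact Finset.mem_sym2_iff.mpr fun v hve => hv ▸ H.incidence e he v hve
  · rintro H ⟨_, hv, _⟩ H' ⟨_, hv', _⟩ he
    exact Multigraph.ext (hv.trans hv'.symm) he

/-- `onVerts` as a finset. -/
noncomputable def members (𝓑 : Set Multigraph) (U : Finset ℕ) (m : ℕ) : Finset Multigraph :=
  (finite_onVerts 𝓑 U m).toFinset

variable {𝓑 : Set Multigraph} {α : ℝ} {U : Finset ℕ} {m : ℕ}

theorem mem_members {H : Multigraph} :
    H ∈ members 𝓑 U m ↔ H ∈ 𝓑 ∧ H.verts = U ∧ H.edges.card = m :=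
  (finite_onVerts 𝓑 U m).mem_toFinset

theorem IsBridgeStable.relabel_mem_members (hB : IsBridgeStable 𝓑 α) (σ : Equiv.Perm ℕ)
    {H : Multigraph} (hH : H ∈ members 𝓑 U m) :
    H.relabel σ ∈ members 𝓑 (U.map σ.toEmbedding) m := by
  rw [mem_members] at hH ⊢
  obtain ⟨h₁, rfl, rfl⟩ := hH
  exact ⟨hB.relabel H h₁ σ, rfl, Multiset.card_map _ _⟩

theorem IsBridgeStable.sum_members_map (hB : IsBridgeStable 𝓑 α) (σ : Equiv.Perm ℕ)
    {f g : Multigraph → ℝ} (hf : ∀ H ∈ members 𝓑 U m, g (H.relabel σ) = f H) :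
    ∑ H ∈ members 𝓑 (U.map σ.toEmbedding) m, g H = ∑ H ∈ members 𝓑 U m, f H := by
  symm
  refine Finset.sum_nbij' (fun H => H.relabel σ) (fun H => H.relabel σ.symm)
    (fun H hH => hB.relabel_mem_members σ hH) (fun H hH => ?_)
    (fun H _ => relabel_symm_relabel H σ) (fun H _ => relabel_relabel_symm H σ)
    (fun H hH => (hf H hH).symm)
  have := hB.relabel_mem_members σ.symm hH
  rwa [Finset.map_map, show σ.toEmbedding.trans σ.symm.toEmbedding = Function.Embedding.refl ℕ by
    ext; simp, Finset.map_refl] at this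

/-- The total weight of the members on `U` with `m` edges. -/
noncomputable def mass (𝓑 : Set Multigraph) (U : Finset ℕ) (m : ℕ) : ℝ :=
  ∑ H ∈ members 𝓑 U m, H.weight

/-- A new vertex `w` subdividing the edge `e` of `H` lies in a two-edge-connected set of at least `t`
vertices. -/
def GoodRoot (t : ℕ) (w : ℕ) (H : Multigraph) (e : Sym2 ℕ) : Prop :=
  ∃ D ⊆ (H.subdivide e w).verts, t ≤ D.card ∧ w ∈ D ∧ TwoEdgeConn (H.subdivide e w).edges D

open Classical in
/-- The weight of `H` times the number of its edges `e` with `GoodRoot t w H e`. -/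
noncomputable def goodRootWeight (t w : ℕ) (H : Multigraph) : ℝ :=
  ∑ e ∈ H.edges.toFinset, if GoodRoot t w H e then H.edges.count e * H.weight else 0

/-- The total weight of the rooted members on `U` with `m` edges such that a new vertex `w`
subdividing the root edge lies in a two-edge-connected set of at least `t` vertices. -/
noncomputable def goodMass (𝓑 : Set Multigraph) (U : Finset ℕ) (m t w : ℕ) : ℝ :=
  ∑ H ∈ members 𝓑 U m, goodRootWeight t w H

theorem GoodRoot.relabel {t w : ℕ} {H : Multigraph} {e : Sym2 ℕ} (h : GoodRoot t w H e)
    (σ : Equiv.Perm ℕ) : GoodRoot t (σ w) (H.relabel σ) (Sym2.map σ e) := by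
  obtain ⟨D, hD, ht, hw, hD'⟩ := h
  rw [GoodRoot, ← relabel_subdivide]
  exact ⟨D.map σ.toEmbedding, Finset.map_subset_map.mpr hD, by rwa [Finset.card_map],
    Finset.mem_map_of_mem _ hw, hD'.relabel σ⟩

theorem goodRoot_relabel_iff {t w : ℕ} {H : Multigraph} {e : Sym2 ℕ} (σ : Equiv.Perm ℕ) :
    GoodRoot t (σ w) (H.relabel σ) (Sym2.map σ e) ↔ GoodRoot t w H e := by
  refine ⟨fun h => ?_, fun h => h.relabel σ⟩
  simpa [relabel_symm_relabel, Sym2.map_map] using h.relabel σ.symm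

theorem goodRootWeight_relabel (t w : ℕ) (H : Multigraph) (σ : Equiv.Perm ℕ) :
    goodRootWeight t (σ w) (H.relabel σ) = goodRootWeight t w H := by
  classical
  have hinj := Sym2.map.injective σ.injective
  have h₁ : (H.relabel σ).edges.toFinset = H.edges.toFinset.image (Sym2.map σ) :=
    Multiset.toFinset_map _ _
  rw [goodRootWeight, h₁, Finset.sum_image fun _ _ _ _ h => hinj h, goodRootWeight]
  refine Finset.sum_congr rfl fun e _ => ?_
  rw [weight_relabel, show (H.relabel σ).edges.count (Sym2.map σ e) = H.edges.count e from
    Multiset.count_map_eq_count' _ _ hinj _]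
  exact if_congr (goodRoot_relabel_iff σ) rfl rfl

/-- Map `U` onto `U'` by any permutation and then swap the image of `w` with `w'`; both are outside
`U'`, so the swap leaves `U'` alone. -/
theorem exists_perm_map_eq {U U' : Finset ℕ} (h : U.card = U'.card) {w w' : ℕ} (hw : w ∉ U)
    (hw' : w' ∉ U') : ∃ σ : Equiv.Perm ℕ, U.map σ.toEmbedding = U' ∧ σ w = w' := by
  obtain ⟨σ, rfl⟩ := Equiv.Perm.exists_map_finset_eq _ _ h
  have hσw : σ w ∉ U.map σ.toEmbedding := by simpa using hw
  refine ⟨σ.trans (Equiv.swap (σ w) w'), ?_, by simp⟩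
  ext v
  simp only [Finset.mem_map_equiv] at hσw hw' ⊢
  rw [Equiv.symm_trans_apply, Equiv.symm_swap]
  by_cases h₁ : v = σ w
  · subst h₁; simp_all
  · by_cases h₂ : v = w'
    · subst h₂; simp_all
    · rw [Equiv.swap_apply_of_ne_of_ne h₁ h₂]

theorem IsBridgeStable.mass_eq (hB : IsBridgeStable 𝓑 α) {U' : Finset ℕ} (h : U.card = U'.card) :
    mass 𝓑 U m = mass 𝓑 U' m := by
  obtain ⟨σ, rfl⟩ := Equiv.Perm.exists_map_finset_eq _ _ h
  exact (hB.sum_members_map σ fun H _ => weight_relabel H σ).symm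

theorem IsBridgeStable.goodMass_eq (hB : IsBridgeStable 𝓑 α) {U' : Finset ℕ}
    (h : U.card = U'.card) (t : ℕ) {w w' : ℕ} (hw : w ∉ U) (hw' : w' ∉ U') :
    goodMass 𝓑 U m t w = goodMass 𝓑 U' m t w' := by
  obtain ⟨σ, rfl, rfl⟩ := exists_perm_map_eq h hw hw'
  exact (hB.sum_members_map σ fun H _ => goodRootWeight_relabel t w H σ).symm

/-- The weighted sum of the numbers of good sets. -/
noncomputable def goodSum (𝓑 : Set Multigraph) (U : Finset ℕ) (m : ℕ) (I : Finset ℕ) (t : ℕ) : ℝ :=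
  ∑ H ∈ members 𝓑 U m, H.weight * (H.goodSets I t).card

/-- The hypothesis concerns the vertex sets `{1, …, 2n}` only; relabelling carries it to arbitrary
ones, as needed for the two sides of a bridge. -/
theorem IsBridgeStable.isCubic_of_mem_members (hB : IsBridgeStable 𝓑 α)
    (hcubic : ∀ n : ℕ, ∀ H ∈ ofSize 𝓑 (2 * n) (3 * n), H.IsCubic) {k : ℕ} (hU : U.card = 2 * k)
    {H : Multigraph} (hH : H ∈ members 𝓑 U (3 * k)) : H.IsCubic := by
  obtain ⟨σ, hσ⟩ := Equiv.Perm.exists_map_finset_eq U (Finset.Icc 1 (2 * k)) (by simpa using hU)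
  have h₁ := hB.relabel_mem_members σ hH
  rw [hσ, mem_members] at h₁
  have h₂ := hcubic k _ h₁
  intro v hv
  rw [← degree_relabel H σ]
  exact h₂ _ (mem_relabel_verts.mpr hv)

theorem sum_count_mul_weight (H : Multigraph) :
    ∑ e ∈ H.edges.toFinset, (H.edges.count e : ℝ) * H.weight = H.edges.card * H.weight := by
  rw [← Finset.sum_mul, ← Nat.cast_sum, Multiset.toFinset_sum_count_eq]

/-- For `t = 0` every edge is a good root, as the singleton `{w}` is vacuously 2-edge-connected.
Thus good sides with `t = 0` cover the plain count of all sides. -/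
theorem goodMass_zero {w : ℕ} : goodMass 𝓑 U m 0 w = m * mass 𝓑 U m := by
  rw [goodMass, mass, Finset.mul_sum]
  refine Finset.sum_congr rfl fun H hH => ?_
  obtain ⟨-, -, rfl⟩ := mem_members.mp hH
  rw [← sum_count_mul_weight, goodRootWeight]
  refine Finset.sum_congr rfl fun e _ => if_pos ?_
  refine ⟨{w}, by simp [subdivide], Nat.zero_le _, Finset.mem_singleton_self _, fun A hA hne hn => ?_⟩
  rcases Finset.subset_singleton_iff.mp hA with rfl | rfl
  · simp at hne
  · exact absurd rfl hn

theorem mass_nonneg : 0 ≤ mass 𝓑 U m := Finset.sum_nonneg fun H _ => (weight_pos H).le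

theorem goodRootWeight_nonneg (t w : ℕ) (H : Multigraph) : 0 ≤ goodRootWeight t w H := by
  classical
  refine Finset.sum_nonneg fun e _ => ?_
  have := (weight_pos H).le
  split_ifs <;> positivity

theorem goodMass_nonneg {t w : ℕ} : 0 ≤ goodMass 𝓑 U m t w :=
  Finset.sum_nonneg fun H _ => goodRootWeight_nonneg t w H

end Multigraph

/-! ### Members with a bridge as pairs of rooted members. -/

namespace Multigraph

section bridgeJoin
variable {P Q : Multigraph} {w x : ℕ}

theorem bridgeJoin_verts (hw : w ∈ P.verts) (hx : x ∈ Q.verts) :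
    (bridgeJoin P w Q x).verts = P.verts ∪ Q.verts :=
  Finset.union_eq_left.mpr (by
    intro v hv
    simp only [Finset.mem_insert, Finset.mem_singleton] at hv
    rcases hv with rfl | rfl
    · exact Finset.mem_union_left _ hw
    · exact Finset.mem_union_right _ hx)

theorem filter_edges_eq_self (P : Multigraph) :
    P.edges.filter (fun e => e ∈ P.verts.sym2) = P.edges :=
  Multiset.filter_eq_self.mpr fun e he => Finset.mem_sym2_iff.mpr fun v hv => P.incidence e he v hv

theorem filter_edges_eq_zero {S : Finset ℕ} (h : Disjoint P.verts S) :
    P.edges.filter (fun e => e ∈ S.sym2) = 0 := by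
  refine Multiset.filter_eq_nil.mpr fun e he heS => ?_
  induction e with | _ a b =>
  exact Finset.disjoint_left.mp h (P.incidence _ he a (Sym2.mem_mk_left a b))
    (Finset.mk_mem_sym2_iff.mp heS).1

theorem filter_bridgeJoin_left (h : Disjoint P.verts Q.verts) (hx : x ∈ Q.verts) :
    (bridgeJoin P w Q x).edges.filter (fun e => e ∈ P.verts.sym2) = P.edges := by
  have hxP : x ∉ P.verts := Finset.disjoint_right.mp h hx
  rw [bridgeJoin, Multiset.filter_add, Multiset.filter_add, filter_edges_eq_self,
    filter_edges_eq_zero h.symm]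
  simp [Multiset.filter_singleton, hxP]

theorem filter_bridgeJoin_right (h : Disjoint P.verts Q.verts) (hw : w ∈ P.verts) :
    (bridgeJoin P w Q x).edges.filter (fun e => e ∈ Q.verts.sym2) = Q.edges := by
  have hwQ : w ∉ Q.verts := Finset.disjoint_left.mp h hw
  rw [bridgeJoin, Multiset.filter_add, Multiset.filter_add, filter_edges_eq_self,
    filter_edges_eq_zero h]
  simp [Multiset.filter_singleton, hwQ]

theorem isPendant_bridgeJoin (h : Disjoint P.verts Q.verts) (hw : w ∈ P.verts) (hx : x ∈ Q.verts) :
    (bridgeJoin P w Q x).IsPendant P.verts := by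
  have hv := bridgeJoin_verts hw hx
  refine ⟨hv ▸ Finset.subset_union_left, ?_⟩
  rw [hv, Finset.union_sdiff_cancel_left h, cut, bridgeJoin]
  rw [Multiset.countP_add, Multiset.countP_add]
  have h₁ : Multiset.countP (Joins P.verts Q.verts) P.edges = 0 := by
    rw [Multiset.countP_eq_zero]
    rintro _ he ⟨a, ha, b, hb, rfl⟩
    exact Finset.disjoint_left.mp h (P.incidence _ he b (Sym2.mem_mk_right _ _)) hb
  have h₂ : Multiset.countP (Joins P.verts Q.verts) Q.edges = 0 := by
    rw [Multiset.countP_eq_zero]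
    rintro _ he ⟨a, ha, b, hb, rfl⟩
    exact Finset.disjoint_left.mp h ha (Q.incidence _ he a (Sym2.mem_mk_left _ _))
  rw [h₁, h₂, ← Multiset.cons_zero, Multiset.countP_cons_of_pos _ ⟨w, hw, x, hx, rfl⟩]
  rfl

end bridgeJoin

/-- A connected multigraph with a bridge is determined by the two sides and the bridge. -/
theorem IsPendant.edges_eq {G : Multigraph} {S : Finset ℕ} (hS : G.IsPendant S) {w x : ℕ}
    (hw : w ∈ S) (hx : x ∈ G.verts \ S) (hwx : s(w, x) ∈ G.edges) :
    G.edges = G.edges.filter (fun e => e ∈ S.sym2) +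
      G.edges.filter (fun e => e ∈ (G.verts \ S).sym2) + {s(w, x)} := by
  have h₁ : G.edges.filter (Joins S (G.verts \ S)) = {s(w, x)} := by
    have hcard : (G.edges.filter (Joins S (G.verts \ S))).card = 1 := by
      rw [← Multiset.countP_eq_card_filter]
      exact hS.2
    obtain ⟨e, he⟩ := Multiset.card_eq_one.mp hcard
    have : s(w, x) ∈ G.edges.filter (Joins S (G.verts \ S)) :=
      Multiset.mem_filter.mpr ⟨hwx, w, hw, x, hx, rfl⟩
    rw [he, Multiset.mem_singleton] at this
    rw [he, this]
  rw [← h₁]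
  conv_lhs => rw [← Multiset.filter_add_not (fun e => e ∈ S.sym2) G.edges,
    ← Multiset.filter_add_not (fun e => e ∈ (G.verts \ S).sym2)
      (G.edges.filter (fun e => e ∉ S.sym2))]
  rw [Multiset.filter_filter, Multiset.filter_filter, add_assoc]
  congr 2
  · refine Multiset.filter_congr fun e he => ⟨fun h => h.1, fun h => ⟨h, ?_⟩⟩
    induction e with | _ a b =>
    simp only [Finset.mk_mem_sym2_iff, Finset.mem_sdiff] at h ⊢
    exact fun h' => h.1.2 h'.1
  · refine Multiset.filter_congr fun e he => ?_
    induction e with | _ a b =>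
    have ha := G.incidence _ he a (Sym2.mem_mk_left _ _)
    have hb := G.incidence _ he b (Sym2.mem_mk_right _ _)
    simp only [Finset.mk_mem_sym2_iff, Finset.mem_sdiff, joins_mk, ha, hb, true_and]
    tauto

theorem cut_filter {E : Multiset (Sym2 ℕ)} {S A B : Finset ℕ} (hA : A ⊆ S) (hB : B ⊆ S) :
    cut (E.filter (fun e => e ∈ S.sym2)) A B = cut E A B := by
  rw [cut, Multiset.countP_filter]
  refine Multiset.countP_congr rfl fun e _ => propext ⟨fun h => h.1, fun h => ⟨h, ?_⟩⟩
  obtain ⟨a, ha, b, hb, rfl⟩ := h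
  exact Finset.mk_mem_sym2_iff.mpr ⟨hA ha, hB hb⟩

theorem twoEdgeConn_filter_iff {E : Multiset (Sym2 ℕ)} {S D : Finset ℕ} (hD : D ⊆ S) :
    TwoEdgeConn (E.filter (fun e => e ∈ S.sym2)) D ↔ TwoEdgeConn E D := by
  refine forall_congr' fun A => forall_congr' fun hA => ?_
  rw [cut_filter (hA.trans hD) (Finset.sdiff_subset.trans hD)]

/-- Bridge insertion with roots `(H₁, e₁)` and `(H₂, e₂)`. -/
def insertBridge (p : Σ _ : Multigraph, Sym2 ℕ) (w : ℕ) (q : Σ _ : Multigraph, Sym2 ℕ) (x : ℕ) :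
    Multigraph :=
  bridgeJoin (p.1.subdivide p.2 w) w (q.1.subdivide q.2 x) x

theorem isBridgeInsertion_insertBridge {p q : Σ _ : Multigraph, Sym2 ℕ} {w x : ℕ}
    (hp : p.2 ∈ p.1.edges) (hq : q.2 ∈ q.1.edges) (hpc : p.1.Connected) (hqc : q.1.Connected)
    (hw : w ∉ p.1.verts) (hx : x ∉ q.1.verts)
    (h : Disjoint (insert w p.1.verts) (insert x q.1.verts)) :
    IsBridgeInsertion p.1 q.1 (insertBridge p w q x) := by
  obtain ⟨H₁, e₁⟩ := p
  obtain ⟨H₂, e₂⟩ := q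
  induction e₁ with | _ y₁ z₁ =>
  induction e₂ with | _ y₂ z₂ =>
  simp only at hp hq hpc hqc hw hx h
  rw [Finset.disjoint_insert_left, Finset.disjoint_insert_right, Finset.mem_insert, not_or] at h
  obtain ⟨⟨hwx, hw'⟩, hx', hd⟩ := h
  refine ⟨hpc, hqc, ?_, w, x, y₁, z₁, y₂, z₂, hp, hq, hd, hwx, ?_, ?_, ?_, ?_⟩
  · refine (hpc.subdivide hp w).bridgeJoin (hqc.subdivide hq x) ?_ ?_
    · rw [subdivide_verts hp]
      exact Finset.mem_insert_self _ _
    · rw [subdivide_verts hq]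
      exact Finset.mem_insert_self _ _
  · simp [hw, hw']
  · simp [hx, hx']
  · change (H₁.subdivide s(y₁, z₁) w).verts ∪ (H₂.subdivide s(y₂, z₂) x).verts ∪ {w, x} = _
    rw [subdivide_verts hp, subdivide_verts hq]
    ext v
    simp only [Finset.mem_union, Finset.mem_insert, Finset.mem_singleton]
    tauto
  · change H₁.edges.erase s(y₁, z₁) + spokes w s(y₁, z₁) +
      (H₂.edges.erase s(y₂, z₂) + spokes x s(y₂, z₂)) + {s(w, x)} = _
    simp only [spokes_mk, Multiset.insert_eq_cons, ← Multiset.singleton_add]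
    abel

/-- Rooted members of `𝓑`. -/
noncomputable def rooted (𝓑 : Set Multigraph) (U : Finset ℕ) (m : ℕ) :
    Finset (Σ _ : Multigraph, Sym2 ℕ) :=
  (members 𝓑 U m).sigma fun H => H.edges.toFinset

section bijection
variable {𝓑 : Set Multigraph} {α : ℝ}

theorem mem_rooted {U : Finset ℕ} {m : ℕ} {p : Σ _ : Multigraph, Sym2 ℕ} :
    p ∈ rooted 𝓑 U m ↔ p.1 ∈ 𝓑 ∧ p.1.verts = U ∧ p.1.edges.card = m ∧ p.2 ∈ p.1.edges := by
  rw [rooted, Finset.mem_sigma, mem_members, Multiset.mem_toFinset]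
  tauto

theorem subdivide_verts_of_mem_rooted {S : Finset ℕ} {m w : ℕ} {p : Σ _ : Multigraph, Sym2 ℕ}
    (hp : p ∈ rooted 𝓑 (S.erase w) m) (hw : w ∈ S) : (p.1.subdivide p.2 w).verts = S := by
  rw [mem_rooted] at hp
  rw [subdivide_verts hp.2.2.2, hp.2.1, Finset.insert_erase hw]

theorem card_edges_subdivide {H : Multigraph} {e : Sym2 ℕ} (he : e ∈ H.edges) (w : ℕ) :
    (H.subdivide e w).edges.card = H.edges.card + 1 := by
  have := Multiset.card_erase_add_one he
  rw [subdivide, Multiset.card_add, card_spokes]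
  omega

/-- The edges at `w` are the spokes and reveal the root edge; the other edges are those of the
original multigraph without its root. -/
theorem subdivide_injective {p p' : Σ _ : Multigraph, Sym2 ℕ} {w : ℕ} (hp : p.2 ∈ p.1.edges)
    (hp' : p'.2 ∈ p'.1.edges) (hw : w ∉ p.1.verts) (hv : p.1.verts = p'.1.verts)
    (h : (p.1.subdivide p.2 w).edges = (p'.1.subdivide p'.2 w).edges) : p = p' := by
  have key : ∀ {p : Σ _ : Multigraph, Sym2 ℕ}, p.2 ∈ p.1.edges → w ∉ p.1.verts →
      (p.1.subdivide p.2 w).edges.filter (fun e => w ∈ e) = spokes w p.2 ∧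
      (p.1.subdivide p.2 w).edges.filter (fun e => w ∉ e) = p.1.edges.erase p.2 := by
    intro p hp hw
    have h₁ : ∀ e ∈ p.1.edges.erase p.2, w ∉ e := fun e he h =>
      hw (p.1.incidence _ (Multiset.mem_of_mem_erase he) w h)
    have h₂ : ∀ e ∈ spokes w p.2, w ∈ e := fun e he => by
      obtain ⟨a, -, rfl⟩ := mem_spokes.mp he
      exact Sym2.mem_mk_left _ _
    constructor
    · rw [subdivide, Multiset.filter_add, Multiset.filter_eq_nil.mpr h₁,
        Multiset.filter_eq_self.mpr h₂, zero_add]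
    · rw [subdivide, Multiset.filter_add, Multiset.filter_eq_self.mpr h₁,
        Multiset.filter_eq_nil.mpr (fun e he => not_not.mpr (h₂ e he)), add_zero]
  obtain ⟨k₁, k₂⟩ := key hp hw
  obtain ⟨k₁', k₂'⟩ := key hp' (hv ▸ hw)
  rw [h] at k₁ k₂
  have he : p.2 = p'.2 := spokes_injective w (k₁.symm.trans k₁')
  have hE : p.1.edges = p'.1.edges := by
    rw [← Multiset.cons_erase hp, ← Multiset.cons_erase hp', ← k₂, ← k₂', he]
  obtain ⟨H, e⟩ := p
  obtain ⟨H', e'⟩ := p'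
  obtain rfl : H = H' := Multigraph.ext hv hE
  obtain rfl : e = e' := he
  rfl

open Classical in
/-- Members with a bridge whose one side is `S` correspond to the bridge and a rooted member on
either side. -/
theorem sum_pendant_eq (hB : IsBridgeStable 𝓑 α)
    (hcubic : ∀ n : ℕ, ∀ H ∈ ofSize 𝓑 (2 * n) (3 * n), H.IsCubic) {V S : Finset ℕ} (hSV : S ⊆ V) {k l : ℕ} (hk : 1 ≤ k) (hl : 1 ≤ l)
    (hS : S.card = 2 * k + 1) (hT : (V \ S).card = 2 * l + 1) (f : Multigraph → ℝ) :
    ∑ G ∈ (members 𝓑 V (3 * (k + l + 1))).filter (fun G => G.IsPendant S), f G =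
      ∑ wx ∈ S ×ˢ (V \ S), ∑ p ∈ rooted 𝓑 (S.erase wx.1) (3 * k),
        ∑ q ∈ rooted 𝓑 ((V \ S).erase wx.2) (3 * l), f (insertBridge p wx.1 q wx.2) := by
  set T := V \ S with hTdef
  have hST : Disjoint S T := Finset.disjoint_sdiff
  simp_rw [← Finset.sum_product']
  rw [Finset.sum_sigma']
  symm
  refine Finset.sum_nbij
    (fun d : (Σ _ : ℕ × ℕ, (Σ _ : Multigraph, Sym2 ℕ) × (Σ _ : Multigraph, Sym2 ℕ)) =>
      insertBridge d.2.1 d.1.1 d.2.2 d.1.2) ?_ ?_ ?_ (fun _ _ => rfl)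
  · rintro ⟨⟨w, x⟩, p, q⟩ hd
    simp only [Finset.mem_sigma, Finset.mem_product] at hd
    obtain ⟨⟨hw, hx⟩, hp, hq⟩ := hd
    have hP := subdivide_verts_of_mem_rooted hp hw
    have hQ := subdivide_verts_of_mem_rooted hq hx
    have hp' := mem_rooted.mp hp
    have hq' := mem_rooted.mp hq
    have hv : (insertBridge p w q x).verts = V := by
      rw [insertBridge, bridgeJoin_verts (by rwa [hP]) (by rwa [hQ]), hP, hQ, hTdef,
        Finset.union_sdiff_of_subset hSV]
    rw [Finset.mem_filter, mem_members]
    refine ⟨⟨?_, hv, ?_⟩, ?_⟩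
    · refine (hB.stability p.1 q.1 _ (isBridgeInsertion_insertBridge hp'.2.2.2 hq'.2.2.2
        (hB.connected _ hp'.1) (hB.connected _ hq'.1) ?_ ?_ ?_)).mp ⟨hp'.1, hq'.1⟩
      · rw [hp'.2.1]; exact Finset.notMem_erase _ _
      · rw [hq'.2.1]; exact Finset.notMem_erase _ _
      · rw [hp'.2.1, hq'.2.1, Finset.insert_erase hw, Finset.insert_erase hx]
        exact hST
    · change ((p.1.subdivide p.2 w).edges + (q.1.subdivide q.2 x).edges + {s(w, x)}).card = _
      rw [Multiset.card_add, Multiset.card_add, card_edges_subdivide hp'.2.2.2,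
        card_edges_subdivide hq'.2.2.2, hp'.2.2.1, hq'.2.2.1, Multiset.card_singleton]
      ring
    · have := isPendant_bridgeJoin (P := p.1.subdivide p.2 w) (Q := q.1.subdivide q.2 x)
        (w := w) (x := x) (by rwa [hP, hQ]) (by rwa [hP]) (by rwa [hQ])
      rwa [hP] at this
  -- Injectivity: only one edge crosses `S`, which recovers `w` and `x`; the edges inside `S` and
  -- inside `T` then recover the rooted parts.
  · rintro ⟨⟨w, x⟩, p, q⟩ hd ⟨⟨w', x'⟩, p', q'⟩ hd' heq
    simp only [Finset.coe_sigma, Set.mem_sigma_iff, Finset.mem_coe, Finset.mem_product] at hd hd'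
    simp only at heq
    obtain ⟨⟨hw, hx⟩, hp, hq⟩ := hd
    obtain ⟨⟨hw', hx'⟩, hp', hq'⟩ := hd'
    have hP := subdivide_verts_of_mem_rooted hp hw
    have hQ := subdivide_verts_of_mem_rooted hq hx
    have hP' := subdivide_verts_of_mem_rooted hp' hw'
    have hQ' := subdivide_verts_of_mem_rooted hq' hx'
    have hpend : (insertBridge p w q x).IsPendant S := by
      have := isPendant_bridgeJoin (P := p.1.subdivide p.2 w) (Q := q.1.subdivide q.2 x)
        (w := w) (x := x) (by rwa [hP, hQ]) (by rwa [hP]) (by rwa [hQ])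
      rwa [hP] at this
    obtain ⟨rfl, rfl⟩ := hpend.eq_of_crossing hw (Finset.disjoint_right.mp hST hx)
      (Multiset.mem_add.mpr (Or.inr (Multiset.mem_singleton_self _))) hw'
      (Finset.disjoint_right.mp hST hx') (by
        rw [heq]; exact Multiset.mem_add.mpr (Or.inr (Multiset.mem_singleton_self _)))
    have hl := filter_bridgeJoin_left (P := p.1.subdivide p.2 w') (Q := q.1.subdivide q.2 x')
      (w := w') (x := x') (by rwa [hP, hQ]) (by rwa [hQ])
    have hl' := filter_bridgeJoin_left (P := p'.1.subdivide p'.2 w') (Q := q'.1.subdivide q'.2 x')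
      (w := w') (x := x') (by rwa [hP', hQ']) (by rwa [hQ'])
    have hr := filter_bridgeJoin_right (P := p.1.subdivide p.2 w') (Q := q.1.subdivide q.2 x')
      (w := w') (x := x') (by rwa [hP, hQ]) (by rwa [hP])
    have hr' := filter_bridgeJoin_right (P := p'.1.subdivide p'.2 w') (Q := q'.1.subdivide q'.2 x')
      (w := w') (x := x') (by rwa [hP', hQ']) (by rwa [hP'])
    change (insertBridge p w' q x').edges.filter _ = _ at hl hr
    change (insertBridge p' w' q' x').edges.filter _ = _ at hl' hr'
    rw [hP] at hl
    rw [hQ] at hr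
    rw [hP', ← heq, hl] at hl'
    rw [hQ', ← heq, hr] at hr'
    have mp := mem_rooted.mp hp
    have mp' := mem_rooted.mp hp'
    have mq := mem_rooted.mp hq
    have mq' := mem_rooted.mp hq'
    obtain rfl : p = p' := subdivide_injective mp.2.2.2 mp'.2.2.2
      (by rw [mp.2.1]; exact Finset.notMem_erase _ _) (mp.2.1.trans mp'.2.1.symm) hl'
    obtain rfl : q = q' := subdivide_injective mq.2.2.2 mq'.2.2.2
      (by rw [mq.2.1]; exact Finset.notMem_erase _ _) (mq.2.1.trans mq'.2.1.symm) hr'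
    rfl
  -- Surjectivity: cut at the bridge and suppress its ends on both sides.
  · intro G hG
    rw [Finset.mem_coe, Finset.mem_filter] at hG
    obtain ⟨hGm, hpend⟩ := hG
    have hVcard : V.card = 2 * (k + l + 1) := by
      have := Finset.card_sdiff_add_card_eq_card hSV
      rw [← hTdef] at this
      omega
    have hcub := hB.isCubic_of_mem_members hcubic hVcard hGm
    obtain ⟨hG𝓑, hGV, -⟩ := mem_members.mp hGm
    have hconn := hB.connected _ hG𝓑
    obtain ⟨w, hw, x, hx, hwx⟩ := hpend.exists_bridge
    obtain ⟨H₁, e₁, he₁, hc₁, hv₁, hE₁⟩ := exists_subdivide hconn hcub hpend (by omega) hw hx hwx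
    have hcomp := hpend.compl
    have hT' : G.verts \ S = T := by rw [hGV]
    have hS' : G.verts \ (G.verts \ S) = S := Finset.sdiff_sdiff_eq_self hpend.1
    obtain ⟨H₂, e₂, he₂, hc₂, hv₂, hE₂⟩ := exists_subdivide hconn hcub hcomp
      (by rw [hT']; omega) hx (hS'.symm ▸ hw) (Sym2.eq_swap ▸ hwx)
    have hedges := hpend.edges_eq hw hx hwx
    rw [← hE₁, ← hE₂] at hedges
    -- The handshake lemma reads `3 (2k + 1) = 2 (|E(H₁)| + 1) + 1`, so `H₁` has `3k` edges;
    -- likewise `H₂` has `3l`.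
    have d₁ := hcub.sum_degree hpend.1
    have d₂ := hcub.sum_degree hcomp.1
    rw [hpend.2, inner, Multiset.countP_eq_card_filter, ← hE₁, card_edges_subdivide he₁] at d₁
    rw [hcomp.2, inner, Multiset.countP_eq_card_filter, ← hE₂, card_edges_subdivide he₂, hT'] at d₂
    rw [hT'] at hv₂ hx
    have hGeq : insertBridge ⟨H₁, e₁⟩ w ⟨H₂, e₂⟩ x = G := by
      refine Multigraph.ext ?_ hedges.symm
      have s₁ : (H₁.subdivide e₁ w).verts = S := by
        rw [subdivide_verts he₁, hv₁, Finset.insert_erase hw]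
      have s₂ : (H₂.subdivide e₂ x).verts = T := by
        rw [subdivide_verts he₂, hv₂, Finset.insert_erase hx]
      rw [insertBridge, bridgeJoin_verts (by rwa [s₁]) (by rwa [s₂]), s₁, s₂, hGV, hTdef,
        Finset.union_sdiff_of_subset hSV]
    -- The reverse direction of (B1): both parts belong to the class because `G` does.
    have hmem := (hB.stability H₁ H₂ G (hGeq ▸ isBridgeInsertion_insertBridge
      (p := ⟨H₁, e₁⟩) (q := ⟨H₂, e₂⟩) he₁ he₂ hc₁ hc₂
      (by simp [hv₁]) (by simp [hv₂])
      (by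
        simp only [hv₁, hv₂]
        rwa [Finset.insert_erase hw, Finset.insert_erase hx]))).mpr hG𝓑
    refine ⟨⟨(w, x), ⟨H₁, e₁⟩, ⟨H₂, e₂⟩⟩, ?_, hGeq⟩
    simp only [Finset.coe_sigma, Set.mem_sigma_iff, Finset.mem_coe, Finset.mem_product, mem_rooted]
    exact ⟨⟨hw, hx⟩, ⟨hmem.1, hv₁, by omega, he₁⟩, hmem.2, hv₂, by omega, he₂⟩

end bijection

end Multigraph

/-! ### First and second moments of the number of good sides. -/

namespace Multigraph
variable {𝓑 : Set Multigraph} {α : ℝ}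

/-- The setting of a bridge insertion with sides `S` and `T`. -/
structure InsertData (S T : Finset ℕ) (w x : ℕ) (p q : Σ _ : Multigraph, Sym2 ℕ) : Prop where
  disj : Disjoint S T
  hw : w ∈ S
  hx : x ∈ T
  hp : p.2 ∈ p.1.edges
  hq : q.2 ∈ q.1.edges
  pverts : p.1.verts = S.erase w
  qverts : q.1.verts = T.erase x

namespace InsertData
variable {S T : Finset ℕ} {w x : ℕ} {p q : Σ _ : Multigraph, Sym2 ℕ}

theorem left_verts (h : InsertData S T w x p q) : (p.1.subdivide p.2 w).verts = S := by
  rw [subdivide_verts h.hp, h.pverts, Finset.insert_erase h.hw]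

theorem right_verts (h : InsertData S T w x p q) : (q.1.subdivide q.2 x).verts = T := by
  rw [subdivide_verts h.hq, h.qverts, Finset.insert_erase h.hx]

theorem verts (h : InsertData S T w x p q) : (insertBridge p w q x).verts = S ∪ T := by
  rw [insertBridge, bridgeJoin_verts (by rw [h.left_verts]; exact h.hw)
    (by rw [h.right_verts]; exact h.hx), h.left_verts, h.right_verts]

theorem isPendant (h : InsertData S T w x p q) : (insertBridge p w q x).IsPendant S := by
  have := isPendant_bridgeJoin (P := p.1.subdivide p.2 w) (Q := q.1.subdivide q.2 x)
    (w := w) (x := x) (by rw [h.left_verts, h.right_verts]; exact h.disj)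
    (by rw [h.left_verts]; exact h.hw) (by rw [h.right_verts]; exact h.hx)
  rwa [h.left_verts] at this

theorem bridge_mem (_ : InsertData S T w x p q) : s(w, x) ∈ (insertBridge p w q x).edges :=
  Multiset.mem_add.mpr (Or.inr (Multiset.mem_singleton_self _))

theorem filter_left (h : InsertData S T w x p q) :
    (insertBridge p w q x).edges.filter (fun e => e ∈ S.sym2) = (p.1.subdivide p.2 w).edges := by
  have := filter_bridgeJoin_left (P := p.1.subdivide p.2 w) (Q := q.1.subdivide q.2 x)
    (w := w) (x := x) (by rw [h.left_verts, h.right_verts]; exact h.disj)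
    (by rw [h.right_verts]; exact h.hx)
  rwa [h.left_verts] at this

theorem sdiff (h : InsertData S T w x p q) : (insertBridge p w q x).verts \ S = T := by
  rw [h.verts, Finset.union_sdiff_cancel_left h.disj]

/-- The bridge at `S` is `wx`, so the end required by goodness is `w`, and 2-edge-connectivity of a
subset of `S` sees only edges inside `S`. Goodness of `S` is thus a condition on the rooted member
`p` alone. -/
theorem isGood_iff (h : InsertData S T w x p q) {I : Finset ℕ} {t k : ℕ} (hk : k ∈ I)
    (hS : S.card = 2 * k + 1) :
    (insertBridge p w q x).IsGood I t S ↔ GoodRoot t w p.1 p.2 := by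
  constructor
  · rintro ⟨-, -, D, hDS, ht, hD, w', hw', x', hx', hwx'⟩
    rw [← twoEdgeConn_filter_iff hDS, h.filter_left] at hD
    obtain ⟨rfl, -⟩ := h.isPendant.eq_of_crossing h.hw (Finset.disjoint_right.mp h.disj h.hx)
      h.bridge_mem (hDS hw') (Finset.mem_sdiff.mp hx').2 hwx'
    exact ⟨D, by rwa [h.left_verts], ht, hw', hD⟩
  · rintro ⟨D, hDS, ht, hw, hD⟩
    rw [h.left_verts] at hDS
    rw [← h.filter_left, twoEdgeConn_filter_iff hDS] at hD
    exact ⟨h.isPendant, ⟨k, hk, hS⟩, D, hDS, ht, hD, w, hw, x, by rw [h.sdiff]; exact h.hx,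
      h.bridge_mem⟩

theorem weight (h : InsertData S T w x p q) : (insertBridge p w q x).weight =
    (p.1.edges.count p.2 * p.1.weight) * (q.1.edges.count q.2 * q.1.weight) := by
  rw [insertBridge, weight_bridgeJoin (by rw [h.left_verts, h.right_verts]; exact h.disj)
    (by rw [h.left_verts]; exact h.hw) (by rw [h.right_verts]; exact h.hx),
    weight_subdivide h.hp (by rw [h.pverts]; exact Finset.notMem_erase _ _),
    weight_subdivide h.hq (by rw [h.qverts]; exact Finset.notMem_erase _ _)]

theorem mem_edges_iff {e : Sym2 ℕ} : e ∈ (insertBridge p w q x).edges ↔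
    e ∈ (p.1.subdivide p.2 w).edges ∨ e ∈ q.1.edges.erase q.2 ∨ e ∈ spokes x q.2 ∨ e = s(w, x) := by
  change e ∈ (p.1.subdivide p.2 w).edges + (q.1.edges.erase q.2 + spokes x q.2) + {s(w, x)} ↔ _
  simp only [Multiset.mem_add, Multiset.mem_singleton, or_assoc]

/-- A good set that avoids `S` remains good when `S` is removed. -/
theorem isGood_right (h : InsertData S T w x p q) {I : Finset ℕ} {t : ℕ} {R : Finset ℕ}
    (hR : (insertBridge p w q x).IsGood I t R) (hRT : R ⊆ T) (hxR : x ∉ R) :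
    q.1.IsGood I t R := by
  set G := insertBridge p w q x with hG
  obtain ⟨hpend, hk, D, hDR, ht, hD, w', hw', x', hx', hwx'⟩ := hR
  have hE : G.edges = (p.1.subdivide p.2 w).edges + (q.1.edges.erase q.2 + spokes x q.2) +
    {s(w, x)} := rfl
  have hdSR : ∀ a ∈ R, a ∉ S := fun a ha => Finset.disjoint_right.mp h.disj (hRT ha)
  have hRq : R ⊆ q.1.verts := by
    rw [h.qverts]
    exact fun a ha => Finset.mem_erase.mpr ⟨fun h => hxR (h ▸ ha), hRT ha⟩
  have hxG : x ∈ G.verts \ R := by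
    rw [Finset.mem_sdiff, h.verts]
    exact ⟨Finset.mem_union_right _ h.hx, hxR⟩
  have hqG : q.1.verts ⊆ G.verts := by
    rw [h.verts, h.qverts]
    exact (Finset.erase_subset _ _).trans Finset.subset_union_right
  have hPedge : ∀ e ∈ (p.1.subdivide p.2 w).edges, ∀ a ∈ e, a ∉ R := by
    intro e he a ha haR
    have := (p.1.subdivide p.2 w).incidence e he a ha
    rw [h.left_verts] at this
    exact hdSR a haR this
  have hspokes : (spokes x q.2).countP (Joins R (G.verts \ R)) ≤ 1 := by
    have h₁ : spokes x q.2 ≤ G.edges := by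
      rw [hE, ← add_assoc]
      exact (Multiset.le_add_left _ _).trans (Multiset.le_add_right _ _)
    exact (Multiset.countP_le_of_le _ h₁).trans hpend.2.le
  obtain ⟨H, e⟩ := q
  induction e with | _ y z =>
  have hyz := h.hq
  simp only at *
  have hJx : ∀ {a : ℕ}, Joins R (G.verts \ R) s(x, a) ↔ a ∈ R := by
    intro a
    rw [joins_mk]
    simp [hxR, Finset.mem_sdiff.mp hxG]
  have hyV := H.incidence _ hyz y (Sym2.mem_mk_left _ _)
  have hzV := H.incidence _ hyz z (Sym2.mem_mk_right _ _)
  -- Otherwise both spokes at `x` would cross `R`, which only one edge crosses.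
  have hnot : ¬ (y ∈ R ∧ z ∈ R) := by
    rintro ⟨hy, hz⟩
    rw [spokes_mk, Multiset.insert_eq_cons, Multiset.countP_cons_of_pos _ (hJx.mpr hy),
      ← Multiset.cons_zero, Multiset.countP_cons_of_pos _ (hJx.mpr hz)] at hspokes
    simp at hspokes
  have hHedge : ∀ e ∈ H.edges, (Joins R (G.verts \ R) e ↔ Joins R (H.verts \ R) e) := by
    intro e he
    induction e with | _ a b =>
    have ha := H.incidence _ he a (Sym2.mem_mk_left _ _)
    have hb := H.incidence _ he b (Sym2.mem_mk_right _ _)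
    simp only [joins_mk, Finset.mem_sdiff, ha, hb, hqG ha, hqG hb, true_and]
  -- As `x ∉ R` and `y`, `z` are not both in `R`, the path `y x z` crosses `R` as often as the edge
  -- `yz`. The bridge and all edges on the side of `p` avoid `R`.
  have hcut : cut G.edges R (G.verts \ R) = cut H.edges R (H.verts \ R) := by
    rw [cut, cut, hE, Multiset.countP_add, Multiset.countP_add, Multiset.countP_add]
    have c₁ : (p.1.subdivide p.2 w).edges.countP (Joins R (G.verts \ R)) = 0 := by
      rw [Multiset.countP_eq_zero]
      rintro _ he ⟨a, ha, b, -, rfl⟩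
      exact hPedge _ he a (Sym2.mem_mk_left _ _) ha
    have c₂ : ({s(w, x)} : Multiset (Sym2 ℕ)).countP (Joins R (G.verts \ R)) = 0 := by
      rw [Multiset.countP_eq_zero]
      intro e he
      rw [Multiset.mem_singleton] at he
      rw [he, Sym2.eq_swap, hJx]
      exact fun hw => hdSR w hw h.hw
    have c₃ : (H.edges.erase s(y, z)).countP (Joins R (G.verts \ R)) =
        (H.edges.erase s(y, z)).countP (Joins R (H.verts \ R)) :=
      Multiset.countP_congr rfl fun e he => propext (hHedge e (Multiset.mem_of_mem_erase he))
    have c₄ : (spokes x s(y, z)).countP (Joins R (G.verts \ R)) =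
        if Joins R (H.verts \ R) s(y, z) then 1 else 0 := by
      rw [spokes_mk, Multiset.insert_eq_cons, Multiset.countP_cons, ← Multiset.cons_zero,
        Multiset.countP_cons, Multiset.countP_zero]
      simp only [hJx, joins_mk, Finset.mem_sdiff, hyV, hzV, true_and]
      by_cases h₁ : y ∈ R <;> by_cases h₂ : z ∈ R <;> simp [h₁, h₂]
      exact hnot ⟨h₁, h₂⟩
    rw [c₁, c₂, c₃, c₄]
    conv_rhs => rw [← Multiset.cons_erase hyz, Multiset.countP_cons]
    omega
  have hfilter : G.edges.filter (fun e => e ∈ R.sym2) = H.edges.filter (fun e => e ∈ R.sym2) := by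
    have c₁ : (p.1.subdivide p.2 w).edges.filter (fun e => e ∈ R.sym2) = 0 := by
      rw [Multiset.filter_eq_nil]
      intro e he heR
      induction e with | _ a b =>
      exact hPedge _ he a (Sym2.mem_mk_left _ _) (Finset.mk_mem_sym2_iff.mp heR).1
    have c₂ : ({s(w, x)} : Multiset (Sym2 ℕ)).filter (fun e => e ∈ R.sym2) = 0 := by
      simp [Multiset.filter_singleton, hxR]
    have c₃ : (spokes x s(y, z)).filter (fun e => e ∈ R.sym2) = 0 := by
      rw [Multiset.filter_eq_nil]
      intro e he heR
      obtain ⟨a, -, rfl⟩ := mem_spokes.mp he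
      exact hxR (Finset.mk_mem_sym2_iff.mp heR).1
    rw [hE, Multiset.filter_add, Multiset.filter_add, Multiset.filter_add, c₁, c₂, c₃]
    conv_rhs => rw [← Multiset.cons_erase hyz, Multiset.filter_cons_of_neg _ (by
      rwa [Finset.mk_mem_sym2_iff])]
    simp
  rw [← twoEdgeConn_filter_iff hDR, hfilter, twoEdgeConn_filter_iff hDR] at hD
  refine ⟨⟨hRq, hcut.symm.trans hpend.2⟩, hk, D, hDR, ht, hD, w', hw', ?_⟩
  have hw'R := hDR hw'
  rw [Finset.mem_sdiff] at hx'
  -- If the bridge at `R` is a spoke at `x`, then after the removal of `S` its role is taken by the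
  -- root edge `yz`.
  rcases mem_edges_iff.mp hwx' with h₁ | h₁ | h₁ | h₁
  · exact absurd hw'R (hPedge _ h₁ w' (Sym2.mem_mk_left _ _))
  · have h₂ := Multiset.mem_of_mem_erase h₁
    exact ⟨x', Finset.mem_sdiff.mpr ⟨H.incidence _ h₂ _ (Sym2.mem_mk_right _ _), hx'.2⟩, h₂⟩
  · obtain ⟨a, ha, hea⟩ := mem_spokes.mp h₁
    have haw : a = w' := by
      rcases Sym2.eq_iff.mp hea with ⟨rfl, -⟩ | ⟨-, h₂⟩
      · exact absurd hw'R hxR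
      · exact h₂
    subst haw
    rcases Sym2.mem_iff.mp ha with rfl | rfl
    · exact ⟨z, Finset.mem_sdiff.mpr ⟨hzV, fun h => hnot ⟨hw'R, h⟩⟩, hyz⟩
    · exact ⟨y, Finset.mem_sdiff.mpr ⟨hyV, fun h => hnot ⟨h, hw'R⟩⟩, Sym2.eq_swap ▸ hyz⟩
  · rcases Sym2.eq_iff.mp h₁ with ⟨rfl, -⟩ | ⟨rfl, -⟩
    · exact absurd h.hw (hdSR _ hw'R)
    · exact absurd hw'R hxR

/-- Every other good set `R` is disjoint from `S`. It also avoids `x`: otherwise the bridge `wx`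
would run between `S` and `R`, so they would cover all vertices, and `hV` forbids that. Hence `R`
survives as a good set of `q.1`, and only `S` is lost. -/
theorem card_goodSets_le (h : InsertData S T w x p q) (hconn : (insertBridge p w q x).Connected)
    {m m' t : ℕ} (ht : 2 * m' < 2 * m + t) (hV : 4 * m' + 2 < (S ∪ T).card)
    (hS : (insertBridge p w q x).IsGood (Finset.Icc m m') t S) :
    ((insertBridge p w q x).goodSets (Finset.Icc m m') t).card ≤
      (q.1.goodSets (Finset.Icc m m') t).card + 1 := by
  have hsub : ((insertBridge p w q x).goodSets (Finset.Icc m m') t).erase S ⊆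
      q.1.goodSets (Finset.Icc m m') t := by
    intro R hR
    rw [Finset.mem_erase, mem_goodSets] at hR
    have hV' := h.verts
    have hdisj := hS.disjoint hconn ht (by rwa [h.verts]) hR.2 hR.1.symm
    rw [mem_goodSets]
    refine h.isGood_right hR.2 (fun a ha => ?_) fun hxR => ?_
    · have := hR.2.1.1 ha
      rw [h.verts, Finset.mem_union] at this
      exact this.resolve_left (Finset.disjoint_right.mp hdisj ha)
    · have h₁ := hS.1.union_eq_verts hconn hR.2.1 h.bridge_mem h.hw
        (Finset.disjoint_right.mp h.disj h.hx) hxR (Finset.disjoint_left.mp hdisj h.hw)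
      have h₂ := Finset.card_union_le S R
      obtain ⟨-, ⟨k, hk, hSk⟩, -⟩ := hS
      obtain ⟨-, ⟨l, hl, hTl⟩, -⟩ := hR.2
      rw [Finset.mem_Icc] at hk hl
      rw [h₁, h.verts] at h₂
      omega
  rw [← Finset.card_erase_add_one (mem_goodSets.mpr hS)]
  exact Nat.add_le_add_right (Finset.card_le_card hsub) 1

end InsertData

theorem sum_rooted (U : Finset ℕ) (m : ℕ) (Φ : Multigraph → ℝ) :
    ∑ q ∈ rooted 𝓑 U m, (q.1.edges.count q.2 * q.1.weight) * Φ q.1 =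
      m * ∑ H ∈ members 𝓑 U m, H.weight * Φ H := by
  rw [rooted, Finset.sum_sigma, Finset.mul_sum]
  refine Finset.sum_congr rfl fun H hH => ?_
  obtain ⟨-, -, rfl⟩ := mem_members.mp hH
  simp only
  rw [← Finset.sum_mul, sum_count_mul_weight]
  ring

open Classical in
theorem goodMass_eq_sum_rooted (U : Finset ℕ) (m t w : ℕ) : goodMass 𝓑 U m t w =
    ∑ p ∈ rooted 𝓑 U m, if GoodRoot t w p.1 p.2 then p.1.edges.count p.2 * p.1.weight else 0 := by
  rw [rooted, Finset.sum_sigma]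
  rfl

open Classical in
-- The weight factorizes and goodness depends on `p` only, so the condition separates from the sum
-- over `q`. The factor `F` is kept general: `1` serves the first moment, the number of good sets
-- minus one the second factorial moment.
theorem sum_isGood_eq (hB : IsBridgeStable 𝓑 α)
    (hcubic : ∀ n : ℕ, ∀ H ∈ ofSize 𝓑 (2 * n) (3 * n), H.IsCubic) {V S : Finset ℕ} (hSV : S ⊆ V)
    {k l : ℕ} (hk : 1 ≤ k) (hl : 1 ≤ l) (hS : S.card = 2 * k + 1)
    (hT : (V \ S).card = 2 * l + 1) {I : Finset ℕ} (hkI : k ∈ I) (t : ℕ) (F : Multigraph → ℝ) :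
    ∑ G ∈ (members 𝓑 V (3 * (k + l + 1))).filter (fun G => G.IsGood I t S), G.weight * F G =
      ∑ wx ∈ S ×ˢ (V \ S), ∑ p ∈ rooted 𝓑 (S.erase wx.1) (3 * k),
        (if GoodRoot t wx.1 p.1 p.2 then p.1.edges.count p.2 * p.1.weight else 0) *
        ∑ q ∈ rooted 𝓑 ((V \ S).erase wx.2) (3 * l),
          (q.1.edges.count q.2 * q.1.weight) * F (insertBridge p wx.1 q wx.2) := by
  have h₁ : (members 𝓑 V (3 * (k + l + 1))).filter (fun G => G.IsGood I t S) =
      ((members 𝓑 V (3 * (k + l + 1))).filter (fun G => G.IsPendant S)).filter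
        (fun G => G.IsGood I t S) := by
    rw [Finset.filter_filter]
    exact Finset.filter_congr fun G _ => ⟨fun h => ⟨h.1, h⟩, fun h => h.2⟩
  rw [h₁, Finset.sum_filter, sum_pendant_eq hB hcubic hSV hk hl hS hT]
  refine Finset.sum_congr rfl fun wx hwx => Finset.sum_congr rfl fun p hp => ?_
  rw [Finset.mul_sum]
  refine Finset.sum_congr rfl fun q hq => ?_
  rw [Finset.mem_product] at hwx
  rw [mem_rooted] at hp hq
  have hd : InsertData S (V \ S) wx.1 wx.2 p q :=
    ⟨Finset.disjoint_sdiff, hwx.1, hwx.2, hp.2.2.2, hq.2.2.2, hp.2.1, hq.2.1⟩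
  rw [hd.weight, if_congr (hd.isGood_iff hkI hS) rfl rfl]
  split_ifs <;> ring

/-- The total weight of the members with `2n` vertices, divided by `(2n)!`. -/
noncomputable def coeff (𝓑 : Set Multigraph) (n : ℕ) : ℝ :=
  mass 𝓑 (Finset.Icc 1 (2 * n)) (3 * n) / (2 * n).factorial

/-- The total weight of the rooted members with `2k` vertices and a good root, divided by `(2k)!`. -/
noncomputable def goodCoeff (𝓑 : Set Multigraph) (t k : ℕ) : ℝ :=
  -- The label `0` is free for the subdividing vertex.
  goodMass 𝓑 (Finset.Icc 1 (2 * k)) (3 * k) t 0 / (2 * k).factorial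

theorem mass_eq_coeff (hB : IsBridgeStable 𝓑 α) {U : Finset ℕ} {n : ℕ} (hU : U.card = 2 * n) :
    mass 𝓑 U (3 * n) = coeff 𝓑 n * (2 * n).factorial := by
  rw [coeff, div_mul_cancel₀ _ (by positivity), hB.mass_eq (U' := Finset.Icc 1 (2 * n)) (by simpa using hU)]

theorem goodMass_eq_goodCoeff (hB : IsBridgeStable 𝓑 α) {U : Finset ℕ} {k t w : ℕ}
    (hU : U.card = 2 * k) (hw : w ∉ U) :
    goodMass 𝓑 U (3 * k) t w = goodCoeff 𝓑 t k * (2 * k).factorial := by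
  rw [goodCoeff, div_mul_cancel₀ _ (by positivity), 
    hB.goodMass_eq (U' := Finset.Icc 1 (2 * k)) (w' := 0) (by simpa using hU) t hw (by simp)]

/-- Accounts for the choices of `S` and of the two ends of the bridge. With the factorials of both
parts they make up the factorial of the whole, so the normalized coefficients satisfy a plain
convolution formula. -/
theorem choose_mul_eq (k l : ℕ) : ((2 * (k + l + 1)).choose (2 * k + 1) : ℝ) *
    ((2 * k + 1) * (2 * l + 1)) * ((2 * k).factorial * (2 * l).factorial) =
      (2 * (k + l + 1)).factorial := by
  have h := Nat.choose_mul_factorial_mul_factorial (n := 2 * (k + l + 1)) (k := 2 * k + 1) (by omega)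
  rw [show 2 * (k + l + 1) - (2 * k + 1) = 2 * l + 1 by omega, Nat.factorial_succ,
    Nat.factorial_succ] at h
  have h' : (((2 * (k + l + 1)).choose (2 * k + 1) * ((2 * k + 1) * (2 * k).factorial) *
    ((2 * l + 1) * (2 * l).factorial) : ℕ) : ℝ) = ((2 * (k + l + 1)).factorial : ℕ) := by
    exact_mod_cast h
  push_cast at h'
  linarith

open Classical in
theorem sum_mul_card_goodSets {V : Finset ℕ} {m : ℕ} (I : Finset ℕ) (t : ℕ) (F : Multigraph → ℝ) :
    ∑ G ∈ members 𝓑 V m, G.weight * F G * (G.goodSets I t).card =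
      ∑ k ∈ I, ∑ S ∈ V.powersetCard (2 * k + 1),
        ∑ G ∈ (members 𝓑 V m).filter (fun G => G.IsGood I t S), G.weight * F G := by
  have hd : (I : Set ℕ).PairwiseDisjoint fun k => V.powersetCard (2 * k + 1) := by
    intro k _ l _ hkl
    rw [Function.onFun, Finset.disjoint_left]
    intro S hS hS'
    rw [Finset.mem_powersetCard] at hS hS'
    omega
  rw [← Finset.sum_biUnion hd]
  simp_rw [Finset.sum_filter]
  rw [Finset.sum_comm]
  refine Finset.sum_congr rfl fun G hG => ?_
  rw [← Finset.sum_filter, Finset.sum_const, nsmul_eq_mul, mul_comm]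
  congr 3
  ext S
  simp only [mem_goodSets, Finset.mem_filter, Finset.mem_biUnion, Finset.mem_powersetCard]
  refine ⟨fun h => ⟨?_, h⟩, fun h => h.2⟩
  obtain ⟨hp, ⟨k, hk, hS⟩, -⟩ := h
  exact ⟨k, hk, (mem_members.mp hG).2.1 ▸ hp.1, hS⟩

/-- The expected number of good sets, up to normalization. -/
theorem goodSum_eq_sum (hB : IsBridgeStable 𝓑 α)
    (hcubic : ∀ n : ℕ, ∀ H ∈ ofSize 𝓑 (2 * n) (3 * n), H.IsCubic) {V : Finset ℕ} {n : ℕ}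
    (hV : V.card = 2 * n) {I : Finset ℕ} (hI : ∀ k ∈ I, 1 ≤ k ∧ k + 2 ≤ n) (t : ℕ) :
    goodSum 𝓑 V (3 * n) I t = (2 * n).factorial *
      ∑ k ∈ I, goodCoeff 𝓑 t k * (3 * (n - 1 - k : ℕ) * coeff 𝓑 (n - 1 - k)) := by
  classical
  have h₁ := sum_mul_card_goodSets (𝓑 := 𝓑) (V := V) (m := 3 * n) I t (fun _ => 1)
  simp only [mul_one] at h₁
  rw [goodSum, h₁, Finset.mul_sum]
  refine Finset.sum_congr rfl fun k hk => ?_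
  obtain ⟨hk1, hkn⟩ := hI k hk
  obtain ⟨l, rfl⟩ : ∃ l, n = k + l + 1 := ⟨n - 1 - k, by omega⟩
  rw [show k + l + 1 - 1 - k = l by omega, ← choose_mul_eq k l, ← hV, ← Finset.card_powersetCard,
    Finset.sum_congr rfl (g := fun _ => ((2 * k + 1) * (2 * l + 1) : ℝ) *
      ((goodCoeff 𝓑 t k * (2 * k).factorial) * (3 * l * (coeff 𝓑 l * (2 * l).factorial)))),
    Finset.sum_const, nsmul_eq_mul]
  · ring
  · intro S hS
    rw [Finset.mem_powersetCard] at hS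
    have hT : (V \ S).card = 2 * l + 1 := by
      have := Finset.card_sdiff_add_card_eq_card hS.1
      omega
    have h₂ := sum_isGood_eq hB hcubic hS.1 hk1 (by omega) hS.2 hT hk t (fun _ => 1)
    simp only [mul_one] at h₂
    rw [h₂, Finset.sum_congr rfl (g := fun _ => (goodCoeff 𝓑 t k * (2 * k).factorial) *
      (3 * l * (coeff 𝓑 l * (2 * l).factorial))), Finset.sum_const, Finset.card_product, hS.2, hT,
      nsmul_eq_mul]
    · push_cast
      ring
    · intro wx hwx
      rw [Finset.mem_product] at hwx
      have h₃ := sum_rooted (𝓑 := 𝓑) ((V \ S).erase wx.2) (3 * l) (fun _ => 1)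
      simp only [mul_one] at h₃
      have hc : (S.erase wx.1).card = 2 * k := by rw [Finset.card_erase_of_mem hwx.1]; omega
      have hc' : ((V \ S).erase wx.2).card = 2 * l := by rw [Finset.card_erase_of_mem hwx.2]; omega
      rw [h₃, ← Finset.sum_mul, ← goodMass_eq_sum_rooted,
        goodMass_eq_goodCoeff hB hc (Finset.notMem_erase _ _)]
      change _ * (_ * mass 𝓑 _ _) = _
      rw [mass_eq_coeff hB hc']
      push_cast
      ring

/-- The second factorial moment of the number of good sets. -/
theorem sum_card_mul_pred_le (hB : IsBridgeStable 𝓑 α)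
    (hcubic : ∀ n : ℕ, ∀ H ∈ ofSize 𝓑 (2 * n) (3 * n), H.IsCubic) {V : Finset ℕ} {n : ℕ}
    (hV : V.card = 2 * n) {m m' t : ℕ} (hm : 1 ≤ m) (ht : 2 * m' < 2 * m + t)
    (hn : 3 * m' + 4 ≤ n) :
    ∑ G ∈ members 𝓑 V (3 * n), G.weight * (((G.goodSets (Finset.Icc m m') t).card : ℝ) - 1) *
        (G.goodSets (Finset.Icc m m') t).card ≤
      (2 * n).factorial * ∑ k ∈ Finset.Icc m m', goodCoeff 𝓑 t k * (3 * (n - 1 - k : ℕ) *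
        ∑ k' ∈ Finset.Icc m m', goodCoeff 𝓑 t k' *
          (3 * (n - 1 - k - 1 - k' : ℕ) * coeff 𝓑 (n - 1 - k - 1 - k'))) := by
  classical
  have h₁ := sum_mul_card_goodSets (𝓑 := 𝓑) (V := V) (m := 3 * n) (Finset.Icc m m') t
    (fun G => ((G.goodSets (Finset.Icc m m') t).card : ℝ) - 1)
  rw [h₁, Finset.mul_sum]
  refine Finset.sum_le_sum fun k hk => ?_
  have hk' := Finset.mem_Icc.mp hk
  obtain ⟨l, rfl⟩ : ∃ l, n = k + l + 1 := ⟨n - 1 - k, by omega⟩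
  rw [show k + l + 1 - 1 - k = l by omega]
  set Q := ∑ k' ∈ Finset.Icc m m', goodCoeff 𝓑 t k' *
    (3 * (l - 1 - k' : ℕ) * coeff 𝓑 (l - 1 - k')) with hQ
  -- After one good side is cut off, the first moment formula applies to what remains.
  have hgs : ∀ U : Finset ℕ, U.card = 2 * l →
      goodSum 𝓑 U (3 * l) (Finset.Icc m m') t = (2 * l).factorial * Q := fun U hU =>
    goodSum_eq_sum hB hcubic hU (fun k' hk' => by rw [Finset.mem_Icc] at hk'; omega) t
  have hbound : ∀ S ∈ V.powersetCard (2 * k + 1),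
      ∑ G ∈ (members 𝓑 V (3 * (k + l + 1))).filter (fun G => G.IsGood (Finset.Icc m m') t S),
        G.weight * (((G.goodSets (Finset.Icc m m') t).card : ℝ) - 1) ≤
      ((2 * k + 1) * (2 * l + 1) : ℝ) *
        ((goodCoeff 𝓑 t k * (2 * k).factorial) * (3 * l * ((2 * l).factorial * Q))) := by
    intro S hS
    rw [Finset.mem_powersetCard] at hS
    have hT : (V \ S).card = 2 * l + 1 := by
      have := Finset.card_sdiff_add_card_eq_card hS.1
      omega
    rw [sum_isGood_eq hB hcubic hS.1 (by omega) (by omega) hS.2 hT hk t]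
    have hwx : ∀ wx ∈ S ×ˢ (V \ S), ∑ p ∈ rooted 𝓑 (S.erase wx.1) (3 * k),
        (if GoodRoot t wx.1 p.1 p.2 then p.1.edges.count p.2 * p.1.weight else 0) *
        ∑ q ∈ rooted 𝓑 ((V \ S).erase wx.2) (3 * l), (q.1.edges.count q.2 * q.1.weight) *
          ((((insertBridge p wx.1 q wx.2).goodSets (Finset.Icc m m') t).card : ℝ) - 1) ≤
        (goodCoeff 𝓑 t k * (2 * k).factorial) * (3 * l * ((2 * l).factorial * Q)) := by
      intro wx hwx
      rw [Finset.mem_product] at hwx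
      have hc : (S.erase wx.1).card = 2 * k := by rw [Finset.card_erase_of_mem hwx.1]; omega
      have hc' : ((V \ S).erase wx.2).card = 2 * l := by rw [Finset.card_erase_of_mem hwx.2]; omega
      have h₃ := sum_rooted (𝓑 := 𝓑) ((V \ S).erase wx.2) (3 * l)
        (fun H => ((H.goodSets (Finset.Icc m m') t).card : ℝ))
      have h₄ : (3 * l : ℝ) * ((2 * l).factorial * Q) =
          ((3 * l : ℕ) : ℝ) * goodSum 𝓑 ((V \ S).erase wx.2) (3 * l) (Finset.Icc m m') t := by
        rw [hgs _ hc']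
        push_cast
        ring
      rw [← goodMass_eq_goodCoeff hB hc (Finset.notMem_erase _ _), h₄, goodSum, ← h₃,
        goodMass_eq_sum_rooted, Finset.sum_mul]
      refine Finset.sum_le_sum fun p hp => ?_
      split_ifs with hgood
      · have hwp := (weight_pos p.1).le
        refine mul_le_mul_of_nonneg_left (Finset.sum_le_sum fun q hq => ?_) (by positivity)
        have hwq := (weight_pos q.1).le
        refine mul_le_mul_of_nonneg_left ?_ (by positivity)
        rw [mem_rooted] at hp hq
        have hd : InsertData S (V \ S) wx.1 wx.2 p q :=
          ⟨Finset.disjoint_sdiff, hwx.1, hwx.2, hp.2.2.2, hq.2.2.2, hp.2.1, hq.2.1⟩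
        have hconn : (insertBridge p wx.1 q wx.2).Connected := by
          refine ((hB.connected _ hp.1).subdivide hp.2.2.2 wx.1).bridgeJoin
            ((hB.connected _ hq.1).subdivide hq.2.2.2 wx.2) ?_ ?_
          · rw [hd.left_verts]; exact hwx.1
          · rw [hd.right_verts]; exact hwx.2
        -- The subtracted `1` accounts for `S` itself.
        have := hd.card_goodSets_le hconn ht
          (by rw [Finset.union_sdiff_of_subset hS.1]; omega) ((hd.isGood_iff hk hS.2).mpr hgood)
        rw [sub_le_iff_le_add]
        exact_mod_cast this
      · simp
    refine (Finset.sum_le_card_nsmul _ _ _ hwx).trans (le_of_eq ?_)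
    rw [Finset.card_product, hS.2, hT, nsmul_eq_mul]
    push_cast
    ring
  refine (Finset.sum_le_card_nsmul _ _ _ hbound).trans (le_of_eq ?_)
  rw [← choose_mul_eq k l, Finset.card_powersetCard, hV, nsmul_eq_mul]
  ring

end Multigraph

/-! ### Sequences of power type and tails of power sums. -/

/-- `g n` is asymptotically equal to `n ^ (-α)`. -/
def PowerLike (g : ℕ → ℝ) (α : ℝ) : Prop :=
  ∀ ε > 0, ∃ N : ℕ, ∀ n ≥ N, (1 - ε) * (n : ℝ) ^ (-α) ≤ g n ∧ g n ≤ (1 + ε) * (n : ℝ) ^ (-α)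

namespace PowerLike
variable {g : ℕ → ℝ} {α : ℝ}

/-- The finitely many indices before the asymptotics take hold are absorbed into the constant. -/
theorem exists_upper (h : PowerLike g α) (hg : ∀ n, 0 ≤ g n) :
    ∃ C > 0, ∀ k : ℕ, 1 ≤ k → g k ≤ C * (k : ℝ) ^ (-α) := by
  obtain ⟨N, hN⟩ := h 1 one_pos
  have hs : ∀ k, 0 ≤ g k * (k : ℝ) ^ α := fun k => mul_nonneg (hg k) (by positivity)
  refine ⟨2 + ∑ k ∈ Finset.range N, g k * (k : ℝ) ^ α,
    add_pos_of_pos_of_nonneg two_pos (Finset.sum_nonneg fun k _ => hs k), fun k hk => ?_⟩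
  have hk' : (0 : ℝ) < k := by exact_mod_cast hk
  have hsum : 0 ≤ ∑ k ∈ Finset.range N, g k * (k : ℝ) ^ α := Finset.sum_nonneg fun k _ => hs k
  by_cases hkN : N ≤ k
  · refine (hN k hkN).2.trans (mul_le_mul_of_nonneg_right (by linarith) (by positivity))
  · have h₁ := Finset.single_le_sum (fun k _ => hs k) (Finset.mem_range.mpr (not_le.mp hkN))
    calc g k = g k * (k : ℝ) ^ α * (k : ℝ) ^ (-α) := by
          rw [mul_assoc, ← Real.rpow_add hk', add_neg_cancel, Real.rpow_zero, mul_one]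
      _ ≤ _ := mul_le_mul_of_nonneg_right (by linarith) (by positivity)

theorem exists_lower (h : PowerLike g α) :
    ∃ N : ℕ, ∀ n ≥ N, 1 / 2 * (n : ℝ) ^ (-α) ≤ g n := by
  obtain ⟨N, hN⟩ := h (1 / 2) (by norm_num)
  exact ⟨N, fun n hn => by have := (hN n hn).1; norm_num at this ⊢; exact this⟩

/-- Needed when sides of order at most a small multiple of `n` are cut off: the coefficient of the
remainder is still close to that of `n`. A single `ε` serves as relative error and as `θ`; by
continuity at `0` it can be taken small enough for `η`. -/
theorem exists_ratio (h : PowerLike g α) (hα : 0 < α) {η : ℝ} (hη : 0 < η) :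
    ∃ θ > 0, θ < 1 ∧ ∃ N : ℕ, ∀ n ≥ N, ∀ l ≤ n, (1 - θ) * (n : ℝ) ≤ l →
      0 < g n ∧ g l ≤ (1 + η) * g n ∧ (1 - η) * (n * g n) ≤ l * g l := by
  have c₁ : ∀ᶠ ε : ℝ in nhdsWithin 0 (Set.Ioi 0),
      (1 + ε) / (1 - ε) * (1 - ε) ^ (-α) < 1 + η := by
    have : Tendsto (fun ε : ℝ => (1 + ε) / (1 - ε) * (1 - ε) ^ (-α)) (nhds 0)
        (nhds ((1 + 0) / (1 - 0) * (1 - 0) ^ (-α))) := by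
      refine ContinuousAt.tendsto (x := (0 : ℝ)) (f := fun ε : ℝ =>
        (1 + ε) / (1 - ε) * (1 - ε) ^ (-α)) ?_
      refine ContinuousAt.mul (ContinuousAt.div (by fun_prop) (by fun_prop) (by norm_num)) ?_
      exact ContinuousAt.rpow_const (by fun_prop) (Or.inl (by norm_num))
    exact (this.mono_left nhdsWithin_le_nhds).eventually_lt_const (by norm_num; exact hη)
  have c₂ : ∀ᶠ ε : ℝ in nhdsWithin 0 (Set.Ioi 0), 1 - η < (1 - ε) * ((1 - ε) / (1 + ε)) := by
    have : Tendsto (fun ε : ℝ => (1 - ε) * ((1 - ε) / (1 + ε))) (nhds 0)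
        (nhds ((1 - 0) * ((1 - 0) / (1 + 0)))) := by
      refine ContinuousAt.tendsto (x := (0 : ℝ)) (f := fun ε : ℝ =>
        (1 - ε) * ((1 - ε) / (1 + ε))) ?_
      exact ContinuousAt.mul (by fun_prop)
        (ContinuousAt.div (by fun_prop) (by fun_prop) (by norm_num))
    exact (this.mono_left nhdsWithin_le_nhds).eventually_const_lt (by norm_num; exact hη)
  have c₃ : ∀ᶠ ε : ℝ in nhdsWithin 0 (Set.Ioi 0), ε < 1 / 2 :=
    (tendsto_id.mono_left nhdsWithin_le_nhds).eventually_lt_const (by norm_num)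
  obtain ⟨ε, ⟨⟨h₁, h₂⟩, h₃⟩, hε⟩ :=
    (((c₁.and c₂).and c₃).and self_mem_nhdsWithin).exists
  have hε1 : 0 < 1 - ε := by linarith
  obtain ⟨N, hN⟩ := h ε hε
  refine ⟨ε, hε, by linarith, 2 * N + 1, fun n hn l hln hl => ?_⟩
  have hn0 : (0 : ℝ) < n := by exact_mod_cast (by omega : 0 < n)
  have hl0 : (0 : ℝ) < l := lt_of_lt_of_le (by positivity) hl
  have hlN : N ≤ l := by
    have h₄ : (n : ℝ) ≤ 2 * l := by nlinarith
    have h₅ : n ≤ 2 * l := by exact_mod_cast h₄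
    omega
  obtain ⟨a₁, a₂⟩ := hN n (by omega)
  obtain ⟨b₁, b₂⟩ := hN l hlN
  have hln' : (l : ℝ) ≤ n := by exact_mod_cast hln
  have hnp : (0 : ℝ) < (n : ℝ) ^ (-α) := by positivity
  have hlp : (l : ℝ) ^ (-α) ≤ (1 - ε) ^ (-α) * (n : ℝ) ^ (-α) := by
    rw [← Real.mul_rpow hε1.le hn0.le]
    exact Real.rpow_le_rpow_of_nonpos (by positivity) hl (by linarith)
  have hlp' : (n : ℝ) ^ (-α) ≤ (l : ℝ) ^ (-α) :=
    Real.rpow_le_rpow_of_nonpos hl0 hln' (by linarith)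
  have hgn : 0 < g n := lt_of_lt_of_le (by positivity) a₁
  refine ⟨hgn, ?_, ?_⟩
  · calc g l ≤ (1 + ε) * ((1 - ε) ^ (-α) * (n : ℝ) ^ (-α)) :=
          b₂.trans (mul_le_mul_of_nonneg_left hlp (by linarith))
      _ = ((1 + ε) / (1 - ε) * (1 - ε) ^ (-α)) * ((1 - ε) * (n : ℝ) ^ (-α)) := by
          field_simp
      _ ≤ (1 + η) * g n :=
          mul_le_mul h₁.le a₁ (by positivity) (by linarith)
  · have h₆ : (1 - ε) / (1 + ε) * g n ≤ g l := by
      calc (1 - ε) / (1 + ε) * g n ≤ (1 - ε) / (1 + ε) * ((1 + ε) * (n : ℝ) ^ (-α)) :=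
            mul_le_mul_of_nonneg_left a₂ (by positivity)
        _ = (1 - ε) * (n : ℝ) ^ (-α) := by field_simp
        _ ≤ (1 - ε) * (l : ℝ) ^ (-α) := mul_le_mul_of_nonneg_left hlp' hε1.le
        _ ≤ g l := b₁
    calc (1 - η) * (n * g n) ≤ (1 - ε) * ((1 - ε) / (1 + ε)) * (n * g n) :=
          mul_le_mul_of_nonneg_right h₂.le (by positivity)
      _ = ((1 - ε) * n) * ((1 - ε) / (1 + ε) * g n) := by ring
      _ ≤ l * g l := mul_le_mul hl h₆ (by positivity) hl0.le

end PowerLike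

/-- The tail of `∑ k ^ (1 - α)`. -/
theorem sum_rpow_tail_le {α : ℝ} (hα : 2 < α) {M : ℕ} (hM : 1 ≤ M) {I : Finset ℕ}
    (hI : ∀ k ∈ I, M < k) :
    ∑ k ∈ I, (k : ℝ) ^ (1 - α) ≤ (M : ℝ) ^ (2 - α) / (α - 2) := by
  have hM0 : (0 : ℝ) < M := by exact_mod_cast hM
  obtain ⟨a, ha⟩ : ∃ a, I ⊆ (Finset.range a).image (fun i => M + (i + 1)) := by
    refine ⟨I.sup id, fun k hk => ?_⟩
    rw [Finset.mem_image]
    have h₁ : k ≤ I.sup id := Finset.le_sup (f := id) hk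
    have h₂ := hI k hk
    exact ⟨k - M - 1, Finset.mem_range.mpr (by omega), by omega⟩
  have hanti : AntitoneOn (fun x : ℝ => x ^ (1 - α)) (Set.Icc (M : ℝ) (M + a)) := by
    intro x hx y hy hxy
    exact Real.rpow_le_rpow_of_nonpos (lt_of_lt_of_le hM0 hx.1) hxy (by linarith)
  have hint : ∫ x in (M : ℝ)..(M + a), x ^ (1 - α) =
      ((M + a : ℝ) ^ (1 - α + 1) - (M : ℝ) ^ (1 - α + 1)) / (1 - α + 1) := by
    refine integral_rpow (Or.inr ⟨by linarith, ?_⟩)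
    rw [Set.uIcc_of_le (by linarith [Nat.cast_nonneg (α := ℝ) a])]
    exact fun h => absurd h.1 (by linarith)
  calc ∑ k ∈ I, (k : ℝ) ^ (1 - α)
      ≤ ∑ k ∈ (Finset.range a).image (fun i => M + (i + 1)), (k : ℝ) ^ (1 - α) :=
        Finset.sum_le_sum_of_subset_of_nonneg ha fun _ _ _ => by positivity
    _ = ∑ i ∈ Finset.range a, (fun x : ℝ => x ^ (1 - α)) ((M : ℝ) + ((i + 1 : ℕ) : ℝ)) := by
        rw [Finset.sum_image (fun i _ j _ h => by simpa using h)]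
        exact Finset.sum_congr rfl fun i _ => by push_cast; rfl
    _ ≤ ∫ x in (M : ℝ)..(M + a), x ^ (1 - α) := hanti.sum_le_integral
    _ = ((M : ℝ) ^ (2 - α) - (M + a : ℝ) ^ (2 - α)) / (α - 2) := by
        rw [hint, show 1 - α + 1 = -(α - 2) by ring, show 2 - α = -(α - 2) by ring, div_neg,
          ← neg_div, neg_sub]
    _ ≤ (M : ℝ) ^ (2 - α) / (α - 2) := by
        refine div_le_div_of_nonneg_right ?_ (by linarith)
        have : (0 : ℝ) ≤ (M + a : ℝ) ^ (2 - α) := by positivity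
        linarith

/-- The terms are at most `3 * k ^ (2 - α)`, which is summable because `α > 3`. This makes the
number of vertices on long small sides negligible. -/
theorem exists_sum_rpow_tail_le {α : ℝ} (hα : 3 < α) {ε : ℝ} (hε : 0 < ε) :
    ∃ K : ℕ, ∀ I : Finset ℕ, (∀ k ∈ I, K < k) →
      ∑ k ∈ I, (2 * k + 1 : ℝ) * (k : ℝ) ^ (1 - α) ≤ ε := by
  have hs : Summable fun k : ℕ => (k : ℝ) ^ (2 - α) :=
    Real.summable_nat_rpow.mpr (by linarith)
  obtain ⟨s, hs⟩ := summable_iff_vanishing_norm.mp hs (ε / 3) (by linarith)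
  refine ⟨s.sup id, fun I hI => ?_⟩
  have h₁ := hs I (Finset.disjoint_left.mpr fun k hk hks =>
    absurd (hI k hk) (not_lt.mpr (Finset.le_sup (f := id) hks)))
  have h₂ : ∑ k ∈ I, (2 * k + 1 : ℝ) * (k : ℝ) ^ (1 - α) ≤ ∑ k ∈ I, 3 * (k : ℝ) ^ (2 - α) := by
    refine Finset.sum_le_sum fun k hk => ?_
    have hk1 : (1 : ℝ) ≤ k := by exact_mod_cast (by have := hI k hk; omega : 1 ≤ k)
    rw [show (2 : ℝ) - α = 1 + (1 - α) by ring, Real.rpow_add (by linarith), Real.rpow_one,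
      ← mul_assoc]
    exact mul_le_mul_of_nonneg_right (by linarith) (by positivity)
  rw [← Finset.mul_sum] at h₂
  have h₃ := (Real.le_norm_self _).trans h₁.le
  linarith

/-! ### Normalized asymptotics and the expected number of small sides. -/

namespace Multigraph
variable {𝓑 : Set Multigraph} {α : ℝ}

/-- The coefficients after removal of the exponential factor. -/
noncomputable def normCoeff (𝓑 : Set Multigraph) (γ c : ℝ) (n : ℕ) : ℝ := coeff 𝓑 n / (c * γ ^ n)

theorem totalWeight_ofSize_inter (n m : ℕ) (E : Set Multigraph) [DecidablePred (· ∈ E)] :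
    totalWeight (ofSize 𝓑 n m ∩ E) =
      ∑ H ∈ (members 𝓑 (Finset.Icc 1 n) m).filter (· ∈ E), H.weight := by
  have hfin : (ofSize 𝓑 n m ∩ E).Finite := (finite_ofSize 𝓑 n m).subset Set.inter_subset_left
  rw [totalWeight, finsum_mem_eq_finite_toFinset_sum _ hfin]
  refine Finset.sum_congr ?_ fun _ _ => rfl
  ext H
  rw [Set.Finite.mem_toFinset, Finset.mem_filter, mem_members]
  rfl

theorem totalWeight_ofSize (n m : ℕ) :
    totalWeight (ofSize 𝓑 n m) = mass 𝓑 (Finset.Icc 1 n) m := by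
  classical
  have := totalWeight_ofSize_inter (𝓑 := 𝓑) n m Set.univ
  simpa [mass] using this

/-- The expectation method: `f ≥ 1` outside `E`. -/
theorem one_sub_le_prob {n : ℕ} (hpos : 0 < mass 𝓑 (Finset.Icc 1 (2 * n)) (3 * n))
    {E : Set Multigraph} {δ : ℝ} (f : Multigraph → ℝ)
    (hf0 : ∀ H ∈ members 𝓑 (Finset.Icc 1 (2 * n)) (3 * n), 0 ≤ f H)
    (hf : ∀ H ∈ members 𝓑 (Finset.Icc 1 (2 * n)) (3 * n), H ∉ E → 1 ≤ f H)
    (hsum : ∑ H ∈ members 𝓑 (Finset.Icc 1 (2 * n)) (3 * n), H.weight * f H ≤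
      δ * mass 𝓑 (Finset.Icc 1 (2 * n)) (3 * n)) : 1 - δ ≤ prob 𝓑 n E := by
  classical
  rw [prob, totalWeight_ofSize_inter, totalWeight_ofSize, le_div_iff₀ hpos]
  have h₁ : mass 𝓑 (Finset.Icc 1 (2 * n)) (3 * n) ≤
      ∑ H ∈ (members 𝓑 (Finset.Icc 1 (2 * n)) (3 * n)).filter (· ∈ E), H.weight +
      ∑ H ∈ members 𝓑 (Finset.Icc 1 (2 * n)) (3 * n), H.weight * f H := by
    rw [mass, Finset.sum_filter, ← Finset.sum_add_distrib]
    refine Finset.sum_le_sum fun H hH => ?_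
    have hw := (weight_pos H).le
    have h₀ := hf0 H hH
    split_ifs with hE
    · nlinarith
    · nlinarith [hf H hH hE]
  linarith

theorem exists_powerLike (hB : IsBridgeStable 𝓑 α) :
    ∃ γ c : ℝ, 0 < γ ∧ 0 < c ∧ PowerLike (normCoeff 𝓑 γ c) α := by
  obtain ⟨γ, c, hγ, hc, h⟩ := hB.asymptotics
  refine ⟨γ, c, hγ, hc, fun ε hε => ?_⟩
  have h₁ := h.isLittleO.def hε
  obtain ⟨N, hN⟩ := eventually_atTop.mp h₁
  refine ⟨N, fun n hn => ?_⟩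
  have h₂ := hN n hn
  have hf : (0 : ℝ) < ((2 * n).factorial : ℝ) := by positivity
  have hcg : 0 < c * γ ^ n := by positivity
  have hp : 0 ≤ (n : ℝ) ^ (-α) := by positivity
  have h₃ : totalWeight (ofSize 𝓑 (2 * n) (3 * n)) =
      normCoeff 𝓑 γ c n * (c * γ ^ n * (2 * n).factorial) := by
    rw [totalWeight_ofSize, normCoeff, coeff]
    field_simp
  have h₄ : c * (n : ℝ) ^ (-α) * γ ^ n * ((2 * n).factorial : ℝ) =
      (n : ℝ) ^ (-α) * (c * γ ^ n * (2 * n).factorial) := by ring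
  simp only [Pi.sub_apply] at h₂
  have hD : 0 < c * γ ^ n * ((2 * n).factorial : ℝ) := by positivity
  rw [h₃, h₄, ← sub_mul, norm_mul _ (c * γ ^ n * ((2 * n).factorial : ℝ)),
    norm_mul _ (c * γ ^ n * ((2 * n).factorial : ℝ)), ← mul_assoc, Real.norm_eq_abs (_ - _),
    Real.norm_of_nonneg hp] at h₂
  have h₅ := le_of_mul_le_mul_right h₂ (norm_pos_iff.mpr hD.ne')
  rw [abs_le] at h₅
  constructor <;> linarith

/-- The normalized asymptotics of a bridge-stable class. -/
structure Asymp (𝓑 : Set Multigraph) (α γ c : ℝ) : Prop where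
  stable : IsBridgeStable 𝓑 α
  cubic : ∀ n : ℕ, ∀ H ∈ ofSize 𝓑 (2 * n) (3 * n), H.IsCubic
  hα : 3 < α
  hγ : 0 < γ
  hc : 0 < c
  powerLike : PowerLike (normCoeff 𝓑 γ c) α

theorem coeff_nonneg (n : ℕ) : 0 ≤ coeff 𝓑 n := div_nonneg mass_nonneg (by positivity)

theorem goodCoeff_nonneg (t n : ℕ) : 0 ≤ goodCoeff 𝓑 t n := div_nonneg goodMass_nonneg (by positivity)

/-- The weighted rate at which sides with `2k+1` vertices appear. -/
noncomputable def rate (𝓑 : Set Multigraph) (γ : ℝ) (t k : ℕ) : ℝ :=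
  3 * goodCoeff 𝓑 t k / γ ^ (k + 1)

namespace Asymp
variable {γ c : ℝ}

theorem normCoeff_nonneg (h : Asymp 𝓑 α γ c) (n : ℕ) : 0 ≤ normCoeff 𝓑 γ c n :=
  div_nonneg (coeff_nonneg n) (mul_nonneg h.hc.le (pow_nonneg h.hγ.le n))

theorem rate_nonneg (h : Asymp 𝓑 α γ c) (t k : ℕ) : 0 ≤ rate 𝓑 γ t k :=
  div_nonneg (mul_nonneg (by norm_num) (goodCoeff_nonneg t k)) (pow_nonneg h.hγ.le _)

theorem coeff_eq (h : Asymp 𝓑 α γ c) (n : ℕ) : coeff 𝓑 n = c * γ ^ n * normCoeff 𝓑 γ c n := by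
  have := h.hc
  have := h.hγ
  rw [normCoeff]
  field_simp

theorem mass_eq (h : Asymp 𝓑 α γ c) (n : ℕ) : mass 𝓑 (Finset.Icc 1 (2 * n)) (3 * n) =
    (2 * n).factorial * (c * γ ^ n * normCoeff 𝓑 γ c n) := by
  rw [mass_eq_coeff h.stable (by simp), h.coeff_eq, mul_comm]

theorem rate_zero (h : Asymp 𝓑 α γ c) (k : ℕ) :
    rate 𝓑 γ 0 k = 9 * c / γ * (k * normCoeff 𝓑 γ c k) := by
  have := h.hc
  have := h.hγ
  have h₁ : goodCoeff 𝓑 0 k = 3 * k * coeff 𝓑 k := by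
    rw [goodCoeff, goodMass_zero, coeff]
    push_cast
    ring
  rw [rate, h₁, h.coeff_eq, pow_succ]
  field_simp
  ring

theorem isCubic (h : Asymp 𝓑 α γ c) {n : ℕ} {H : Multigraph}
    (hH : H ∈ members 𝓑 (Finset.Icc 1 (2 * n)) (3 * n)) : H.IsCubic :=
  h.stable.isCubic_of_mem_members h.cubic (by simp) hH

theorem connected (h : Asymp 𝓑 α γ c) {U : Finset ℕ} {m : ℕ} {H : Multigraph}
    (hH : H ∈ members 𝓑 U m) : H.Connected := h.stable.connected _ (mem_members.mp hH).1

theorem goodSum_eq (h : Asymp 𝓑 α γ c) {n : ℕ} {I : Finset ℕ}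
    (hI : ∀ k ∈ I, 1 ≤ k ∧ k + 2 ≤ n) (t : ℕ) :
    goodSum 𝓑 (Finset.Icc 1 (2 * n)) (3 * n) I t = (2 * n).factorial * (c * γ ^ n) *
      ∑ k ∈ I, rate 𝓑 γ t k * ((n - 1 - k : ℕ) * normCoeff 𝓑 γ c (n - 1 - k)) := by
  have := h.hγ
  rw [goodSum_eq_sum h.stable h.cubic (by simp) hI, mul_assoc, Finset.mul_sum (a := c * γ ^ n)]
  congr 1
  refine Finset.sum_congr rfl fun k hk => ?_
  -- A side with `2k + 1` vertices and the far end of its bridge together take `2 (k + 1)` vertices,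
  -- whence the exponent `k + 1` in `rate`.
  obtain ⟨l, rfl⟩ : ∃ l, n = l + (k + 1) := ⟨n - 1 - k, by have := hI k hk; omega⟩
  rw [show l + (k + 1) - 1 - k = l by omega, h.coeff_eq, rate, pow_add]
  field_simp

theorem sum_card_mul_pred_le (h : Asymp 𝓑 α γ c) {n m m' t : ℕ} (hm : 1 ≤ m)
    (ht : 2 * m' < 2 * m + t) (hn : 3 * m' + 4 ≤ n) :
    ∑ G ∈ members 𝓑 (Finset.Icc 1 (2 * n)) (3 * n),
      G.weight * (((G.goodSets (Finset.Icc m m') t).card : ℝ) - 1) *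
        (G.goodSets (Finset.Icc m m') t).card ≤
      (2 * n).factorial * (c * γ ^ n) * ∑ k ∈ Finset.Icc m m', rate 𝓑 γ t k * ((n - 1 - k : ℕ) *
        ∑ k' ∈ Finset.Icc m m', rate 𝓑 γ t k' *
          ((n - 1 - k - 1 - k' : ℕ) * normCoeff 𝓑 γ c (n - 1 - k - 1 - k'))) := by
  have := h.hγ
  refine (Multigraph.sum_card_mul_pred_le h.stable h.cubic (by simp) hm ht hn).trans (le_of_eq ?_)
  rw [mul_assoc, Finset.mul_sum (a := c * γ ^ n)]
  congr 1
  refine Finset.sum_congr rfl fun k hk => ?_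
  rw [Finset.mul_sum, Finset.mul_sum, Finset.mul_sum, Finset.mul_sum, Finset.mul_sum]
  refine Finset.sum_congr rfl fun k' hk' => ?_
  rw [Finset.mem_Icc] at hk hk'
  obtain ⟨l, rfl⟩ : ∃ l, n = l + (k' + 1) + (k + 1) := ⟨n - 1 - k - 1 - k', by omega⟩
  rw [show l + (k' + 1) + (k + 1) - 1 - k - 1 - k' = l by omega, h.coeff_eq, rate, rate, pow_add,
    pow_add]
  field_simp

/-- The expected number of short sides of bridges. -/
theorem exists_goodSum_le (h : Asymp 𝓑 α γ c) : ∃ C > 0, ∃ N : ℕ, ∀ n ≥ N,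
    0 < mass 𝓑 (Finset.Icc 1 (2 * n)) (3 * n) ∧ ∀ k : ℕ, 1 ≤ k → 2 * k + 1 ≤ n →
      goodSum 𝓑 (Finset.Icc 1 (2 * n)) (3 * n) {k} 0 ≤
        C * n * (k : ℝ) ^ (1 - α) * mass 𝓑 (Finset.Icc 1 (2 * n)) (3 * n) := by
  have hγ := h.hγ
  have hc := h.hc
  have hα := h.hα
  obtain ⟨C, hC, hup⟩ := h.powerLike.exists_upper h.normCoeff_nonneg
  obtain ⟨N, hlow⟩ := h.powerLike.exists_lower
  refine ⟨9 * c / γ * C * (C * 3 ^ α * 2), by positivity, N + 1, fun n hn => ?_⟩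
  have hn0 : (0 : ℝ) < n := by exact_mod_cast (by omega : 0 < n)
  have hnp : (0 : ℝ) < (n : ℝ) ^ (-α) := by positivity
  have hg := hlow n (by omega)
  have hgpos : 0 < normCoeff 𝓑 γ c n := lt_of_lt_of_le (by positivity) hg
  rw [h.mass_eq]
  refine ⟨by positivity, fun k hk hkn => ?_⟩
  have hk0 : (0 : ℝ) < k := by exact_mod_cast hk
  rw [h.goodSum_eq (by simpa using ⟨hk, by omega⟩), Finset.sum_singleton, h.rate_zero]
  set l := n - 1 - k with hl
  have hln : (l : ℝ) ≤ n := by exact_mod_cast (by omega : l ≤ n)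
  -- The side has at most half of the vertices, so the remainder keeps a third of the size and its
  -- coefficient is at most a constant times that of `n`.
  have hl3 : (n : ℝ) / 3 ≤ l := by
    have : (n : ℝ) ≤ 3 * l := by exact_mod_cast (by omega : n ≤ 3 * l)
    linarith
  have hgl : normCoeff 𝓑 γ c l ≤ C * 3 ^ α * 2 * normCoeff 𝓑 γ c n := by
    calc normCoeff 𝓑 γ c l ≤ C * (l : ℝ) ^ (-α) := hup l (by omega)
      _ ≤ C * ((n : ℝ) / 3) ^ (-α) := mul_le_mul_of_nonneg_left
          (Real.rpow_le_rpow_of_nonpos (by positivity) hl3 (by linarith)) hC.le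
      _ = C * 3 ^ α * 2 * (1 / 2 * (n : ℝ) ^ (-α)) := by
          rw [Real.div_rpow hn0.le (by norm_num), Real.rpow_neg (by norm_num : (0 : ℝ) ≤ 3)]
          field_simp
      _ ≤ _ := mul_le_mul_of_nonneg_left hg (by positivity)
  have hgk : k * normCoeff 𝓑 γ c k ≤ C * (k : ℝ) ^ (1 - α) := by
    calc k * normCoeff 𝓑 γ c k ≤ k * (C * (k : ℝ) ^ (-α)) :=
          mul_le_mul_of_nonneg_left (hup k hk) hk0.le
      _ = C * (k : ℝ) ^ (1 - α) := by
          rw [sub_eq_add_neg, Real.rpow_add hk0, Real.rpow_one]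
          ring
  have hlg : l * normCoeff 𝓑 γ c l ≤ n * (C * 3 ^ α * 2 * normCoeff 𝓑 γ c n) :=
    mul_le_mul hln hgl (h.normCoeff_nonneg l) hn0.le
  have hkg0 : 0 ≤ k * normCoeff 𝓑 γ c k := mul_nonneg hk0.le (h.normCoeff_nonneg k)
  have hlg0 : 0 ≤ l * normCoeff 𝓑 γ c l := mul_nonneg (Nat.cast_nonneg l) (h.normCoeff_nonneg l)
  calc ((2 * n).factorial : ℝ) * (c * γ ^ n) *
        (9 * c / γ * (k * normCoeff 𝓑 γ c k) * (l * normCoeff 𝓑 γ c l))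
      ≤ (2 * n).factorial * (c * γ ^ n) * (9 * c / γ * (C * (k : ℝ) ^ (1 - α)) *
          (n * (C * 3 ^ α * 2 * normCoeff 𝓑 γ c n))) := by
        refine mul_le_mul_of_nonneg_left ?_ (by positivity)
        exact mul_le_mul (mul_le_mul_of_nonneg_left hgk (by positivity)) hlg hlg0 (by positivity)
    _ = _ := by ring

end Asymp

theorem IsPendant.isGood_zero {G : Multigraph} {S I : Finset ℕ} (h : G.IsPendant S) {k : ℕ}
    (hk : k ∈ I) (hS : S.card = 2 * k + 1) : G.IsGood I 0 S := by
  obtain ⟨w, hw, x, hx, hwx⟩ := h.exists_bridge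
  refine ⟨h, ⟨k, hk, hS⟩, {w}, by simpa using hw, Nat.zero_le _, fun A hA hne hn => ?_, w, by simp,
    x, hx, hwx⟩
  rcases Finset.subset_singleton_iff.mp hA with rfl | rfl
  · simp at hne
  · exact absurd rfl hn

/-- The values of `k` such that a small side of a bridge may have `2k+1 > 2K+1` vertices. -/
def smallRange (n K : ℕ) : Finset ℕ := (Finset.range n).filter fun k => K < k ∧ 2 * k + 1 ≤ n

/-- In a cubic multigraph the side of a bridge has odd order by the handshake lemma, so small sides
can be grouped by `k` with `S.card = 2 * k + 1`. -/
theorem sum_smallSets_le {G : Multigraph} (hcub : G.IsCubic) {n K : ℕ}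
    (hV : G.verts.card = 2 * n) (φ : ℕ → ℕ) :
    ∑ S ∈ G.smallSets.filter (fun S => 2 * K + 1 < S.card), φ S.card ≤
      ∑ k ∈ smallRange n K, φ (2 * k + 1) * (G.goodSets {k} 0).card := by
  classical
  have hodd : ∀ S ∈ G.smallSets.filter (fun S => 2 * K + 1 < S.card),
      S.card = 2 * ((S.card - 1) / 2) + 1 ∧ (S.card - 1) / 2 ∈ smallRange n K := by
    intro S hS
    rw [Finset.mem_filter, mem_smallSets] at hS
    have h₁ := hcub.sum_degree hS.1.1.1
    rw [hS.1.1.2] at h₁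
    have h₂ := hS.1.2
    have h₃ : S.card = 2 * ((S.card - 1) / 2) + 1 := by omega
    refine ⟨h₃, ?_⟩
    rw [smallRange, Finset.mem_filter, Finset.mem_range]
    omega
  rw [← Finset.sum_fiberwise_of_maps_to (fun S hS => (hodd S hS).2)]
  refine Finset.sum_le_sum fun k _ => ?_
  have h₁ : ∀ S ∈ (G.smallSets.filter (fun S => 2 * K + 1 < S.card)).filter
      (fun S => (S.card - 1) / 2 = k), S.card = 2 * k + 1 := by
    intro S hS
    rw [Finset.mem_filter] at hS
    have := (hodd S hS.1).1
    rwa [hS.2] at this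
  rw [Finset.sum_congr rfl (fun S hS => by rw [h₁ S hS]), Finset.sum_const, smul_eq_mul, mul_comm]
  refine Nat.mul_le_mul_left _ (Finset.card_le_card fun S hS => ?_)
  have hS' := h₁ S hS
  rw [Finset.mem_filter, Finset.mem_filter, mem_smallSets] at hS
  exact mem_goodSets.mpr (hS.1.1.1.isGood_zero (Finset.mem_singleton_self k) hS')

/-- Used twice: `φ = id` counts the vertices on long small sides, which bounds the core from below,
and `φ = 1` counts the sides themselves, which bounds the further blocks from above. -/
theorem Asymp.exists_sum_smallSets_le {γ c : ℝ} (h : Asymp 𝓑 α γ c) : ∃ C > 0, ∃ N : ℕ, ∀ n ≥ N,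
    0 < mass 𝓑 (Finset.Icc 1 (2 * n)) (3 * n) ∧ ∀ (K : ℕ) (φ : ℕ → ℕ),
      ∑ G ∈ members 𝓑 (Finset.Icc 1 (2 * n)) (3 * n), G.weight *
        ((∑ S ∈ G.smallSets.filter (fun S => 2 * K + 1 < S.card), φ S.card : ℕ) : ℝ) ≤
        C * n * (∑ k ∈ smallRange n K, (φ (2 * k + 1) : ℝ) * (k : ℝ) ^ (1 - α)) *
          mass 𝓑 (Finset.Icc 1 (2 * n)) (3 * n) := by
  obtain ⟨C, hC, N, hN⟩ := h.exists_goodSum_le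
  refine ⟨C, hC, N, fun n hn => ⟨(hN n hn).1, fun K φ => ?_⟩⟩
  set M := members 𝓑 (Finset.Icc 1 (2 * n)) (3 * n) with hM
  calc ∑ G ∈ M, G.weight *
        ((∑ S ∈ G.smallSets.filter (fun S => 2 * K + 1 < S.card), φ S.card : ℕ) : ℝ)
      ≤ ∑ G ∈ M, G.weight *
        ((∑ k ∈ smallRange n K, φ (2 * k + 1) * (G.goodSets {k} 0).card : ℕ) : ℝ) := by
        refine Finset.sum_le_sum fun G hG => mul_le_mul_of_nonneg_left ?_ (weight_pos G).le
        exact_mod_cast sum_smallSets_le (h.isCubic hG)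
          (by rw [(mem_members.mp hG).2.1]; simp) φ
    _ = ∑ k ∈ smallRange n K, (φ (2 * k + 1) : ℝ) *
        goodSum 𝓑 (Finset.Icc 1 (2 * n)) (3 * n) {k} 0 := by
        push_cast
        simp_rw [goodSum, Finset.mul_sum]
        rw [Finset.sum_comm]
        exact Finset.sum_congr rfl fun k _ => Finset.sum_congr rfl fun G _ => by ring
    _ ≤ ∑ k ∈ smallRange n K, (φ (2 * k + 1) : ℝ) *
        (C * n * (k : ℝ) ^ (1 - α) * mass 𝓑 (Finset.Icc 1 (2 * n)) (3 * n)) := by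
        refine Finset.sum_le_sum fun k hk => mul_le_mul_of_nonneg_left ?_ (Nat.cast_nonneg _)
        rw [smallRange, Finset.mem_filter] at hk
        exact (hN n hn).2 k (by omega) hk.2.2
    _ = _ := by
        rw [Finset.mul_sum, Finset.sum_mul]
        exact Finset.sum_congr rfl fun k _ => by ring

end Multigraph

/-! ### Orders of blocks, and good roots in the core. -/

namespace Multigraph

/-- Turns a statement on the `i`-th largest entry into a count of large entries. The condition `1 ≤
t` keeps the default value `0` from qualifying. -/
theorem le_getD_iff {l : List ℕ} (hl : l.Pairwise (· ≥ ·)) {t : ℕ} (ht : 1 ≤ t) (j : ℕ) :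
    t ≤ l.getD j 0 ↔ j < l.countP (fun a => t ≤ a) := by
  induction l generalizing j with
  | nil => simp; omega
  | cons a l ih =>
    rw [List.pairwise_cons] at hl
    have ih := fun j => ih hl.2 j
    by_cases ha : t ≤ a
    · rw [List.countP_cons_of_pos (by simpa using ha)]
      cases j with
      | zero => simp [ha]
      | succ j => simpa using ih j
    · have h0 : l.countP (fun a => t ≤ a) = 0 := by
        rw [List.countP_eq_zero]
        intro b hb
        have := hl.1 b hb
        simp only [decide_eq_true_eq]
        omega
      rw [List.countP_cons_of_neg (by simpa using ha)]
      cases j with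
      | zero => simp [ha, h0]
      | succ j =>
        have := ih j
        rw [h0] at this ⊢
        simpa using this

theorem le_blockOrder_iff (H : Multigraph) {t : ℕ} (ht : 1 ≤ t) (i : ℕ) :
    t ≤ H.blockOrder i ↔ i - 1 < (H.blocks.filter (fun D => t ≤ D.card)).card := by
  rw [blockOrder, le_getD_iff (Multiset.pairwise_sort _ _) ht, ← Multiset.coe_countP,
    Multiset.sort_eq, Multiset.countP_map]
  rfl

theorem mem_blocks {H : Multigraph} {D : Finset ℕ} : D ∈ H.blocks ↔ H.IsBlock D := by
  classical
  unfold blocks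
  rw [Finset.mem_filter, Finset.mem_powerset]
  exact ⟨fun h => h.2, fun h => ⟨h.subset, h⟩⟩

theorem blockOrder_le_card_verts (H : Multigraph) (i : ℕ) : H.blockOrder i ≤ H.verts.card := by
  by_contra! h
  have h₁ := (le_blockOrder_iff H (t := H.verts.card + 1) (by omega) i).mp h
  obtain ⟨D, hD⟩ := Finset.card_pos.mp (lt_of_le_of_lt (Nat.zero_le _) h₁)
  rw [Finset.mem_filter, mem_blocks] at hD
  have := Finset.card_le_card hD.1.subset
  omega

/-- All blocks but one lie on small sides of bridges. -/
theorem blockOrder_le_of_smallSets {G : Multigraph} (hG : G.Connected)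
    (hdeg : ∀ v ∈ G.verts, G.degree v ≤ 3) {L : ℕ} (h : ∀ S, G.IsSmall S → S.card ≤ L) {i : ℕ}
    (hi : 2 ≤ i) : G.blockOrder i ≤ L := by
  by_contra! hlt
  have h₁ := (le_blockOrder_iff G (t := L + 1) (by omega) i).mp hlt
  -- Two distinct blocks have more than `L` vertices; neither fits into a small side, so both would
  -- be the core.
  obtain ⟨D, hD, D', hD', hne⟩ := Finset.one_lt_card.mp (lt_of_le_of_lt (by omega) h₁)
  have main : ∀ D ∈ G.blocks.filter (fun D => L + 1 ≤ D.card), D = G.core := by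
    intro D hD
    rw [Finset.mem_filter, mem_blocks] at hD
    refine (hD.1.eq_core_or hG hdeg).resolve_right ?_
    rintro ⟨S, hS, hDS⟩
    have h₂ := Finset.card_le_card hDS
    have h₃ := h S hS
    omega
  exact hne ((main D hD).trans (main D' hD').symm)

theorem exists_block_superset {G : Multigraph} {D : Finset ℕ} (hD : G.IsTwoConnectedOn D) :
    ∃ B, G.IsBlock B ∧ D ⊆ B := by
  obtain ⟨B, hDB, hB⟩ := Set.Finite.exists_le_maximal
    (s := {B | G.IsTwoConnectedOn B}) (G.verts.powerset.finite_toSet.subset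
      (fun B hB => by simpa using hB.1)) hD
  exact ⟨B, Or.inl hB, hDB⟩

theorem card_core_le_blockOrder {G : Multigraph} (hG : G.Connected)
    (hdeg : ∀ v ∈ G.verts, G.degree v ≤ 3) (h2 : 2 ≤ G.core.card) :
    G.core.card ≤ G.blockOrder 1 := by
  obtain ⟨B, hB, hCB⟩ := exists_block_superset ((twoEdgeConn_core hG).isTwoConnectedOn
    (core_subset G) (fun v hv => hdeg v (core_subset G hv)) h2)
  rw [le_blockOrder_iff G (by omega)]
  exact Finset.card_pos.mpr ⟨B, Finset.mem_filter.mpr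
    ⟨mem_blocks.mpr hB, Finset.card_le_card hCB⟩⟩

/-- Subdividing an edge inside a two-edge-connected set. -/
theorem TwoEdgeConn.subdivide {H : Multigraph} {D : Finset ℕ} (h : TwoEdgeConn H.edges D)
    {e : Sym2 ℕ} (he : e ∈ H.edges) (heD : e ∈ D.sym2) {w : ℕ} (hw : w ∉ D) :
    TwoEdgeConn (H.subdivide e w).edges (insert w D) := by
  -- By symmetry of cuts it suffices to treat the part avoiding `w`. If it is all of `D`, both
  -- spokes cross; otherwise, if `e` crossed, a spoke replaces it.
  have main : ∀ A ⊆ D, A.Nonempty → 2 ≤ cut (H.subdivide e w).edges A (insert w D \ A) := by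
    intro A hA hne
    have hwA : w ∉ A := fun h => hw (hA h)
    have hE : cut (H.subdivide e w).edges A (insert w D \ A) =
        cut (H.edges.erase e) A (insert w D \ A) + cut (spokes w e) A (insert w D \ A) :=
      Multiset.countP_add _ _ _
    induction e with | _ y z =>
    rw [Finset.mk_mem_sym2_iff] at heD
    have hspoke : cut (spokes w s(y, z)) A (insert w D \ A) =
        (if y ∈ A then 1 else 0) + if z ∈ A then 1 else 0 := by
      have hJ : ∀ {a : ℕ}, Joins A (insert w D \ A) s(w, a) ↔ a ∈ A := by
        intro a
        rw [joins_mk]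
        simp [hwA]
      rw [cut, spokes_mk, Multiset.insert_eq_cons, Multiset.countP_cons, ← Multiset.cons_zero,
        Multiset.countP_cons, Multiset.countP_zero]
      simp only [hJ]
      omega
    by_cases hAD : A = D
    · rw [hE, hspoke, hAD, if_pos heD.1, if_pos heD.2]
      omega
    · have h₁ := h A hA hne hAD
      rw [cut, ← Multiset.cons_erase he, Multiset.countP_cons] at h₁
      have h₂ : cut (H.edges.erase s(y, z)) A (D \ A) ≤
          cut (H.edges.erase s(y, z)) A (insert w D \ A) :=
        cut_mono le_rfl (Finset.sdiff_subset_sdiff (Finset.subset_insert _ _) le_rfl)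
      rw [hE, hspoke]
      unfold cut at h₂ ⊢
      simp only [joins_mk, Finset.mem_sdiff, heD.1, heD.2, true_and] at h₁
      by_cases h₃ : y ∈ A <;> by_cases h₄ : z ∈ A <;> simp only [h₃, h₄, not_true_eq_false,
        not_false_eq_true, and_false, and_true, or_self, or_false, or_true, if_true,
        if_false] at h₁ ⊢ <;> omega
  intro A hA hne hneq
  by_cases hwA : w ∈ A
  · have hsub : insert w D \ A ⊆ D := by
      intro v hv
      rw [Finset.mem_sdiff, Finset.mem_insert] at hv
      exact hv.1.resolve_left fun h => hv.2 (h ▸ hwA)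
    have h₁ := main (insert w D \ A) hsub
      (Finset.sdiff_nonempty.mpr fun h => hneq (Finset.Subset.antisymm hA h))
    rwa [Finset.sdiff_sdiff_eq_self hA, cut_comm] at h₁
  · exact main A (fun v hv => (Finset.mem_insert.mp (hA hv)).resolve_left fun h => hwA (h ▸ hv)) hne

theorem sum_count_filter {ι : Type*} [DecidableEq ι] (E : Multiset ι) (p : ι → Prop)
    [DecidablePred p] : ∑ e ∈ E.toFinset.filter p, E.count e = E.countP p := by
  rw [Multiset.countP_eq_card_filter, ← Multiset.toFinset_sum_count_eq, Multiset.toFinset_filter]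
  refine Finset.sum_congr rfl fun e he => ?_
  rw [Multiset.count_filter_of_pos (Finset.mem_filter.mp he).2]

/-- Every edge inside the core is a good root if the core is large. -/
theorem card_core_mul_weight_le {H : Multigraph} (hH : H.Connected) {t w : ℕ} (hw : w ∉ H.verts)
    (ht : t ≤ H.core.card) (h2 : 2 ≤ H.core.card) :
    H.core.card * H.weight ≤ goodRootWeight t w H := by
  classical
  have hwC : w ∉ H.core := fun h => hw (core_subset H h)
  have h₁ : ∑ e ∈ H.edges.toFinset.filter (fun e => e ∈ H.core.sym2),
      (H.edges.count e : ℝ) * H.weight ≤ goodRootWeight t w H := by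
    rw [goodRootWeight, Finset.sum_filter]
    refine Finset.sum_le_sum fun e he => ?_
    have := (weight_pos H).le
    by_cases heC : e ∈ H.core.sym2
    · have heE := Multiset.mem_toFinset.mp he
      rw [if_pos heC, if_pos]
      refine ⟨insert w H.core, ?_, ?_, Finset.mem_insert_self _ _,
        (twoEdgeConn_core hH).subdivide heE heC hwC⟩
      · rw [subdivide_verts heE]
        exact Finset.insert_subset_insert _ (core_subset H)
      · rw [Finset.card_insert_of_notMem hwC]
        omega
    · rw [if_neg heC]
      split_ifs <;> positivity
  -- A 2-edge-connected set spans at least as many edges as it has vertices.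
  refine le_trans ?_ h₁
  rw [← Finset.sum_mul, ← Nat.cast_sum, sum_count_filter]
  refine mul_le_mul_of_nonneg_right ?_ (weight_pos H).le
  exact_mod_cast (twoEdgeConn_core hH).card_le_inner (core_subset H) h2

end Multigraph

/-! ### The linear core, the upper bounds, and the variance. -/

namespace Multigraph
variable {𝓑 : Set Multigraph} {α : ℝ}

theorem IsCubic.degree_le {G : Multigraph} (hG : G.IsCubic) : ∀ v ∈ G.verts, G.degree v ≤ 3 :=
  fun v hv => (hG v hv).le

namespace Asymp
variable {γ c : ℝ}

/-- The core has linear size with high probability. -/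
theorem exists_core_ge (h : Asymp 𝓑 α γ c) {δ : ℝ} (hδ : 0 < δ) :
    ∃ c₀ : ℝ, 0 < c₀ ∧ c₀ ≤ 1 ∧ ∃ N : ℕ, ∀ n ≥ N, 0 < mass 𝓑 (Finset.Icc 1 (2 * n)) (3 * n) ∧
      ∑ G ∈ members 𝓑 (Finset.Icc 1 (2 * n)) (3 * n),
        G.weight * (if c₀ * n ≤ (G.core.card : ℝ) then 0 else 1) ≤
          δ * mass 𝓑 (Finset.Icc 1 (2 * n)) (3 * n) := by
  obtain ⟨C, hC, N, hN⟩ := h.exists_sum_smallSets_le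
  obtain ⟨K, hK⟩ := exists_sum_rpow_tail_le h.hα (ε := δ / (2 * C)) (by positivity)
  set L := 2 * K + 1 with hL
  -- The constant comes from `card_core_ge` with `G.verts.card = 2 * n`.
  refine ⟨6 / (4 * (1 + 3 * L)), by positivity, ?_, N + 2 * K + 2, fun n hn => ?_⟩
  · rw [div_le_one (by positivity)]
    have : (1 : ℝ) ≤ L := by exact_mod_cast (by omega : 1 ≤ L)
    linarith
  obtain ⟨hpos, hsum⟩ := hN n (by omega)
  have hn0 : (0 : ℝ) < n := by exact_mod_cast (by omega : 0 < n)
  refine ⟨hpos, ?_⟩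
  have h₁ := hsum K id
  have h₂ : ∑ k ∈ smallRange n K, ((id (2 * k + 1) : ℕ) : ℝ) * (k : ℝ) ^ (1 - α) ≤
      δ / (2 * C) := by
    refine le_trans (le_of_eq (Finset.sum_congr rfl fun k _ => ?_)) (hK (smallRange n K) ?_)
    · simp
    · intro k hk
      rw [smallRange, Finset.mem_filter] at hk
      exact hk.2.1
  -- Markov's inequality at level `n / 2`, a quarter of the vertices: if the core is small, at least
  -- that many are counted on long small sides.
  calc ∑ G ∈ members 𝓑 (Finset.Icc 1 (2 * n)) (3 * n),
        G.weight * (if 6 / (4 * (1 + 3 * L)) * n ≤ (G.core.card : ℝ) then 0 else 1)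
      ≤ ∑ G ∈ members 𝓑 (Finset.Icc 1 (2 * n)) (3 * n), 2 / n * (G.weight *
        ((∑ S ∈ G.smallSets.filter (fun S => 2 * K + 1 < S.card), id S.card : ℕ) : ℝ)) := by
        refine Finset.sum_le_sum fun G hG => ?_
        have hw := (weight_pos G).le
        rw [mul_left_comm]
        refine mul_le_mul_of_nonneg_left ?_ hw
        split_ifs with hcore
        · positivity
        · have hV : G.verts.card = 2 * n := by rw [(mem_members.mp hG).2.1]; simp
          by_contra! hlt
          refine hcore ?_
          have h₃ : 4 * ∑ S ∈ G.smallSets.filter (fun S => L < S.card), S.card ≤ G.verts.card := by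
            rw [div_mul_eq_mul_div, div_lt_one hn0] at hlt
            have h₄ : 2 * ∑ S ∈ G.smallSets.filter (fun S => 2 * K + 1 < S.card), id S.card < n := by
              exact_mod_cast hlt
            simp only [id] at h₄
            rw [hV, hL]
            omega
          have h₅ := card_core_ge (h.connected hG) (h.isCubic hG).degree_le L (by omega) h₃
          have h₆ : (3 * (2 * n) : ℝ) ≤ 4 * (1 + 3 * L) * G.core.card := by
            rw [hV] at h₅
            exact_mod_cast h₅
          rw [div_mul_eq_mul_div, div_le_iff₀ (by positivity)]
          linarith
    _ ≤ 2 / n * (C * n * (δ / (2 * C)) * mass 𝓑 (Finset.Icc 1 (2 * n)) (3 * n)) := by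
        rw [← Finset.mul_sum]
        refine mul_le_mul_of_nonneg_left (h₁.trans ?_) (by positivity)
        exact mul_le_mul_of_nonneg_right (mul_le_mul_of_nonneg_left h₂ (by positivity)) hpos.le
    _ = δ * mass 𝓑 (Finset.Icc 1 (2 * n)) (3 * n) := by field_simp

theorem isThetaP_largest (h : Asymp 𝓑 α γ c) :
    IsThetaP (prob 𝓑) (fun _ H => (blockOrder 1 H : ℝ)) (fun n => (n : ℝ)) := by
  constructor
  · intro δ hδ
    obtain ⟨c₀, -, -, N, hN⟩ := h.exists_core_ge hδ
    refine ⟨2, two_pos, N, fun n hn => ?_⟩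
    refine one_sub_le_prob (hN n hn).1 (fun _ => 0) (fun _ _ => le_rfl) (fun H hH hE => ?_) (by
      simpa using mul_nonneg hδ.le (hN n hn).1.le)
    refine absurd ?_ hE
    have h₁ := blockOrder_le_card_verts H 1
    rw [(mem_members.mp hH).2.1, Nat.card_Icc] at h₁
    have h₂ : (blockOrder 1 H : ℝ) ≤ 2 * n := by exact_mod_cast h₁
    simpa using h₂
  · intro δ hδ
    obtain ⟨c₀, hc₀, -, N, hN⟩ := h.exists_core_ge hδ
    -- Ensures `c₀ * n ≥ 2`, so that the core is large enough to lie in a block.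
    obtain ⟨N', hN'⟩ := exists_nat_ge (2 / c₀)
    refine ⟨c₀, hc₀, max N N', fun n hn => ?_⟩
    obtain ⟨hpos, hsum⟩ := hN n (le_trans (le_max_left _ _) hn)
    refine one_sub_le_prob hpos (fun G => if c₀ * n ≤ (G.core.card : ℝ) then 0 else 1)
      (fun G _ => by split_ifs <;> norm_num) (fun G hG hE => ?_) hsum
    by_cases hcore : c₀ * n ≤ (G.core.card : ℝ)
    · refine absurd ?_ hE
      have hn' : (N' : ℝ) ≤ n := by exact_mod_cast le_trans (le_max_right _ _) hn
      have h₁ : 2 ≤ c₀ * n := by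
        rw [div_le_iff₀ hc₀] at hN'
        nlinarith
      have h₂ : 2 ≤ G.core.card := by exact_mod_cast h₁.trans hcore
      have h₃ := card_core_le_blockOrder (h.connected hG) (h.isCubic hG).degree_le h₂
      have h₄ : (G.core.card : ℝ) ≤ blockOrder 1 G := by exact_mod_cast h₃
      simpa using hcore.trans h₄
    · simp [hcore]

/-- A threshold beyond which short sides of bridges are unlikely. -/
theorem exists_threshold {C δ : ℝ} (hα : 2 < α) (hC : 0 < C) (hδ : 0 < δ) :
    ∃ A > 0, ∀ n : ℕ, 1 ≤ n → ∃ M : ℕ, 1 ≤ M ∧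
      2 * (M : ℝ) + 1 ≤ A * (n : ℝ) ^ (1 / (α - 2)) ∧
      C * n * ((M : ℝ) ^ (2 - α) / (α - 2)) ≤ δ := by
  have h0 : 0 < α - 2 := by linarith
  have hA0 : 0 < (C / (α - 2) / δ) ^ (1 / (α - 2)) := by positivity
  refine ⟨2 * (C / (α - 2) / δ) ^ (1 / (α - 2)) + 3, by positivity, fun n hn => ?_⟩
  have hn1 : (1 : ℝ) ≤ n := by exact_mod_cast hn
  have hn0 : (0 : ℝ) < n := by linarith
  have hb1 : 1 ≤ (n : ℝ) ^ (1 / (α - 2)) := Real.one_le_rpow hn1 (by positivity)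
  -- The factor is chosen such that `M = A * b` gives exactly `δ`, since `b ^ (2 - α) = 1 / n`;
  -- rounding `M` up only decreases the bound.
  have hAb : ((C / (α - 2) / δ) ^ (1 / (α - 2)) * (n : ℝ) ^ (1 / (α - 2))) ^ (2 - α) =
      δ * (α - 2) / C / n := by
    rw [Real.mul_rpow hA0.le (by positivity), ← Real.rpow_mul (by positivity),
      ← Real.rpow_mul hn0.le, show 1 / (α - 2) * (2 - α) = -1 by field_simp; ring,
      Real.rpow_neg_one, Real.rpow_neg_one]
    field_simp
  generalize (C / (α - 2) / δ) ^ (1 / (α - 2)) = A at *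
  generalize (n : ℝ) ^ (1 / (α - 2)) = b at *
  have hMge : A * b ≤ (⌈A * b⌉₊ : ℝ) := Nat.le_ceil _
  have hMle : (⌈A * b⌉₊ : ℝ) ≤ A * b + 1 := (Nat.ceil_lt_add_one (by positivity)).le
  refine ⟨⌈A * b⌉₊, Nat.one_le_ceil_iff.mpr (by positivity), by nlinarith, ?_⟩
  calc C * n * ((⌈A * b⌉₊ : ℝ) ^ (2 - α) / (α - 2))
      ≤ C * n * ((A * b) ^ (2 - α) / (α - 2)) := by
        refine mul_le_mul_of_nonneg_left (div_le_div_of_nonneg_right ?_ h0.le) (by positivity)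
        exact Real.rpow_le_rpow_of_nonpos (by positivity) hMge (by linarith)
    _ = δ := by
        rw [hAb]
        field_simp

/-- A first moment bound: with high probability there is no small side with more than `2 * M + 1`
vertices, and then all blocks but the core are at most that large. -/
theorem isBigOP_second (h : Asymp 𝓑 α γ c) {i : ℕ} (hi : 2 ≤ i) :
    IsBigOP (prob 𝓑) (fun _ H => (blockOrder i H : ℝ)) (fun n => (n : ℝ) ^ (1 / (α - 2))) := by
  intro δ hδ
  have hα := h.hα
  obtain ⟨C, hC, N, hN⟩ := h.exists_sum_smallSets_le
  obtain ⟨A, hA, hthr⟩ := exists_threshold (α := α) (by linarith) hC hδ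
  refine ⟨A, hA, N + 1, fun n hn => ?_⟩
  obtain ⟨hpos, hsum⟩ := hN n (by omega)
  obtain ⟨M, hM1, hMA, hMδ⟩ := hthr n (by omega)
  have htail := sum_rpow_tail_le (α := α) (by linarith) hM1 (I := smallRange n M) (by
    intro k hk
    rw [smallRange, Finset.mem_filter] at hk
    exact hk.2.1)
  have h₁ := hsum M (fun _ => 1)
  have h₂ : C * n * ∑ k ∈ smallRange n M, ((1 : ℕ) : ℝ) * (k : ℝ) ^ (1 - α) ≤ δ := by
    refine le_trans (mul_le_mul_of_nonneg_left ?_ (by positivity)) hMδ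
    simpa only [Nat.cast_one, one_mul] using htail
  refine one_sub_le_prob hpos (fun G => ((∑ S ∈ G.smallSets.filter
    (fun S => 2 * M + 1 < S.card), 1 : ℕ) : ℝ)) (fun G _ => Nat.cast_nonneg _)
    (fun G hG hE => ?_) (le_trans ?_ (mul_le_mul_of_nonneg_right h₂ hpos.le))
  swap
  · simpa only using h₁
  by_contra! hlt
  refine hE ?_
  have h₂ : ∑ S ∈ G.smallSets.filter (fun S => 2 * M + 1 < S.card), 1 = 0 := by
    have : ∑ S ∈ G.smallSets.filter (fun S => 2 * M + 1 < S.card), 1 < 1 := by exact_mod_cast hlt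
    omega
  rw [← Finset.card_eq_sum_ones, Finset.card_eq_zero, Finset.filter_eq_empty_iff] at h₂
  have h₃ := blockOrder_le_of_smallSets (h.connected hG) (h.isCubic hG).degree_le
    (L := 2 * M + 1) (fun S hS => not_lt.mp (h₂ (mem_smallSets.mpr hS))) hi
  have h₄ : (blockOrder i G : ℝ) ≤ 2 * M + 1 := by exact_mod_cast h₃
  change |(blockOrder i G : ℝ)| ≤ _
  rw [abs_of_nonneg (Nat.cast_nonneg _)]
  exact h₄.trans hMA

/-- The variance of the number of good sets. -/
theorem sum_sq_le (h : Asymp 𝓑 α γ c) {n m m' t : ℕ} (hm : 1 ≤ m) (ht : 2 * m' < 2 * m + t)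
    (hn : 3 * m' + 4 ≤ n) {η θ μ : ℝ} (hη : 0 < η)
    (hwin : 2 * (m' : ℝ) + 2 ≤ θ * n)
    (hratio : ∀ l ≤ n, (1 - θ) * (n : ℝ) ≤ l →
      0 < normCoeff 𝓑 γ c n ∧ normCoeff 𝓑 γ c l ≤ (1 + η) * normCoeff 𝓑 γ c n ∧
        (1 - η) * (n * normCoeff 𝓑 γ c n) ≤ l * normCoeff 𝓑 γ c l)
    (hμ : μ = n * ∑ k ∈ Finset.Icc m m', rate 𝓑 γ t k) :
    ∑ G ∈ members 𝓑 (Finset.Icc 1 (2 * n)) (3 * n),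
      G.weight * (((G.goodSets (Finset.Icc m m') t).card : ℝ) - μ) ^ 2 ≤
      (3 * η * μ ^ 2 + (1 + η) * μ) * mass 𝓑 (Finset.Icc 1 (2 * n)) (3 * n) := by
  have hγ := h.hγ
  have hc := h.hc
  set g := normCoeff 𝓑 γ c with hg
  set I := Finset.Icc m m' with hI
  set A : ℝ := (2 * n).factorial * (c * γ ^ n) with hA
  have hA0 : 0 < A := by positivity
  have hrate := h.rate_nonneg t
  have hgn : 0 < g n := (hratio n le_rfl (by
    have : (0 : ℝ) ≤ m' := Nat.cast_nonneg _
    nlinarith)).1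
  have hn0 : (0 : ℝ) ≤ n := Nat.cast_nonneg _
  have hμ0 : 0 ≤ μ := by
    rw [hμ]
    exact mul_nonneg hn0 (Finset.sum_nonneg fun k _ => hrate k)
  -- Cutting off two sides from the window lowers `n` by at most `2 * m' + 2`, which `hwin` keeps
  -- within the range of `hratio`.
  have hl : ∀ l : ℕ, l ≤ n → (n : ℝ) ≤ l + 2 * m' + 2 →
      g l ≤ (1 + η) * g n ∧ (1 - η) * (n * g n) ≤ l * g l ∧ l * g l ≤ (1 + η) * (n * g n) := by
    intro l hln hl
    obtain ⟨-, h₁, h₂⟩ := hratio l hln (by linarith)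
    refine ⟨h₁, h₂, ?_⟩
    have hln' : (l : ℝ) ≤ n := by exact_mod_cast hln
    calc l * g l ≤ n * ((1 + η) * g n) := mul_le_mul hln' h₁ (h.normCoeff_nonneg l) hn0
      _ = _ := by ring
  have hS1 := h.goodSum_eq (n := n) (I := I)
    (fun k hk => by rw [hI, Finset.mem_Icc] at hk; omega) t
  rw [← hA] at hS1
  have hS2 := h.sum_card_mul_pred_le hm ht hn
  rw [← hA] at hS2
  have hmass : mass 𝓑 (Finset.Icc 1 (2 * n)) (3 * n) = A * g n := by
    rw [h.mass_eq, hA, hg]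
    ring
  have hcast : ∀ k ∈ I, (n : ℝ) ≤ ((n - 1 - k : ℕ) : ℝ) + 2 * m' + 2 := by
    intro k hk
    rw [hI, Finset.mem_Icc] at hk
    exact_mod_cast (by omega : n ≤ (n - 1 - k) + 2 * m' + 2)
  have b₁ : ∑ k ∈ I, rate 𝓑 γ t k * ((n - 1 - k : ℕ) * g (n - 1 - k)) ≤ (1 + η) * g n * μ := by
    rw [hμ, Finset.mul_sum, Finset.mul_sum]
    refine Finset.sum_le_sum fun k hk => ?_
    calc rate 𝓑 γ t k * ((n - 1 - k : ℕ) * g (n - 1 - k))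
        ≤ rate 𝓑 γ t k * ((1 + η) * (n * g n)) :=
          mul_le_mul_of_nonneg_left (hl _ (by omega) (hcast k hk)).2.2 (hrate k)
      _ = _ := by ring
  have b₂ : (1 - η) * g n * μ ≤ ∑ k ∈ I, rate 𝓑 γ t k * ((n - 1 - k : ℕ) * g (n - 1 - k)) := by
    rw [hμ, Finset.mul_sum, Finset.mul_sum]
    refine Finset.sum_le_sum fun k hk => ?_
    calc (1 - η) * g n * (n * rate 𝓑 γ t k) = rate 𝓑 γ t k * ((1 - η) * (n * g n)) := by ring
      _ ≤ _ := mul_le_mul_of_nonneg_left (hl _ (by omega) (hcast k hk)).2.1 (hrate k)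
  have b₃ : ∑ k ∈ I, rate 𝓑 γ t k * ((n - 1 - k : ℕ) * ∑ k' ∈ I, rate 𝓑 γ t k' *
      ((n - 1 - k - 1 - k' : ℕ) * g (n - 1 - k - 1 - k'))) ≤ (1 + η) * g n * μ ^ 2 := by
    have hin : ∀ k ∈ I, ∑ k' ∈ I, rate 𝓑 γ t k' *
        ((n - 1 - k - 1 - k' : ℕ) * g (n - 1 - k - 1 - k')) ≤ (1 + η) * g n * μ := by
      intro k hk
      rw [hμ, Finset.mul_sum, Finset.mul_sum]
      refine Finset.sum_le_sum fun k' hk' => ?_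
      rw [hI, Finset.mem_Icc] at hk hk'
      have hb : (n : ℝ) ≤ ((n - 1 - k - 1 - k' : ℕ) : ℝ) + 2 * m' + 2 := by
        exact_mod_cast (by omega : n ≤ (n - 1 - k - 1 - k') + 2 * m' + 2)
      calc rate 𝓑 γ t k' * ((n - 1 - k - 1 - k' : ℕ) * g (n - 1 - k - 1 - k'))
          ≤ rate 𝓑 γ t k' * ((1 + η) * (n * g n)) :=
            mul_le_mul_of_nonneg_left (hl _ (by omega) hb).2.2 (hrate k')
        _ = _ := by ring
    calc ∑ k ∈ I, rate 𝓑 γ t k * ((n - 1 - k : ℕ) * ∑ k' ∈ I, rate 𝓑 γ t k' *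
          ((n - 1 - k - 1 - k' : ℕ) * g (n - 1 - k - 1 - k')))
        ≤ ∑ k ∈ I, rate 𝓑 γ t k * (n * ((1 + η) * g n * μ)) := by
          refine Finset.sum_le_sum fun k hk => mul_le_mul_of_nonneg_left ?_ (hrate k)
          have hkn : ((n - 1 - k : ℕ) : ℝ) ≤ n := by exact_mod_cast (by omega : n - 1 - k ≤ n)
          calc ((n - 1 - k : ℕ) : ℝ) * ∑ k' ∈ I, rate 𝓑 γ t k' *
                ((n - 1 - k - 1 - k' : ℕ) * g (n - 1 - k - 1 - k'))
              ≤ ((n - 1 - k : ℕ) : ℝ) * ((1 + η) * g n * μ) :=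
                mul_le_mul_of_nonneg_left (hin k hk) (Nat.cast_nonneg _)
            _ ≤ _ := mul_le_mul_of_nonneg_right hkn (by positivity)
      _ = (1 + η) * g n * μ ^ 2 := by
          rw [← Finset.sum_mul, sq, ← mul_assoc ((1 + η) * g n) μ μ]
          nth_rewrite 2 [hμ]
          ring
  -- With `X` the number of good sets, `(X - μ)² = X (X - 1) + (1 - 2μ) X + μ²`.
  have hexp : ∑ G ∈ members 𝓑 (Finset.Icc 1 (2 * n)) (3 * n),
      G.weight * (((G.goodSets I t).card : ℝ) - μ) ^ 2 =
      ∑ G ∈ members 𝓑 (Finset.Icc 1 (2 * n)) (3 * n),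
        G.weight * (((G.goodSets I t).card : ℝ) - 1) * (G.goodSets I t).card +
      (1 - 2 * μ) * goodSum 𝓑 (Finset.Icc 1 (2 * n)) (3 * n) I t +
      μ ^ 2 * mass 𝓑 (Finset.Icc 1 (2 * n)) (3 * n) := by
    rw [goodSum, mass, Finset.mul_sum, Finset.mul_sum, ← Finset.sum_add_distrib,
      ← Finset.sum_add_distrib]
    exact Finset.sum_congr rfl fun G _ => by ring
  rw [hexp, hS1, hmass]
  have e₂ := mul_le_mul_of_nonneg_left b₃ hA0.le
  -- The first moment enters with both signs: `b₁` bounds it from above in the term `X`, `b₂` from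
  -- below in `-2μX`. The terms in `μ ^ 2` then cancel up to `3η`.
  have e₃ : (1 - 2 * μ) * ∑ k ∈ I, rate 𝓑 γ t k * ((n - 1 - k : ℕ) * g (n - 1 - k)) ≤
      (1 + η) * g n * μ - 2 * μ * ((1 - η) * g n * μ) := by
    have := mul_le_mul_of_nonneg_left b₂ (by positivity : 0 ≤ 2 * μ)
    linarith
  have e₄ := mul_le_mul_of_nonneg_left e₃ hA0.le
  calc _ ≤ A * ((1 + η) * g n * μ ^ 2) + A * ((1 + η) * g n * μ - 2 * μ * ((1 - η) * g n * μ)) +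
        μ ^ 2 * (A * g n) := by
        refine add_le_add (add_le_add (hS2.trans e₂) ?_) le_rfl
        rw [mul_left_comm]
        exact e₄
    _ = _ := by ring

end Asymp
end Multigraph

/-! ### The lower bound for the further blocks. -/

namespace Multigraph
variable {𝓑 : Set Multigraph} {α : ℝ}

namespace Asymp
variable {γ c : ℝ}

/-- A positive proportion of the rooted members has a good root. -/
theorem exists_rate_ge (h : Asymp 𝓑 α γ c) : ∃ c₀ : ℝ, 0 < c₀ ∧ c₀ ≤ 1 ∧ ∃ C > 0, ∃ N : ℕ,
    ∀ k ≥ N, ∀ t : ℕ, (t : ℝ) ≤ c₀ * k → C * (k : ℝ) ^ (1 - α) ≤ rate 𝓑 γ t k := by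
  have hγ := h.hγ
  have hc := h.hc
  obtain ⟨c₀, hc₀, hc₁, N₁, hN₁⟩ := h.exists_core_ge (δ := 1 / 2) (by norm_num)
  obtain ⟨N₂, hN₂⟩ := h.powerLike.exists_lower
  obtain ⟨N₃, hN₃⟩ := exists_nat_ge (2 / c₀)
  refine ⟨c₀, hc₀, hc₁, 3 * c₀ * c / (4 * γ), by positivity, max (max N₁ N₂) (max N₃ 1),
    fun k hk t ht => ?_⟩
  simp only [ge_iff_le, max_le_iff] at hk
  obtain ⟨⟨hk₁, hk₂⟩, hk₃, hk1⟩ := hk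
  have hk0 : (0 : ℝ) < k := by exact_mod_cast hk1
  obtain ⟨-, hsum⟩ := hN₁ k hk₁
  set M := members 𝓑 (Finset.Icc 1 (2 * k)) (3 * k) with hM
  have h2 : 2 ≤ c₀ * k := by
    have : (N₃ : ℝ) ≤ k := by exact_mod_cast hk₃
    rw [div_le_iff₀ hc₀] at hN₃
    nlinarith
  -- At least half of the mass has a core of at least `c₀ * k ≥ t` vertices, and each such member
  -- has at least that many good roots.
  have hgood : c₀ * k * (1 / 2 * mass 𝓑 (Finset.Icc 1 (2 * k)) (3 * k)) ≤
      goodMass 𝓑 (Finset.Icc 1 (2 * k)) (3 * k) t 0 := by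
    have h₁ : ∑ G ∈ M, c₀ * k * (G.weight - G.weight *
        (if c₀ * k ≤ (G.core.card : ℝ) then 0 else 1)) ≤
        goodMass 𝓑 (Finset.Icc 1 (2 * k)) (3 * k) t 0 := by
      refine Finset.sum_le_sum fun G hG => ?_
      split_ifs with hcore
      · have hv : 0 ∉ G.verts := by rw [(mem_members.mp hG).2.1]; simp
        have h₃ := card_core_mul_weight_le (h.connected hG) hv (t := t)
          (by exact_mod_cast ht.trans hcore) (by exact_mod_cast h2.trans hcore)
        refine le_trans ?_ h₃
        rw [mul_zero, sub_zero]
        exact mul_le_mul_of_nonneg_right hcore (weight_pos G).le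
      · simpa using goodRootWeight_nonneg t 0 G
    rw [← Finset.mul_sum, Finset.sum_sub_distrib] at h₁
    refine le_trans (mul_le_mul_of_nonneg_left ?_ (by positivity)) h₁
    change _ ≤ mass 𝓑 _ _ - _
    linarith
  have hrate : 3 * c₀ * c / (2 * γ) * (k * normCoeff 𝓑 γ c k) ≤ rate 𝓑 γ t k := by
    rw [mass_eq_coeff h.stable (by simp), h.coeff_eq,
      goodMass_eq_goodCoeff h.stable (by simp) (by simp)] at hgood
    have h₄ : c₀ * k * (1 / 2 * (c * γ ^ k * normCoeff 𝓑 γ c k)) ≤ goodCoeff 𝓑 t k := by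
      refine le_of_mul_le_mul_right (le_trans (le_of_eq ?_) hgood)
        (by positivity : (0 : ℝ) < (2 * k).factorial)
      ring
    rw [rate, le_div_iff₀ (by positivity)]
    calc 3 * c₀ * c / (2 * γ) * (k * normCoeff 𝓑 γ c k) * γ ^ (k + 1)
        = 3 * (c₀ * k * (1 / 2 * (c * γ ^ k * normCoeff 𝓑 γ c k))) := by
          rw [pow_succ]
          field_simp
      _ ≤ 3 * goodCoeff 𝓑 t k := by linarith
  refine le_trans ?_ hrate
  calc 3 * c₀ * c / (4 * γ) * (k : ℝ) ^ (1 - α)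
      = 3 * c₀ * c / (2 * γ) * (k * (1 / 2 * (k : ℝ) ^ (-α))) := by
        rw [sub_eq_add_neg, Real.rpow_add hk0, Real.rpow_one]
        field_simp
        ring
    _ ≤ _ := by
        refine mul_le_mul_of_nonneg_left (mul_le_mul_of_nonneg_left (hN₂ k hk₂) hk0.le)
          (by positivity)

/-- The number of good sets in a suitable window has large expectation. -/
theorem exists_window (h : Asymp 𝓑 α γ c) (R : ℝ) {ε : ℝ} (hε : 0 < ε) :
    ∃ a > 0, ∃ N : ℕ, ∀ n ≥ N, ∃ m m' t : ℕ, 1 ≤ m ∧ 2 ≤ t ∧ 2 * m' < 2 * m + t ∧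
      (m' : ℝ) + 1 ≤ ε * n ∧ a * (n : ℝ) ^ (1 / (α - 2)) ≤ t ∧
      R ≤ n * ∑ k ∈ Finset.Icc m m', rate 𝓑 γ t k := by
  have hα := h.hα
  have h0 : 0 < α - 2 := by linarith
  obtain ⟨c₀, hc₀, hc₁, C, hC, N₁, hrate⟩ := h.exists_rate_ge
  set C₁ := c₀ / 8 * C * 2 ^ (1 - α) with hC₁
  have hC₁0 : 0 < C₁ := by positivity
  obtain ⟨R', hR', hRR'⟩ : ∃ R' > 0, R ≤ R' := ⟨max R 1, by simp, le_max_left _ _⟩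
  -- Since sides of order about `a * n ^ (1 / (α - 2))` occur about `a ^ (2 - α)` times, a small `a`
  -- makes the mean as large as required; this `a` yields exactly `R'`.
  set a := (R' / C₁) ^ (-(1 / (α - 2))) / 2 with ha
  have ha0 : 0 < a := by positivity
  have hapow : C₁ * (2 * a) ^ (2 - α) = R' := by
    rw [ha, mul_div_cancel₀ _ (two_ne_zero), ← Real.rpow_mul (by positivity),
      show -(1 / (α - 2)) * (2 - α) = 1 by field_simp; ring, Real.rpow_one]
    field_simp
  have hβ : 0 < 1 / (α - 2) := by positivity
  have t₁ : Tendsto (fun n : ℕ => (n : ℝ) ^ (1 / (α - 2))) atTop atTop :=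
    (tendsto_rpow_atTop hβ).comp tendsto_natCast_atTop_atTop
  have t₂ : Tendsto (fun n : ℕ => (n : ℝ) ^ (-(1 - 1 / (α - 2)))) atTop (nhds 0) := by
    refine (tendsto_rpow_neg_atTop ?_).comp tendsto_natCast_atTop_atTop
    rw [sub_pos, div_lt_one h0]
    linarith
  have ev₁ := t₁.eventually_ge_atTop (max (max 1 (N₁ : ℝ)) (2 * 2 / c₀) / a)
  -- Here `α > 3` is used again: `n ^ (1 / (α - 2))` is of smaller order than `n`.
  have ev₂ := t₂.eventually_le_const (u := ε / (5 * a)) (by positivity)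
  obtain ⟨N, hN⟩ := eventually_atTop.mp (ev₁.and ev₂)
  refine ⟨c₀ * a / 2, by positivity, N + 1, fun n hn => ?_⟩
  obtain ⟨e₁, e₂⟩ := hN n (by omega)
  have hn0 : (0 : ℝ) < n := by exact_mod_cast (by omega : 0 < n)
  have hbn : a * (n : ℝ) ^ (1 / (α - 2)) * 5 ≤ ε * n := by
    rw [le_div_iff₀ (by positivity), neg_sub, Real.rpow_sub hn0, Real.rpow_one,
      div_mul_eq_mul_div, div_le_iff₀ hn0] at e₂
    linarith
  have hbpow : ((n : ℝ) ^ (1 / (α - 2))) ^ (2 - α) * n = 1 := by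
    rw [← Real.rpow_mul hn0.le, show 1 / (α - 2) * (2 - α) = -1 by field_simp; ring,
      Real.rpow_neg_one, inv_mul_cancel₀ hn0.ne']
  have hb0 : (0 : ℝ) < (n : ℝ) ^ (1 / (α - 2)) := by positivity
  generalize (n : ℝ) ^ (1 / (α - 2)) = b at *
  rw [div_le_iff₀' ha0, max_le_iff, max_le_iff] at e₁
  obtain ⟨⟨hab1, habN⟩, hab2⟩ := e₁
  obtain ⟨m, hmab, hmle⟩ : ∃ m : ℕ, a * b ≤ m ∧ (m : ℝ) ≤ 2 * (a * b) :=
    ⟨⌈a * b⌉₊, Nat.le_ceil _, by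
      have := (Nat.ceil_lt_add_one (by positivity : 0 ≤ a * b)).le
      linarith⟩
  have hm1 : (1 : ℝ) ≤ m := hab1.trans hmab
  have hmN : N₁ ≤ m := by exact_mod_cast habN.trans hmab
  have hcm : 4 ≤ c₀ * m := by
    rw [div_le_iff₀ hc₀] at hab2
    nlinarith
  obtain ⟨t, htle, htge⟩ : ∃ t : ℕ, (t : ℝ) ≤ c₀ * m ∧ c₀ * m ≤ t + 1 :=
    ⟨⌊c₀ * m⌋₊, Nat.floor_le (by positivity), (Nat.lt_floor_add_one _).le⟩
  have ht2 : 2 ≤ t := by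
    have : (2 : ℝ) ≤ t := by linarith
    exact_mod_cast this
  have htm : t ≤ m := by
    have : (t : ℝ) ≤ m := by nlinarith
    exact_mod_cast this
  -- The length `t / 4` satisfies `2 * (t / 4) < t`, as disjointness of good sides requires, and `t
  -- ≤ m` keeps the window within `[m, 2m]`. It still has at least `c₀ * m / 8` elements.
  refine ⟨m, m + t / 4, t, by exact_mod_cast hm1, ht2, by omega, ?_, by nlinarith, ?_⟩
  · have : ((m + t / 4 : ℕ) : ℝ) ≤ 2 * m := by exact_mod_cast (by omega : m + t / 4 ≤ 2 * m)
    linarith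
  · have hterm : ∀ k ∈ Finset.Icc m (m + t / 4), C * (2 * m : ℝ) ^ (1 - α) ≤ rate 𝓑 γ t k := by
      intro k hk
      rw [Finset.mem_Icc] at hk
      have hmk : (m : ℝ) ≤ k := by exact_mod_cast hk.1
      have hkm : (k : ℝ) ≤ 2 * m := by exact_mod_cast (by omega : k ≤ 2 * m)
      refine le_trans (mul_le_mul_of_nonneg_left ?_ hC.le)
        (hrate k (by omega) t (htle.trans (mul_le_mul_of_nonneg_left hmk hc₀.le)))
      exact Real.rpow_le_rpow_of_nonpos (by linarith) hkm (by linarith)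
    have hsum := Finset.card_nsmul_le_sum _ _ _ hterm
    rw [Nat.card_Icc, nsmul_eq_mul] at hsum
    have hcnt : c₀ * m / 8 ≤ ((m + t / 4 + 1 - m : ℕ) : ℝ) := by
      have : (t : ℝ) ≤ 4 * ((m + t / 4 + 1 - m : ℕ) : ℝ) := by
        exact_mod_cast (by omega : t ≤ 4 * (m + t / 4 + 1 - m))
      linarith
    calc R ≤ R' := hRR'
      _ = n * (C₁ * (2 * (a * b)) ^ (2 - α)) := by
          rw [← mul_assoc 2 a b, Real.mul_rpow (by positivity) hb0.le]
          linear_combination (-1 : ℝ) * hapow + (-C₁ * (2 * a) ^ (2 - α)) * hbpow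
      _ ≤ n * (C₁ * (m : ℝ) ^ (2 - α)) := by
          refine mul_le_mul_of_nonneg_left (mul_le_mul_of_nonneg_left ?_ hC₁0.le) hn0.le
          exact Real.rpow_le_rpow_of_nonpos (by linarith) hmle (by linarith)
      _ = n * (c₀ * m / 8 * (C * (2 * m : ℝ) ^ (1 - α))) := by
          rw [hC₁, show 2 - α = 1 + (1 - α) by ring, Real.rpow_add (by linarith), Real.rpow_one,
            Real.mul_rpow (by norm_num) (by linarith)]
          ring
      _ ≤ n * ∑ k ∈ Finset.Icc m (m + t / 4), rate 𝓑 γ t k := by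
          refine mul_le_mul_of_nonneg_left (le_trans ?_ hsum) hn0.le
          exact mul_le_mul_of_nonneg_right hcnt (by positivity)

/-- Chebyshev's inequality: with probability at least `1 - δ` there are at least `i` good sets, and
they lie around `i` distinct blocks of at least `t` vertices. -/
theorem isBigOmegaP_second (h : Asymp 𝓑 α γ c) {i : ℕ} (hi : 2 ≤ i) :
    IsBigOmegaP (prob 𝓑) (fun _ H => (blockOrder i H : ℝ))
      (fun n => (n : ℝ) ^ (1 / (α - 2))) := by
  intro δ hδ
  have hα := h.hα
  -- The final bound is `12η + 4 (1 + η) / μ`; with `μ ≥ 16 / δ` both summands are at most `δ / 2`.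
  set η := min 1 (δ / 24) with hη
  have hη0 : 0 < η := by positivity
  have hη1 : η ≤ 1 := min_le_left _ _
  have hηδ : η ≤ δ / 24 := min_le_right _ _
  clear_value η
  obtain ⟨θ, hθ, -, N₁, hratio⟩ := h.powerLike.exists_ratio (by linarith) hη0
  -- `μ ≥ 2i` makes fewer than `i` good sets a deviation of at least `μ / 2`. The bound `θ / 2` on
  -- the window is for the ratio estimate, and `1 / 6` for the conditions comparing `m'` with `n`.
  obtain ⟨a, ha, N₂, hwin⟩ := h.exists_window (max (2 * i) (16 / δ))
    (ε := min (θ / 2) (1 / 6)) (by positivity)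
  obtain ⟨C, -, N₃, hpos⟩ := h.exists_goodSum_le
  refine ⟨a, ha, max N₁ (max N₂ (max N₃ 2)), fun n hn => ?_⟩
  simp only [ge_iff_le, max_le_iff] at hn
  obtain ⟨hn₁, hn₂, hn₃, hn2⟩ := hn
  obtain ⟨m, m', t, hm, ht2, htw, hm'n, hta, hR⟩ := hwin n hn₂
  have hn0 : (0 : ℝ) < n := by exact_mod_cast (by omega : 0 < n)
  have hm'6 : 6 * (m' : ℝ) + 6 ≤ n := by
    have := mul_le_mul_of_nonneg_right (min_le_right (θ / 2) (1 / 6)) hn0.le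
    linarith
  have hm'6' : 6 * m' + 6 ≤ n := by exact_mod_cast hm'6
  have hm'θ : 2 * (m' : ℝ) + 2 ≤ θ * n := by
    have := mul_le_mul_of_nonneg_right (min_le_left (θ / 2) (1 / 6)) hn0.le
    linarith
  have hvar := h.sum_sq_le hm htw (by omega) hη0 hm'θ (hratio n hn₁) rfl
  set μ := n * ∑ k ∈ Finset.Icc m m', rate 𝓑 γ t k with hμ
  clear_value μ
  obtain ⟨hRi, hRδ⟩ := max_le_iff.mp hR
  have hμ0 : 0 < μ := lt_of_lt_of_le (by positivity) hRδ
  obtain ⟨hmass, -⟩ := hpos n hn₃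
  refine one_sub_le_prob hmass
    (fun G => 4 / μ ^ 2 * (((G.goodSets (Finset.Icc m m') t).card : ℝ) - μ) ^ 2)
    (fun G _ => by positivity) (fun G hG hE => ?_) ?_
  · by_contra! hlt
    refine hE ?_
    have h₁ : (i : ℝ) ≤ (G.goodSets (Finset.Icc m m') t).card := by
      by_contra! hX
      have h₂ : μ / 2 ≤ μ - (G.goodSets (Finset.Icc m m') t).card := by linarith
      rw [div_mul_eq_mul_div, div_lt_one (by positivity)] at hlt
      nlinarith
    have h₂ : i ≤ (G.goodSets (Finset.Icc m m') t).card := by exact_mod_cast h₁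
    have hV : G.verts.card = 2 * n := by rw [(mem_members.mp hG).2.1]; simp
    have h₃ := card_goodSets_le (h.connected hG) (h.isCubic hG).degree_le htw
      (by rw [hV]; omega) ht2
    have h₄ : t ≤ blockOrder i G := (le_blockOrder_iff G (by omega) i).mpr (by omega)
    have h₅ : (t : ℝ) ≤ blockOrder i G := by exact_mod_cast h₄
    change a * _ ≤ |(blockOrder i G : ℝ)|
    rw [abs_of_nonneg (Nat.cast_nonneg _)]
    exact hta.trans h₅
  · have h₁ : 16 ≤ μ * δ := by rwa [div_le_iff₀ hδ] at hRδ
    calc ∑ G ∈ members 𝓑 (Finset.Icc 1 (2 * n)) (3 * n), G.weight *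
          (4 / μ ^ 2 * (((G.goodSets (Finset.Icc m m') t).card : ℝ) - μ) ^ 2)
        = 4 / μ ^ 2 * ∑ G ∈ members 𝓑 (Finset.Icc 1 (2 * n)) (3 * n), G.weight *
          (((G.goodSets (Finset.Icc m m') t).card : ℝ) - μ) ^ 2 := by
          rw [Finset.mul_sum]
          exact Finset.sum_congr rfl fun G _ => by ring
      _ ≤ 4 / μ ^ 2 * ((3 * η * μ ^ 2 + (1 + η) * μ) *
          mass 𝓑 (Finset.Icc 1 (2 * n)) (3 * n)) :=
          mul_le_mul_of_nonneg_left hvar (by positivity)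
      _ = (12 * η + 4 * (1 + η) / μ) * mass 𝓑 (Finset.Icc 1 (2 * n)) (3 * n) := by
          field_simp
          ring
      _ ≤ δ * mass 𝓑 (Finset.Icc 1 (2 * n)) (3 * n) := by
          refine mul_le_mul_of_nonneg_right ?_ hmass.le
          have h₂ : 4 * (1 + η) / μ ≤ δ / 2 := by
            rw [div_le_iff₀ hμ0]
            nlinarith
          linarith

end Asymp
end Multigraph

theorem lemma7p10 (𝓑 : Set Multigraph) (α : ℝ) (hα : 3 < α)
    (h𝓑 : Multigraph.IsBridgeStable 𝓑 α)
    (hcubic : ∀ n : ℕ, ∀ H ∈ Multigraph.ofSize 𝓑 (2 * n) (3 * n), H.IsCubic) :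
    IsThetaP (Multigraph.prob 𝓑) (fun _ H => (Multigraph.blockOrder 1 H : ℝ))
        (fun n => (n : ℝ)) ∧
      ∀ i : ℕ, 2 ≤ i →
        IsThetaP (Multigraph.prob 𝓑) (fun _ H => (Multigraph.blockOrder i H : ℝ))
          (fun n => (n : ℝ) ^ (1 / (α - 2))) := by
  obtain ⟨γ, c, hγ, hc, hpow⟩ := Multigraph.exists_powerLike h𝓑
  have h : Multigraph.Asymp 𝓑 α γ c := ⟨h𝓑, hcubic, hα, hγ, hc, hpow⟩
  exact ⟨h.isThetaP_largest, fun i hi => ⟨h.isBigOP_second hi, h.isBigOmegaP_second hi⟩⟩
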